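/- Let $k$ be an even integer, $\mathbb T\subset\mathbb C$ the circle group with Lie algebra $2\pi i\,\mathbb R$, Maurer–Cartan form $\vartheta=z^{-1}dz$ and pairing $\langle a,b\rangle=\frac{1}{4\pi^2}ab$ on the Lie algebra. For a closed (compact, without boundary, not necessarily connected) oriented smooth surface $\Sigma$, a $2\pi i\,\mathbb R$-valued $1$-form $\alpha$ on $\Sigma$ and a smooth map $\lambda:\Sigma\to\mathbb T$ put $$c_\Sigma(\alpha,\lambda)=\exp\Big(\pi i k\int_\Sigma\langle\alpha\wedge\lambda^*\vartheta\rangle\Big)\in\mathbb T .$$ This satisfies the cocycle identity $c_\Sigma(\alpha,\lambda_1\lambda_2)=c_\Sigma(\alpha,\lambda_1)\,c_\Sigma(\alpha+\lambda_1^*\vartheta,\lambda_2)$. For a connection $\eta$ on a trivializable principal $\mathbb T$-bundle $Q\to\Sigma$, with set of smooth sections $\Gamma(\Sigma;Q)$, let $L_\eta=L_{\Sigma,\eta}$ be the space of functions $f:\Gamma(\Sigma;Q)\to\mathbb C$ such that $f(s_1)=f(s)\,c_\Sigma(s^*\eta,\lambda)$ whenever $s_1=s\cdot\lambda$. Then $L_\eta$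 is a complex line, and $(f_1,f_2)=\overline{f_1(s)}f_2(s)$ is a hermitian inner product on it that does not depend on $s\in\Gamma(\Sigma;Q)$. As $\eta$ varies over the affine Fréchet space $\mathcal A_Q$ of connections on $Q$, the lines $L_\eta$ fit together smoothly into a hermitian line bundle over $\mathcal A_Q$, for which $(\eta,f)\mapsto(\eta,f(s))$ is a smooth unitary trivialization for every section $s$. Moreover: (a) Functoriality. Let $\psi:Q'\to Q$ be a morphism between trivializable $\mathbb T$-bundles covering an orientation preserving diffeomorphism $\bar\psi:\Sigma'\to\Sigma$ of closed oriented surfaces, and let $\eta$ be a connection on $Q$. Then $(\psi^*f)(s')=f(\psi\circ s'\circ\bar\psi^{-1})$, for $s'\in\Gamma(\Sigma';Q')$, defines an isometry $\psi^*:L_\eta\to L_{\psi^*\eta}$. (b) Orientation. If $-\Sigma$ denotes $\Sigma$ with the opposite orientation, then $f\mapsto\bar f$ defines an isometry $L_{-\Sigma,\eta}\cong\overline{L_{\Sigma,\eta}}$ onto the conjugate line. (c) Disjoint union. If $\eta_i$ are connections on trivializable $\mathbb T$-bundles over closed oriented surfaces $\Sigma_i$, $i=1,2$, then there is an isometry $L_{\eta_1}\otimes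 L_{\eta_2}\cong L_{\eta_1\sqcup\eta_2}$ that carries $f_1\otimes f_2$ to the function $f$ with $f(s_1\sqcup s_2)=f_1(s_1)f_2(s_2)$. -/

import Mathlib

open scoped Manifold ContDiff Topology ComplexConjugate TensorProduct
open Set

noncomputable section

namespace CSLines

section Forms
variable {E H E' H' E'' H'' F : Type*}
  [NormedAddCommGroup E] [NormedSpace ℝ E] [TopologicalSpace H]
  [NormedAddCommGroup E'] [NormedSpace ℝ E'] [TopologicalSpace H']
  [NormedAddCommGroup E''] [NormedSpace ℝ E''] [TopologicalSpace H'']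
  [NormedAddCommGroup F] [NormedSpace ℝ F]

/-- A smooth 1-form on `M` with values in `F`: a linear form on every tangent space, such that the
resulting function on the total space of the tangent bundle is smooth. -/
structure OneForm (I : ModelWithCorners ℝ E H) (M : Type*) [TopologicalSpace M] [ChartedSpace H M]
    [IsManifold I ∞ M] (F : Type*) [NormedAddCommGroup F] [NormedSpace ℝ F] where
  toFun : ∀ x : M, TangentSpace I x →L[ℝ] F
  smooth' : ContMDiff I.tangent 𝓘(ℝ, F) ∞ (fun v : TangentBundle I M => toFun v.proj v.snd)

namespace OneForm

variable {I : ModelWithCorners ℝ E H} {M : Type*} [TopologicalSpace M] [ChartedSpace H M]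
    [IsManifold I ∞ M]
  {I' : ModelWithCorners ℝ E' H'} {M' : Type*} [TopologicalSpace M'] [ChartedSpace H' M']
    [IsManifold I' ∞ M']
  {I'' : ModelWithCorners ℝ E'' H''} {M'' : Type*} [TopologicalSpace M''] [ChartedSpace H'' M'']
    [IsManifold I'' ∞ M'']

instance : CoeFun (OneForm I M F) (fun _ => ∀ x : M, TangentSpace I x →L[ℝ] F) := ⟨toFun⟩

@[ext] theorem ext {α β : OneForm I M F} (h : ∀ x v, α x v = β x v) : α = β := by
  cases α; cases β
  congr 1
  funext x
  exact ContinuousLinearMap.ext (h x)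

instance : Zero (OneForm I M F) := ⟨⟨fun _ => 0, contMDiff_const⟩⟩
instance : Add (OneForm I M F) := ⟨fun α β => ⟨fun x => α x + β x, α.smooth'.add β.smooth'⟩⟩
instance : Neg (OneForm I M F) := ⟨fun α => ⟨fun x => -α x, α.smooth'.neg⟩⟩
instance : SMul ℝ (OneForm I M F) :=
  ⟨fun c α => ⟨fun x => c • α x,
    ((c • ContinuousLinearMap.id ℝ F).contMDiff (n := ∞)).comp α.smooth'⟩⟩

@[simp] theorem zero_apply (x : M) (v : TangentSpace I x) : (0 : OneForm I M F) x v = 0 := rfl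
@[simp] theorem add_apply (α β : OneForm I M F) (x : M) (v : TangentSpace I x) :
    (α + β) x v = α x v + β x v := rfl
@[simp] theorem neg_apply (α : OneForm I M F) (x : M) (v : TangentSpace I x) :
    (-α) x v = -α x v := rfl
@[simp] theorem smul_apply (c : ℝ) (α : OneForm I M F) (x : M) (v : TangentSpace I x) :
    (c • α) x v = c • α x v := rfl

instance : AddCommGroup (OneForm I M F) where
  add_assoc α β γ := by ext; simp [add_assoc]
  zero_add α := by ext; simp
  add_zero α := by ext; simp
  neg_add_cancel α := by ext; simp
  add_comm α β := by ext; simp [add_comm]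
  nsmul := nsmulRec
  zsmul := zsmulRec

instance : Module ℝ (OneForm I M F) where
  one_smul α := by ext; simp
  mul_smul a b α := by ext; simp [mul_smul]
  smul_zero a := by ext; simp
  smul_add a α β := by ext; simp
  add_smul a b α := by ext; simp [add_smul]
  zero_smul α := by ext; simp

/-- The pullback `f^* α` of a 1-form by a smooth map. -/
def pullback (f : M → M') (hf : ContMDiff I I' ∞ f) (α : OneForm I' M' F) : OneForm I M F where
  toFun x := (α (f x)).comp (mfderiv I I' f x)
  smooth' := α.smooth'.comp (hf.contMDiff_tangentMap (by simp))

@[simp] theorem pullback_apply (f : M → M') (hf : ContMDiff I I' ∞ f) (α : OneForm I' M' F) (x : M)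
    (v : TangentSpace I x) : pullback f hf α x v = α (f x) (mfderiv I I' f x v) := rfl

theorem pullback_pullback (f : M → M') (hf : ContMDiff I I' ∞ f) (g : M' → M'')
    (hg : ContMDiff I' I'' ∞ g) (α : OneForm I'' M'' F) :
    pullback f hf (pullback g hg α) = pullback (g ∘ f) (hg.comp hf) α := by
  ext x v
  have := mfderiv_comp x ((hg (f x)).mdifferentiableAt (by simp))
    ((hf x).mdifferentiableAt (by simp))
  simp only [pullback_apply, this]
  rfl

theorem pullback_add (f : M → M') (hf : ContMDiff I I' ∞ f) (α β : OneForm I' M' F) :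
    pullback f hf (α + β) = pullback f hf α + pullback f hf β := rfl

theorem pullback_const (c : M') (α : OneForm I' M' F) :
    pullback (I := I) (fun _ : M => c) contMDiff_const α = 0 := by
  ext x v
  simp only [pullback_apply, mfderiv_const, zero_apply]
  exact map_zero _

theorem pullback_congr {f g : M → M'} (hf : ContMDiff I I' ∞ f) (hg : ContMDiff I I' ∞ g)
    (h : f = g) (α : OneForm I' M' F) : pullback f hf α = pullback g hg α := by
  subst h; rfl

/-- The 1-form `α ⊔ β` on the disjoint union `M ⊔ N`. The differential of either inclusion is the
identity of the model space, so that the tangent space of `M ⊔ N` at a point of `M` is literally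
that of `M`. -/
def sum {N : Type*} [TopologicalSpace N] [ChartedSpace H N] [IsManifold I ∞ N]
    (α : OneForm I M F) (β : OneForm I N F) : OneForm I (M ⊕ N) F where
  toFun x := match x with
    | Sum.inl p => (show TangentSpace I p →L[ℝ] F from α p)
    | Sum.inr p => (show TangentSpace I p →L[ℝ] F from β p)
  smooth' := by
    rintro ⟨x, v⟩
    rcases x with p | p
    · have hr : ContMDiff I I ∞ (Sum.elim id (fun _ : N => p)) :=
        contMDiff_id.sumElim contMDiff_const
      refine ((α.pullback _ hr).smooth' _).congr_of_eventuallyEq ?_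
      have hopen : IsOpen {w : TangentBundle I (M ⊕ N) | w.proj ∈ Set.range Sum.inl} :=
        isOpen_range_inl.preimage (FiberBundle.continuous_proj E (TangentSpace I (M := M ⊕ N)))
      filter_upwards [hopen.mem_nhds ⟨p, rfl⟩] with w hw
      obtain ⟨_, w⟩ := w
      obtain ⟨q, rfl⟩ := hw
      have h1 : mfderiv I I ((Sum.elim id (fun _ : N => p)) ∘ (Sum.inl : M → M ⊕ N)) q
          = ContinuousLinearMap.id ℝ _ := by
        rw [Sum.elim_comp_inl]; exact mfderiv_id
      rw [mfderiv_comp q (I' := I) ((hr _).mdifferentiableAt (by simp))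
        hasMFDerivAt_inl.mdifferentiableAt, hasMFDerivAt_inl.mfderiv] at h1
      have h2 := congrArg (fun L : E →L[ℝ] E => L w) h1
      exact congrArg (α q) h2.symm
    · have hr : ContMDiff I I ∞ (Sum.elim (fun _ : M => p) id) :=
        contMDiff_const.sumElim contMDiff_id
      refine ((β.pullback _ hr).smooth' _).congr_of_eventuallyEq ?_
      have hopen : IsOpen {w : TangentBundle I (M ⊕ N) | w.proj ∈ Set.range Sum.inr} :=
        isOpen_range_inr.preimage (FiberBundle.continuous_proj E (TangentSpace I (M := M ⊕ N)))
      filter_upwards [hopen.mem_nhds ⟨p, rfl⟩] with w hw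
      obtain ⟨_, w⟩ := w
      obtain ⟨q, rfl⟩ := hw
      have h1 : mfderiv I I ((Sum.elim (fun _ : M => p) id) ∘ (Sum.inr : N → M ⊕ N)) q
          = ContinuousLinearMap.id ℝ _ := by
        rw [Sum.elim_comp_inr]; exact mfderiv_id
      rw [mfderiv_comp q (I' := I) ((hr _).mdifferentiableAt (by simp))
        hasMFDerivAt_inr.mdifferentiableAt, hasMFDerivAt_inr.mfderiv] at h1
      have h2 := congrArg (fun L : E →L[ℝ] E => L w) h1
      exact congrArg (β q) h2.symm

theorem pullback_inl_sum {N : Type*} [TopologicalSpace N] [ChartedSpace H N] [IsManifold I ∞ N]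
    (α : OneForm I M F) (β : OneForm I N F) :
    pullback (Sum.inl : M → M ⊕ N) ContMDiff.inl (α.sum β) = α := by
  ext x v
  rw [pullback_apply, hasMFDerivAt_inl.mfderiv]
  rfl

theorem pullback_inr_sum {N : Type*} [TopologicalSpace N] [ChartedSpace H N] [IsManifold I ∞ N]
    (α : OneForm I M F) (β : OneForm I N F) :
    pullback (Sum.inr : N → M ⊕ N) ContMDiff.inr (α.sum β) = β := by
  ext x v
  rw [pullback_apply, hasMFDerivAt_inr.mfderiv]
  rfl

theorem ext_sum {N : Type*} [TopologicalSpace N] [ChartedSpace H N] [IsManifold I ∞ N]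
    {α β : OneForm I (M ⊕ N) F}
    (h1 : pullback (Sum.inl : M → M ⊕ N) ContMDiff.inl α = pullback Sum.inl ContMDiff.inl β)
    (h2 : pullback (Sum.inr : N → M ⊕ N) ContMDiff.inr α = pullback Sum.inr ContMDiff.inr β) :
    α = β := by
  ext x v
  rcases x with p | p
  · have h := congrArg (fun γ : OneForm I M F => γ p (show TangentSpace I p from v)) h1
    rw [pullback_apply, pullback_apply, hasMFDerivAt_inl.mfderiv] at h
    exact h
  · have h := congrArg (fun γ : OneForm I N F => γ p (show TangentSpace I p from v)) h2
    rw [pullback_apply, pullback_apply, hasMFDerivAt_inr.mfderiv] at h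
    exact h

end OneForm
end Forms

/-- The Lie algebra `2πi ℝ` of the circle group, as a real line in `ℂ`. -/
abbrev LieT : Submodule ℝ ℂ := LinearMap.ker Complex.reLm

theorem contMDiff_coe_circle :
    ContMDiff (𝓡 1) 𝓘(ℝ, ℂ) ∞ (fun z : Circle => (z : ℂ)) := by
  have : Fact (Module.finrank ℝ ℂ = 1 + 1) := ⟨by simp⟩
  exact contMDiff_coe_sphere

/-- The differential `dz` of the inclusion of the circle group into `ℂ`. -/
def circleDz (z : Circle) : EuclideanSpace ℝ (Fin 1) →L[ℝ] ℂ :=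
  mfderiv (𝓡 1) 𝓘(ℝ, ℂ) (fun z : Circle => (z : ℂ)) z

theorem inv_mul_circleDz_mem (z : Circle) (v : EuclideanSpace ℝ (Fin 1)) :
    (z : ℂ)⁻¹ * circleDz z v ∈ LieT := by
  have hd : MDifferentiableAt (𝓡 1) 𝓘(ℝ, ℂ) (fun z : Circle => (z : ℂ)) z :=
    (contMDiff_coe_circle z).mdifferentiableAt (by simp)
  have hN : HasFDerivAt (fun w : ℂ => ‖w‖ ^ 2) _ (z : ℂ) :=
    (hasStrictFDerivAt_norm_sq (z : ℂ)).hasFDerivAt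
  have h := hN.hasMFDerivAt.comp z hd.hasMFDerivAt
  have hc : (fun w : ℂ => ‖w‖ ^ 2) ∘ (fun z : Circle => (z : ℂ)) = fun _ => (1 : ℝ) := by
    funext w
    change ‖(w : ℂ)‖ ^ 2 = 1
    rw [Circle.norm_coe, one_pow]
  have h' := h.congr_of_eventuallyEq (f₁ := fun _ => (1 : ℝ)) (by rw [← hc])
  have h0 := hasMFDerivAt_unique h' (hasMFDerivAt_const (1 : ℝ) z)
  have h1 := congrArg (fun L : EuclideanSpace ℝ (Fin 1) →L[ℝ] ℝ => L v) h0
  have h2 : (2 • innerSL ℝ (z : ℂ)) (circleDz z v) = 0 := h1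
  rw [← Circle.coe_inv, Circle.coe_inv_eq_conj]
  simp [Complex.inner] at h2
  simp [LinearMap.mem_ker]
  linarith

/-- The Maurer-Cartan form `ϑ = z⁻¹ dz` of the circle group. -/
def maurerCartan : OneForm (𝓡 1) Circle LieT where
  toFun z := ((ContinuousLinearMap.mul ℝ ℂ (z : ℂ)⁻¹).comp (circleDz z)).codRestrict LieT
    (inv_mul_circleDz_mem z)
  smooth' := by
    let P : ℂ →L[ℝ] LieT := LieT.orthogonalProjectionOnto
    have h1 : ContMDiff (𝓡 1).tangent 𝓘(ℝ, ℂ) ∞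
        (fun v : TangentBundle (𝓡 1) Circle => circleDz v.proj v.snd) := by
      have := (contMDiff_snd_tangentBundle_modelSpace ℂ 𝓘(ℝ, ℂ) (n := ∞)).comp
        (contMDiff_coe_circle.contMDiff_tangentMap (m := ∞) (by simp))
      exact this
    have h2 : ContMDiff (𝓡 1).tangent 𝓘(ℝ, ℂ) ∞
        (fun v : TangentBundle (𝓡 1) Circle => ((v.proj : Circle) : ℂ)⁻¹) := by
      have h3 : ContMDiff (𝓡 1) 𝓘(ℝ, ℂ) ∞ (fun z : Circle => ((z⁻¹ : Circle) : ℂ)) :=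
        contMDiff_coe_circle.comp (contMDiff_inv (𝓡 1) ∞)
      simp only [Circle.coe_inv] at h3
      exact h3.comp (Bundle.contMDiff_proj (TangentSpace (𝓡 1) (M := Circle)))
    have h4 := P.contMDiff.comp (contDiff_mul.contMDiff.comp (h2.prodMk_space h1))
    refine h4.congr fun v => ?_
    exact (Submodule.orthogonalProjectionOnto_mem_subspace_eq_self (K := LieT) ⟨_, _⟩).symm

/-! ### Closed oriented surfaces and integration of 2-forms -/

/-- The model space of surfaces. -/
abbrev R2 := EuclideanSpace ℝ (Fin 2)

/-- The sign (`1` or `-1` for a basis, `0` otherwise) of a pair of vectors with respect to an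
orientation. -/
def frameSign {V : Type*} [AddCommGroup V] [Module ℝ V] (o : Orientation ℝ V (Fin 2))
    (v : Fin 2 → V) : ℝ :=
  Real.sign (Module.Ray.someVector (R := ℝ) (M := V [⋀^Fin 2]→ₗ[ℝ] ℝ) o v)

theorem frameSign_neg {V : Type*} [AddCommGroup V] [Module ℝ V] (o : Orientation ℝ V (Fin 2))
    (v : Fin 2 → V) : frameSign (-o) v = -frameSign o v := by
  have h : SameRay ℝ (Module.Ray.someVector (-o)) (-(Module.Ray.someVector o)) := by
    refine (ray_eq_iff (Module.Ray.someVector_ne_zero _)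
      (neg_ne_zero.2 (Module.Ray.someVector_ne_zero _))).1 ?_
    rw [Module.Ray.someVector_ray,
      ← neg_rayOfNeZero ℝ _ (Module.Ray.someVector_ne_zero _), Module.Ray.someVector_ray]
  obtain ⟨r, hr, h⟩ := h.exists_pos_left (Module.Ray.someVector_ne_zero _)
    (neg_ne_zero.2 (Module.Ray.someVector_ne_zero _))
  have h1 := congrArg (fun f => Real.sign (f v)) h
  simp only [AlternatingMap.smul_apply, AlternatingMap.neg_apply, smul_eq_mul] at h1
  rw [frameSign, frameSign, ← Real.sign_neg, ← h1]
  rcases lt_trichotomy ((Module.Ray.someVector (-o)) v) 0 with h2 | h2 | h2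
  · rw [Real.sign_of_neg h2, Real.sign_of_neg (mul_neg_of_pos_of_neg hr h2)]
  · rw [h2, mul_zero]
  · rw [Real.sign_of_pos h2, Real.sign_of_pos (mul_pos hr h2)]

section Surfaces

variable {S : Type*} [TopologicalSpace S] [ChartedSpace R2 S]

/-- The coordinate frame `(∂/∂y₀, ∂/∂y₁)` at the point `x` in the domain of the chart `e`. -/
def chartFrame (e : OpenPartialHomeomorph S R2) (x : S) (i : Fin 2) : TangentSpace (𝓡 2) x :=
  (mfderiv (𝓡 2) (𝓡 2) e.symm (e x) : R2 →L[ℝ] R2) (EuclideanSpace.single i 1)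

theorem chartFrame_inl {S' : Type*} [TopologicalSpace S'] [ChartedSpace R2 S']
    [IsManifold (𝓡 2) ∞ S] [IsManifold (𝓡 2) ∞ S'] (x₀ x : S)
    (hx : x ∈ (chartAt R2 x₀).source) (i : Fin 2) :
    (chartFrame (chartAt R2 x₀) x i : R2) =
      chartFrame ((chartAt R2 x₀).lift_openEmbedding
        (Topology.IsOpenEmbedding.inl (X := S) (Y := S'))) (Sum.inl x) i := by
  have : Nonempty R2 := inferInstance
  unfold chartFrame
  rw [OpenPartialHomeomorph.lift_openEmbedding_apply, OpenPartialHomeomorph.lift_openEmbedding_symm]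
  have hd : MDifferentiableAt (𝓡 2) (𝓡 2) (chartAt R2 x₀).symm (chartAt R2 x₀ x) :=
    mdifferentiableAt_atlas_symm (chart_mem_atlas R2 x₀) ((chartAt R2 x₀).map_source hx)
  rw [mfderiv_comp _ hasMFDerivAt_inl.mdifferentiableAt hd, hasMFDerivAt_inl.mfderiv]
  rfl

theorem chartFrame_inr {S' : Type*} [TopologicalSpace S'] [ChartedSpace R2 S']
    [IsManifold (𝓡 2) ∞ S] [IsManifold (𝓡 2) ∞ S'] (x₀ x : S')
    (hx : x ∈ (chartAt R2 x₀).source) (i : Fin 2) :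
    (chartFrame (chartAt R2 x₀) x i : R2) =
      chartFrame ((chartAt R2 x₀).lift_openEmbedding
        (Topology.IsOpenEmbedding.inr (X := S) (Y := S'))) (Sum.inr x) i := by
  have : Nonempty R2 := inferInstance
  unfold chartFrame
  rw [OpenPartialHomeomorph.lift_openEmbedding_apply, OpenPartialHomeomorph.lift_openEmbedding_symm]
  have hd : MDifferentiableAt (𝓡 2) (𝓡 2) (chartAt R2 x₀).symm (chartAt R2 x₀ x) :=
    mdifferentiableAt_atlas_symm (chart_mem_atlas R2 x₀) ((chartAt R2 x₀).map_source hx)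
  rw [mfderiv_comp _ hasMFDerivAt_inr.mdifferentiableAt hd, hasMFDerivAt_inr.mfderiv]
  rfl

variable (S) in
/-- An orientation of the surface `S`: an orientation of every tangent space which is locally
constant in the charts of the atlas. -/
structure SurfaceOrientation where
  toFun : ∀ x : S, Orientation ℝ (TangentSpace (𝓡 2) x) (Fin 2)
  continuousOn' : ∀ x₀ : S, ContinuousOn
    (fun x => frameSign (toFun x) (chartFrame (chartAt R2 x₀) x)) (chartAt R2 x₀).source

namespace SurfaceOrientation

instance : CoeFun (SurfaceOrientation S)
    (fun _ => ∀ x : S, Orientation ℝ (TangentSpace (𝓡 2) x) (Fin 2)) := ⟨toFun⟩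

/-- The opposite orientation. -/
instance : Neg (SurfaceOrientation S) where
  neg o :=
    { toFun := fun x => -(o x)
      continuousOn' := fun x₀ => by
        simp only [frameSign_neg]
        exact (o.continuousOn' x₀).neg }

/-- The orientation of the disjoint union of two oriented surfaces. -/
def sum {S' : Type*} [TopologicalSpace S'] [ChartedSpace R2 S'] 
    [IsManifold (𝓡 2) ∞ S] [IsManifold (𝓡 2) ∞ S']
    (o : SurfaceOrientation S)
    (o' : SurfaceOrientation S') : SurfaceOrientation (S ⊕ S') where
  toFun x := match x with
    | Sum.inl p => (show Orientation ℝ (TangentSpace (𝓡 2) p) (Fin 2) from o p)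
    | Sum.inr p => (show Orientation ℝ (TangentSpace (𝓡 2) p) (Fin 2) from o' p)
  continuousOn' := by
    rintro (x₀ | x₀)
    · rw [ChartedSpace.sum_chartAt_inl, OpenPartialHomeomorph.lift_openEmbedding_source]
      rintro _ ⟨x, hx, rfl⟩
      refine ContinuousAt.continuousWithinAt ?_
      rw [← Topology.IsOpenEmbedding.inl.continuousAt_iff]
      refine ((o.continuousOn' x₀).continuousAt
        ((chartAt R2 x₀).open_source.mem_nhds hx)).congr ?_
      filter_upwards [(chartAt R2 x₀).open_source.mem_nhds hx] with y hy
      exact congrArg (frameSign (o y)) (funext fun i => chartFrame_inl _ y hy i)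
    · rw [ChartedSpace.sum_chartAt_inr, OpenPartialHomeomorph.lift_openEmbedding_source]
      rintro _ ⟨x, hx, rfl⟩
      refine ContinuousAt.continuousWithinAt ?_
      rw [← Topology.IsOpenEmbedding.inr.continuousAt_iff]
      refine ((o'.continuousOn' x₀).continuousAt
        ((chartAt R2 x₀).open_source.mem_nhds hx)).congr ?_
      filter_upwards [(chartAt R2 x₀).open_source.mem_nhds hx] with y hy
      exact congrArg (frameSign (o' y)) (funext fun i => chartFrame_inr _ y hy i)

/-- The diffeomorphism `f` carries positive frames to positive frames. -/
def IsPreservedBy {S' : Type*} [TopologicalSpace S'] [ChartedSpace R2 S']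
    (o' : SurfaceOrientation S') (o : SurfaceOrientation S)
    (f : Diffeomorph (𝓡 2) (𝓡 2) S' S ∞) : Prop :=
  ∀ (x : S') (v : Fin 2 → TangentSpace (𝓡 2) x),
    frameSign (o (f x)) (fun i => mfderiv (𝓡 2) (𝓡 2) f x (v i)) = frameSign (o' x) v

end SurfaceOrientation

/-- The bilinear form `⟨a, b⟩ = ab / (4π²)` on the Lie algebra of the circle group. -/
def liePairing (a b : LieT) : ℝ := ((a : ℂ) * (b : ℂ)).re / (4 * Real.pi ^ 2)

/-- The real 2-form `⟨α ∧ β⟩`, that is,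
`⟨α ∧ β⟩ (v, w) = ⟨α v, β w⟩ - ⟨α w, β v⟩`. -/
def wedgePairing [IsManifold (𝓡 2) ∞ S] (α β : OneForm (𝓡 2) S LieT) (x : S) :
    (TangentSpace (𝓡 2) x) [⋀^Fin 2]→ₗ[ℝ] ℝ where
  toFun v := liePairing (α x (v 0)) (β x (v 1)) - liePairing (α x (v 1)) (β x (v 0))
  map_update_add' v i a b := by
    fin_cases i <;> simp [liePairing, Function.update] <;> ring
  map_update_smul' v i c a := by
    fin_cases i <;> simp [liePairing, Function.update] <;> ring
  map_eq_zero_of_eq' v i j h hij := by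
    fin_cases i <;> fin_cases j <;> simp_all

variable (S) in
/-- A smooth partition of unity, indexed by the points of `S`, such that the function with index `x`
is supported in the domain of the preferred chart at `x`. -/
def chartPartition [IsManifold (𝓡 2) ∞ S] [CompactSpace S] [T2Space S] :
    SmoothPartitionOfUnity S (𝓡 2) S :=
  (SmoothPartitionOfUnity.exists_isSubordinate_chartAt_source (𝓡 2) S).choose

/-- The integral of a 2-form over a closed oriented surface, through a partition of unity subordinate
to coordinate charts. The chart at `x₀` need not be positively oriented: its coordinate expression
enters with the sign of its coordinate frame. -/
def surfaceIntegral [IsManifold (𝓡 2) ∞ S] [CompactSpace S] [T2Space S]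
    (o : SurfaceOrientation S) (w : ∀ x : S, (TangentSpace (𝓡 2) x) [⋀^Fin 2]→ₗ[ℝ] ℝ) : ℝ :=
  ∑ᶠ x₀ : S, ∫ y in (chartAt R2 x₀).target,
    (fun x : S => chartPartition S x₀ x *
      (frameSign (o x) (chartFrame (chartAt R2 x₀) x) * w x (chartFrame (chartAt R2 x₀) x)))
      ((chartAt R2 x₀).symm y)

end Surfaces


/-! ### Principal circle bundles, sections and connections -/

/-- The model with corners of the total spaces of circle bundles over surfaces. -/
abbrev I3 := (𝓡 2).prod (𝓡 1)

section Bundles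

/-- The map `π : P → S` and the action of the circle group on `P` are trivial over `U`: there is an
equivariant diffeomorphism `φ : U × 𝕋 → π⁻¹ U` over `U`, with inverse `(π, τ)`. -/
def IsTrivialOver {S P : Type*} [TopologicalSpace S] [ChartedSpace R2 S] [TopologicalSpace P]
    [ChartedSpace (ModelProd R2 (EuclideanSpace ℝ (Fin 1))) P] [SMul Circle P]
    (π : P → S) (U : Set S) : Prop :=
  ∃ (φ : S × Circle → P) (τ : P → Circle),
    ContMDiffOn I3 I3 ∞ φ (U ×ˢ univ) ∧
    ContMDiffOn I3 (𝓡 1) ∞ τ (π ⁻¹' U) ∧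
    (∀ x ∈ U, ∀ z, π (φ (x, z)) = x ∧ τ (φ (x, z)) = z) ∧
    (∀ p, π p ∈ U → φ (π p, τ p) = p) ∧
    (∀ x ∈ U, ∀ z w, φ (x, z * w) = w • φ (x, z))

/-- A principal bundle over the surface `S` with structure group the circle group. As the group is
commutative, the right action `p · z` is written as the left action `z • p`. -/
structure CircleBundle (S : Type*) [TopologicalSpace S] [ChartedSpace R2 S] where
  Total : Type*
  [topologicalSpace : TopologicalSpace Total]
  [chartedSpace : ChartedSpace (ModelProd R2 (EuclideanSpace ℝ (Fin 1))) Total]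
  [isManifold : IsManifold I3 ∞ Total]
  [mulAction : MulAction Circle Total]
  proj : Total → S
  contMDiff_proj : ContMDiff I3 (𝓡 2) ∞ proj
  contMDiff_smul : ContMDiff ((𝓡 1).prod I3) I3 ∞ (fun q : Circle × Total => q.1 • q.2)
  proj_smul : ∀ (z : Circle) (p : Total), proj (z • p) = proj p
  locally_trivial : ∀ x : S, ∃ U : Set S, IsOpen U ∧ x ∈ U ∧ IsTrivialOver proj U

namespace CircleBundle

attribute [instance] topologicalSpace chartedSpace isManifold mulAction

variable {S : Type*} [TopologicalSpace S] [ChartedSpace R2 S]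

/-- The bundle is trivializable: isomorphic to the product bundle `S × 𝕋`. -/
def Trivializable (Q : CircleBundle S) : Prop := IsTrivialOver Q.proj univ

theorem contMDiff_smul_left (Q : CircleBundle S) (z : Circle) :
    ContMDiff I3 I3 ∞ (fun p : Q.Total => z • p) :=
  Q.contMDiff_smul.comp (contMDiff_const.prodMk contMDiff_id)

theorem contMDiff_orbit (Q : CircleBundle S) (p : Q.Total) :
    ContMDiff (𝓡 1) I3 ∞ (fun z : Circle => z • p) :=
  Q.contMDiff_smul.comp (contMDiff_id.prodMk contMDiff_const)

end CircleBundle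

variable {S : Type*} [TopologicalSpace S] [ChartedSpace R2 S]

/-- The smooth global sections of a circle bundle. -/
@[ext] structure GlobalSection (Q : CircleBundle S) where
  toFun : S → Q.Total
  contMDiff' : ContMDiff (𝓡 2) I3 ∞ toFun
  proj_apply' : ∀ x, Q.proj (toFun x) = x

instance (Q : CircleBundle S) : CoeFun (GlobalSection Q) (fun _ => S → Q.Total) :=
  ⟨GlobalSection.toFun⟩

/-- Gauge transformations: smooth maps from the surface to the circle group. -/
abbrev Gauge (S : Type*) [TopologicalSpace S] [ChartedSpace R2 S] :=
  ContMDiffMap (𝓡 2) (𝓡 1) S Circle ∞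

/-- Any two sections are related by a gauge transformation. -/
theorem GlobalSection.exists_gauge {Q : CircleBundle S} (s s₁ : GlobalSection Q) :
    ∃ l : Gauge S, ∀ x, s₁ x = l x • s x := by
  choose U hU hxU φ τ hφ hτ h1 h2 h3 using Q.locally_trivial
  have key : ∀ x y, y ∈ U x → s₁ y = (τ x (s₁ y) * (τ x (s y))⁻¹) • s y := by
    intro x y hy
    have e1 := h2 x (s₁ y) (by rwa [s₁.proj_apply'])
    have e2 := h2 x (s y) (by rwa [s.proj_apply'])
    rw [s₁.proj_apply'] at e1
    rw [s.proj_apply'] at e2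
    conv_rhs => rw [← e2]
    rw [h1 x y hy _ |>.2, ← h3 x y hy, mul_comm (τ x (s₁ y)), mul_inv_cancel_left, e1]
  have uniq : ∀ x y, y ∈ U x → ∀ z w : Circle, z • s y = w • s y → z = w := by
    intro x y hy z w hzw
    have e2 := h2 x (s y) (by rwa [s.proj_apply'])
    rw [s.proj_apply'] at e2
    rw [← e2, ← h3 x y hy, ← h3 x y hy] at hzw
    have := congrArg (τ x) hzw
    rw [(h1 x y hy _).2, (h1 x y hy _).2] at this
    exact mul_left_cancel this
  refine ⟨⟨fun x => τ x (s₁ x) * (τ x (s x))⁻¹, fun x => ?_⟩, fun x => key x x (hxU x)⟩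
  have hs : ContMDiffAt (𝓡 2) (𝓡 1) ∞ (fun y => τ x (s y)) x :=
    ((hτ x).contMDiffAt (((hU x).preimage Q.contMDiff_proj.continuous).mem_nhds
      (by rw [mem_preimage, s.proj_apply']; exact hxU x))).comp x (s.contMDiff' x)
  have hs₁ : ContMDiffAt (𝓡 2) (𝓡 1) ∞ (fun y => τ x (s₁ y)) x :=
    ((hτ x).contMDiffAt (((hU x).preimage Q.contMDiff_proj.continuous).mem_nhds
      (by rw [mem_preimage, s₁.proj_apply']; exact hxU x))).comp x (s₁.contMDiff' x)
  refine (hs₁.mul hs.inv).congr_of_eventuallyEq ?_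
  filter_upwards [(hU x).mem_nhds (hxU x)] with y hy
  exact uniq y y (hxU y) _ _ ((key y y (hxU y)).symm.trans (key x y hy))

/-- A connection on a circle bundle: an invariant 1-form with values in the Lie algebra, which
restricts to the Maurer-Cartan form on each orbit. -/
@[ext] structure Connection (Q : CircleBundle S) where
  form : OneForm I3 Q.Total LieT
  invariant : ∀ z : Circle,
    form.pullback (fun p : Q.Total => z • p) (Q.contMDiff_smul_left z) = form
  vertical : ∀ p : Q.Total,
    form.pullback (fun z : Circle => z • p) (Q.contMDiff_orbit p) = maurerCartan

namespace Connection

variable [IsManifold (𝓡 2) ∞ S] {Q : CircleBundle S}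

/-- The 1-form `s^* η` on the surface. -/
def pullSection (η : Connection Q) (s : GlobalSection Q) : OneForm (𝓡 2) S LieT :=
  η.form.pullback s s.contMDiff'

/-- The action `η + π^* α` of the 1-forms on the surface on the connections, which makes the space
of connections an affine space. -/
instance : VAdd (OneForm (𝓡 2) S LieT) (Connection Q) where
  vadd α η :=
    { form := η.form + α.pullback Q.proj Q.contMDiff_proj
      invariant := fun z => by
        rw [OneForm.pullback_add, η.invariant, OneForm.pullback_pullback]
        congr 1
        exact OneForm.pullback_congr _ _ (funext fun p => Q.proj_smul z p) α
      vertical := fun p => by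
        rw [OneForm.pullback_add, η.vertical, OneForm.pullback_pullback]
        have h := (OneForm.pullback_congr (Q.contMDiff_proj.comp (Q.contMDiff_orbit p))
          contMDiff_const (g := fun _ => Q.proj p) (funext fun z => Q.proj_smul z p) α).trans
          (OneForm.pullback_const _ α)
        rw [h, add_zero] }

end Connection

/-- A morphism of circle bundles covering a diffeomorphism of the base surfaces. -/
structure BundleMorphism {S' : Type*} [TopologicalSpace S'] [ChartedSpace R2 S']
    (Q' : CircleBundle S') (Q : CircleBundle S) where
  toFun : Q'.Total → Q.Total
  contMDiff' : ContMDiff I3 I3 ∞ toFun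
  map_smul' : ∀ (z : Circle) (p : Q'.Total), toFun (z • p) = z • toFun p
  base : Diffeomorph (𝓡 2) (𝓡 2) S' S ∞
  proj_apply' : ∀ p, Q.proj (toFun p) = base (Q'.proj p)

namespace BundleMorphism

variable {S' : Type*} [TopologicalSpace S'] [ChartedSpace R2 S']
  {Q' : CircleBundle S'} {Q : CircleBundle S}

/-- The connection `ψ^* η`. -/
def pullback (ψ : BundleMorphism Q' Q) (η : Connection Q) : Connection Q' where
  form := η.form.pullback ψ.toFun ψ.contMDiff'
  invariant z := by
    rw [OneForm.pullback_pullback]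
    conv_rhs => rw [← η.invariant z, OneForm.pullback_pullback]
    exact OneForm.pullback_congr _ _ (funext fun p => ψ.map_smul' z p) _
  vertical p := by
    rw [OneForm.pullback_pullback, ← η.vertical (ψ.toFun p)]
    exact OneForm.pullback_congr _ _ (funext fun z => ψ.map_smul' z p) _

/-- The section `ψ ∘ s' ∘ ψ̄⁻¹`. -/
def mapSection (ψ : BundleMorphism Q' Q) (s' : GlobalSection Q') : GlobalSection Q where
  toFun := ψ.toFun ∘ s' ∘ ψ.base.symm
  contMDiff' := ψ.contMDiff'.comp (s'.contMDiff'.comp ψ.base.symm.contMDiff)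
  proj_apply' x := by simp [ψ.proj_apply', s'.proj_apply']

end BundleMorphism

/-! ### Disjoint unions -/

section Sum

variable {S₁ S₂ P₁ P₂ : Type*}
  [TopologicalSpace S₁] [ChartedSpace R2 S₁] [TopologicalSpace S₂] [ChartedSpace R2 S₂]
  [TopologicalSpace P₁] [ChartedSpace (ModelProd R2 (EuclideanSpace ℝ (Fin 1))) P₁]
  [TopologicalSpace P₂] [ChartedSpace (ModelProd R2 (EuclideanSpace ℝ (Fin 1))) P₂]
  [MulAction Circle P₁] [MulAction Circle P₂]

theorem IsTrivialOver.sum_inl {π₁ : P₁ → S₁} {U : Set S₁} (h : IsTrivialOver π₁ U)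
    (π₂ : P₂ → S₂) (x₀ : S₁) :
    IsTrivialOver (Sum.map π₁ π₂) (Sum.inl '' U) := by
  obtain ⟨φ, τ, hφ, hτ, h1, h2, h3⟩ := h
  have hr : ContMDiff (𝓡 2) (𝓡 2) ∞ (Sum.elim id (fun _ : S₂ => x₀)) :=
    contMDiff_id.sumElim contMDiff_const
  have hq : ContMDiff I3 I3 ∞ (Sum.elim id (fun _ : P₂ => φ (x₀, 1))) :=
    contMDiff_id.sumElim contMDiff_const
  refine ⟨fun q => Sum.inl (φ (Sum.elim id (fun _ => x₀) q.1, q.2)),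
    fun p => τ (Sum.elim id (fun _ => φ (x₀, 1)) p), ?_, ?_, ?_, ?_, ?_⟩
  · refine ContMDiff.inl.comp_contMDiffOn (hφ.comp ((hr.comp contMDiff_fst).prodMk
      contMDiff_snd).contMDiffOn ?_)
    rintro ⟨_, z⟩ ⟨⟨x, hx, rfl⟩, -⟩
    exact ⟨hx, trivial⟩
  · refine hτ.comp hq.contMDiffOn ?_
    rintro (p | p) ⟨x, hx, hp⟩
    · have : x = π₁ p := Sum.inl.inj hp
      subst this
      exact hx
    · cases hp
  · rintro _ ⟨x, hx, rfl⟩ z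
    exact ⟨congrArg Sum.inl (h1 x hx z).1, (h1 x hx z).2⟩
  · rintro (p | p) ⟨x, hx, hp⟩
    · have : x = π₁ p := Sum.inl.inj hp
      subst this
      exact congrArg Sum.inl (h2 p hx)
    · cases hp
  · rintro _ ⟨x, hx, rfl⟩ z w
    exact congrArg Sum.inl (h3 x hx z w)

theorem IsTrivialOver.sum_inr {π₂ : P₂ → S₂} {U : Set S₂} (h : IsTrivialOver π₂ U)
    (π₁ : P₁ → S₁) (x₀ : S₂) :
    IsTrivialOver (Sum.map π₁ π₂) (Sum.inr '' U) := by
  obtain ⟨φ, τ, hφ, hτ, h1, h2, h3⟩ := h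
  have hr : ContMDiff (𝓡 2) (𝓡 2) ∞ (Sum.elim (fun _ : S₁ => x₀) id) :=
    contMDiff_const.sumElim contMDiff_id
  have hq : ContMDiff I3 I3 ∞ (Sum.elim (fun _ : P₁ => φ (x₀, 1)) id) :=
    contMDiff_const.sumElim contMDiff_id
  refine ⟨fun q => Sum.inr (φ (Sum.elim (fun _ => x₀) id q.1, q.2)),
    fun p => τ (Sum.elim (fun _ => φ (x₀, 1)) id p), ?_, ?_, ?_, ?_, ?_⟩
  · refine ContMDiff.inr.comp_contMDiffOn (hφ.comp ((hr.comp contMDiff_fst).prodMk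
      contMDiff_snd).contMDiffOn ?_)
    rintro ⟨_, z⟩ ⟨⟨x, hx, rfl⟩, -⟩
    exact ⟨hx, trivial⟩
  · refine hτ.comp hq.contMDiffOn ?_
    rintro (p | p) ⟨x, hx, hp⟩
    · cases hp
    · have : x = π₂ p := Sum.inr.inj hp
      subst this
      exact hx
  · rintro _ ⟨x, hx, rfl⟩ z
    exact ⟨congrArg Sum.inr (h1 x hx z).1, (h1 x hx z).2⟩
  · rintro (p | p) ⟨x, hx, hp⟩
    · cases hp
    · have : x = π₂ p := Sum.inr.inj hp
      subst this
      exact congrArg Sum.inr (h2 p hx)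
  · rintro _ ⟨x, hx, rfl⟩ z w
    exact congrArg Sum.inr (h3 x hx z w)

/-- The disjoint union `Q₁ ⊔ Q₂` of circle bundles, over the disjoint union of the surfaces. -/
def CircleBundle.sum (Q₁ : CircleBundle S₁) (Q₂ : CircleBundle S₂) : CircleBundle (S₁ ⊕ S₂) where
  Total := Q₁.Total ⊕ Q₂.Total
  proj := Sum.map Q₁.proj Q₂.proj
  contMDiff_proj := Q₁.contMDiff_proj.sumMap Q₂.contMDiff_proj
  contMDiff_smul := by
    rintro ⟨z, p | p⟩
    · have hr : ContMDiff I3 I3 ∞ (Sum.elim id (fun _ : Q₂.Total => p)) :=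
        contMDiff_id.sumElim contMDiff_const
      have h := (ContMDiff.inl (M' := Q₂.Total)).comp (Q₁.contMDiff_smul.comp
        ((contMDiff_fst (I := 𝓡 1) (M := Circle)).prodMk (hr.comp contMDiff_snd)))
      refine (h (z, Sum.inl p)).congr_of_eventuallyEq ?_
      filter_upwards [(isOpen_range_inl.preimage continuous_snd).mem_nhds
        (show (z, (Sum.inl p : Q₁.Total ⊕ Q₂.Total)) ∈ _ from ⟨p, rfl⟩)] with q hq
      obtain ⟨w, q⟩ := q
      obtain ⟨q, rfl⟩ := hq
      rfl
    · have hr : ContMDiff I3 I3 ∞ (Sum.elim (fun _ : Q₁.Total => p) id) :=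
        contMDiff_const.sumElim contMDiff_id
      have h := (ContMDiff.inr (M := Q₁.Total)).comp (Q₂.contMDiff_smul.comp
        ((contMDiff_fst (I := 𝓡 1) (M := Circle)).prodMk (hr.comp contMDiff_snd)))
      refine (h (z, Sum.inr p)).congr_of_eventuallyEq ?_
      filter_upwards [(isOpen_range_inr.preimage continuous_snd).mem_nhds
        (show (z, (Sum.inr p : Q₁.Total ⊕ Q₂.Total)) ∈ _ from ⟨p, rfl⟩)] with q hq
      obtain ⟨w, q⟩ := q
      obtain ⟨q, rfl⟩ := hq
      rfl
  proj_smul := by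
    rintro z (p | p)
    · exact congrArg Sum.inl (Q₁.proj_smul z p)
    · exact congrArg Sum.inr (Q₂.proj_smul z p)
  locally_trivial := by
    rintro (x | x)
    · obtain ⟨U, hU, hx, h⟩ := Q₁.locally_trivial x
      exact ⟨Sum.inl '' U, isOpenMap_inl _ hU, ⟨x, hx, rfl⟩, h.sum_inl _ x⟩
    · obtain ⟨U, hU, hx, h⟩ := Q₂.locally_trivial x
      exact ⟨Sum.inr '' U, isOpenMap_inr _ hU, ⟨x, hx, rfl⟩, h.sum_inr _ x⟩

variable {Q₁ : CircleBundle S₁} {Q₂ : CircleBundle S₂}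

/-- The section `s₁ ⊔ s₂`. -/
def GlobalSection.sum (s₁ : GlobalSection Q₁) (s₂ : GlobalSection Q₂) :
    GlobalSection (Q₁.sum Q₂) where
  toFun := Sum.map s₁ s₂
  contMDiff' := s₁.contMDiff'.sumMap s₂.contMDiff'
  proj_apply' := by
    rintro (x | x)
    · exact congrArg Sum.inl (s₁.proj_apply' x)
    · exact congrArg Sum.inr (s₂.proj_apply' x)

/-- The connection `η₁ ⊔ η₂`. -/
def Connection.sum (η₁ : Connection Q₁) (η₂ : Connection Q₂) : Connection (Q₁.sum Q₂) where
  form := OneForm.sum (M := Q₁.Total) (N := Q₂.Total) η₁.form η₂.form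
  invariant z := by
    refine OneForm.ext_sum ?_ ?_
    · rw [OneForm.pullback_inl_sum]
      conv_rhs => rw [← η₁.invariant z]
      have h := OneForm.pullback_pullback _ (Q₁.contMDiff_smul_left z) _
        (ContMDiff.inl (M' := Q₂.Total)) (OneForm.sum (M := Q₁.Total) (N := Q₂.Total) η₁.form η₂.form)
      rw [OneForm.pullback_inl_sum] at h
      rw [h]
      exact OneForm.pullback_pullback _ _ _ _ _
    · rw [OneForm.pullback_inr_sum]
      conv_rhs => rw [← η₂.invariant z]
      have h := OneForm.pullback_pullback _ (Q₂.contMDiff_smul_left z) _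
        (ContMDiff.inr (M := Q₁.Total)) (OneForm.sum (M := Q₁.Total) (N := Q₂.Total) η₁.form η₂.form)
      rw [OneForm.pullback_inr_sum] at h
      rw [h]
      exact OneForm.pullback_pullback _ _ _ _ _
  vertical := by
    rintro (p | p)
    · have h := OneForm.pullback_pullback _ (Q₁.contMDiff_orbit p) _
        (ContMDiff.inl (M' := Q₂.Total)) (OneForm.sum (M := Q₁.Total) (N := Q₂.Total) η₁.form η₂.form)
      rw [OneForm.pullback_inl_sum, η₁.vertical] at h
      exact h.symm
    · have h := OneForm.pullback_pullback _ (Q₂.contMDiff_orbit p) _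
        (ContMDiff.inr (M := Q₁.Total)) (OneForm.sum (M := Q₁.Total) (N := Q₂.Total) η₁.form η₂.form)
      rw [OneForm.pullback_inr_sum, η₂.vertical] at h
      exact h.symm

end Sum

end Bundles


/-! ### Smooth functions on the space of connections -/

section FrechetSmooth

/-- Smoothness on the open set `U` of a function on a Fréchet space `V`: the iterated directional
derivatives `D j x w = D^j G (x) (w₀, …, w_{j-1})` exist on `U` and are jointly continuous. -/
def FrechetSmoothOn {V : Type*} [AddCommGroup V] [Module ℝ V] [TopologicalSpace V]
    (G : V → ℂ) (U : Set V) : Prop :=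
  ∃ D : (j : ℕ) → V → (Fin j → V) → ℂ,
    (∀ x ∈ U, ∀ w, D 0 x w = G x) ∧
    (∀ j, ContinuousOn (fun p : V × (Fin j → V) => D j p.1 p.2) (U ×ˢ univ)) ∧
    (∀ j, ∀ x ∈ U, ∀ (v : V) (w : Fin j → V),
      HasDerivAt (fun t : ℝ => D j (x + t • v) w) (D (j + 1) x (Fin.cons v w)) 0)

variable {S : Type*} [TopologicalSpace S] [ChartedSpace R2 S] [IsManifold (𝓡 2) ∞ S]

/-- The expression of a 1-form on the surface in the chart `e`. -/
def OneForm.localRep (e : OpenPartialHomeomorph S R2) (α : OneForm (𝓡 2) S LieT) (y : R2) :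
    R2 →L[ℝ] LieT :=
  (α (e.symm y)).comp (mfderiv (𝓡 2) (𝓡 2) e.symm y)

/-- The Fréchet topology on the 1-forms: uniform convergence on compact sets of all derivatives of
the coordinate expressions. -/
instance : TopologicalSpace (OneForm (𝓡 2) S LieT) :=
  ⨅ (e : IsManifold.maximalAtlas (𝓡 2) ∞ S) (n : ℕ),
    TopologicalSpace.induced
      (fun α => UniformOnFun.ofFun {K : Set R2 | IsCompact K ∧ K ⊆ e.1.target}
        (iteratedFDeriv ℝ n (α.localRep e.1))) inferInstance

variable {Q : CircleBundle S}

/-- The topology of the affine space of connections: `α ↦ η + π^* α` is a chart for every `η`. -/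
instance : TopologicalSpace (Connection Q) :=
  ⨆ η : Connection Q,
    TopologicalSpace.coinduced (fun α : OneForm (𝓡 2) S LieT => α +ᵥ η) inferInstance

/-- Smoothness, on an open set, of a function on the affine Fréchet space of connections. -/
def ConnectionSmoothOn (G : Connection Q → ℂ) (U : Set (Connection Q)) : Prop :=
  ∀ η : Connection Q, FrechetSmoothOn (fun α : OneForm (𝓡 2) S LieT => G (α +ᵥ η))
    {α | α +ᵥ η ∈ U}

/-- A local unitary trivialization of a family of hermitian lines over the space of connections. -/
structure UnitaryTrivialization (L : Connection Q → Type*) [∀ η, NormedAddCommGroup (L η)]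
    [∀ η, InnerProductSpace ℂ (L η)] where
  base : Set (Connection Q)
  isOpen_base : IsOpen base
  iso : ∀ η ∈ base, L η ≃ₗᵢ[ℂ] ℂ

/-- A smooth hermitian line bundle over the space of connections with the given fibres: an atlas of
local unitary trivializations, with smooth transition functions. -/
structure SmoothHermitianLineBundle (L : Connection Q → Type*) [∀ η, NormedAddCommGroup (L η)]
    [∀ η, InnerProductSpace ℂ (L η)] where
  atlas : Set (UnitaryTrivialization L)
  cover : ∀ η, ∃ t ∈ atlas, η ∈ t.base
  smooth_transition : ∀ t ∈ atlas, ∀ t' ∈ atlas, ∃ g : Connection Q → ℂ,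
    ConnectionSmoothOn g (t.base ∩ t'.base) ∧
    ∀ η (h : η ∈ t.base) (h' : η ∈ t'.base) (f : L η), t'.iso η h' f = g η * t.iso η h f

end FrechetSmooth

/-! ### The Chern-Simons lines -/

section Lines

variable {S : Type*} [TopologicalSpace S] [ChartedSpace R2 S] [IsManifold (𝓡 2) ∞ S]
  [CompactSpace S] [T2Space S]

/-- The 1-form `λ^* ϑ` of a gauge transformation. -/
def Gauge.mc (l : Gauge S) : OneForm (𝓡 2) S LieT := maurerCartan.pullback l l.contMDiff

/-- The cocycle `c(α, λ) = exp (πik ∫ ⟨α ∧ λ^* ϑ⟩)`. -/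
def csCocycle (k : ℤ) (o : SurfaceOrientation S) (α : OneForm (𝓡 2) S LieT) (l : Gauge S) :
    Circle :=
  Circle.exp (Real.pi * k * surfaceIntegral o (wedgePairing α l.mc))

variable {Q : CircleBundle S}

/-- The functions `f` on the set of sections such that `f(s₁) = f(s) c(s^* η, λ)` if `s₁ = s · λ`. -/
def csSubmodule (k : ℤ) (o : SurfaceOrientation S) (η : Connection Q) :
    Submodule ℂ (GlobalSection Q → ℂ) where
  carrier := {f | ∀ (s s₁ : GlobalSection Q) (l : Gauge S), (∀ x, s₁ x = l x • s x) →
    f s₁ = f s * csCocycle k o (η.pullSection s) l}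
  add_mem' {f g} hf hg s s₁ l h := by
    simp only [Pi.add_apply, hf s s₁ l h, hg s s₁ l h, add_mul]
  zero_mem' s s₁ l h := by simp
  smul_mem' c f hf s s₁ l h := by
    simp only [Pi.smul_apply, smul_eq_mul, hf s s₁ l h, mul_assoc]

/-- The Chern-Simons line of a connection. -/
def CSLine (k : ℤ) (o : SurfaceOrientation S) (η : Connection Q) : Type _ := csSubmodule k o η

namespace CSLine

variable {k : ℤ} {o : SurfaceOrientation S} {η : Connection Q}

instance : AddCommGroup (CSLine k o η) := inferInstanceAs (AddCommGroup (csSubmodule k o η))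
instance : Module ℂ (CSLine k o η) := inferInstanceAs (Module ℂ (csSubmodule k o η))
instance : CoeFun (CSLine k o η) (fun _ => GlobalSection Q → ℂ) := ⟨fun f => f.1⟩

theorem eq_zero_of_apply {f : CSLine k o η} {s : GlobalSection Q} (h : f s = 0) : f = 0 := by
  refine Subtype.ext (funext fun s₁ => ?_)
  obtain ⟨l, hl⟩ := s.exists_gauge s₁
  have := f.2 s s₁ l hl
  rw [this]
  change f s * _ = 0
  rw [h, zero_mul]

open Classical in
/-- The hermitian inner product `(f₁, f₂) = conj (f₁ s) * f₂ s`, where `s` is any section (and the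
line is zero if there is none). -/
@[reducible] def core : InnerProductSpace.Core ℂ (CSLine k o η) where
  inner f g := if h : Nonempty (GlobalSection Q) then conj (f h.some) * g h.some else 0
  conj_inner_symm f g := by
    split_ifs
    · simp [mul_comm]
    · simp
  re_inner_nonneg f := by
    split_ifs with h
    · rw [← Complex.normSq_eq_conj_mul_self]
      exact Complex.normSq_nonneg _
    · simp
  add_left f g r := by
    split_ifs with h
    · change conj (f _ + g _) * _ = _
      rw [map_add, add_mul]
    · simp
  smul_left f g c := by
    split_ifs with h
    · change conj (c * f _) * _ = _
      rw [map_mul, mul_assoc]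
    · simp
  definite f hf := by
    by_cases h : Nonempty (GlobalSection Q)
    · rw [dif_pos h, ← Complex.normSq_eq_conj_mul_self] at hf
      exact eq_zero_of_apply (Complex.normSq_eq_zero.1 (by exact_mod_cast hf))
    · exact Subtype.ext (funext fun s => (h ⟨s⟩).elim)

instance : NormedAddCommGroup (CSLine k o η) :=
  @InnerProductSpace.Core.toNormedAddCommGroup ℂ _ _ _ _ core
instance : InnerProductSpace ℂ (CSLine k o η) := InnerProductSpace.ofCore core.toCore

end CSLine

end Lines

end CSLines

end

open CSLines

noncomputable section

/-! The crux is that `∫ ⟨λ₁^*ϑ ∧ λ₂^*ϑ⟩` is an integer (`integral_wedge_mc_int`): up to sign it is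
the degree of the map `(λ₁, λ₂)` from the surface to the torus. Since `λ^*ϑ` is additive in `λ` and
the wedge pairing is bilinear, the two sides of the cocycle identity differ by the factor
`exp(πikn)` with `n` this integer, and the factor is `1` because `k` is even.

Integrality is proved by counting preimages of a regular value. Sard's theorem in equal dimensions
(`exists_regular_value`) provides a regular value, which constant factors move to `(1, 1)`. By
Stokes' theorem (`integral_wedge_gaugeExp`), multiplying `λ` by `exp(iH)` with `H` real-valued
leaves the integral unchanged. A suitable `H` turns `λ` into `exp(iτ(arg λ))`, where `τ` steps from
`0` to `2π` within a short interval around `0` (`exists_collapse`). The new form `λ^*ϑ` lives only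
where `λ` is close to `1`, so the integrand is concentrated near the finitely many preimages of `(1,
1)`. Near each of them `(arg λ₁, arg λ₂)` is a local diffeomorphism, and a change of variables
identifies the contribution with minus the product of two signs (`exists_nhds_integral_int`). All
this needs the integral to be independent of charts and partitions of unity, which rests on the
change of variables formula (`setIntegral_density_pullback`).

The rest is formal. Passing from `s` to `s · λ` adds `λ^*ϑ` to `s^*η`. Any two sections differ by a
gauge transformation, so an element of the line is determined by its value at one section; the
cocycle identity says that every value occurs. As the cocycle is unimodular, evaluation at `s` is a
unitary isomorphism onto `ℂ`. The transition function between two evaluations is `η ↦ c(s^*η, λ)`,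
the exponential of a continuous affine function, hence smooth. The three isometries are composites
of evaluations; they are given by the stated formulas because the integral is invariant under
orientation preserving diffeomorphisms, changes sign with the orientation and is additive over
disjoint unions. -/

namespace CSLines

/-! ### Continuous 2-forms on a surface and their densities in charts -/

section TwoForms

variable {S : Type*} [TopologicalSpace S] [ChartedSpace R2 S]

/-- Not necessarily smooth 2-forms on a surface. -/
abbrev TwoForm (S : Type*) [TopologicalSpace S] [ChartedSpace R2 S] :=
  ∀ x : S, (TangentSpace (𝓡 2) x) [⋀^Fin 2]→ₗ[ℝ] ℝ

/-- A 2-form is continuous if its components in the preferred charts are. -/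
def TwoForm.IsCont (w : TwoForm S) : Prop :=
  ∀ x₀ x : S, x ∈ (chartAt R2 x₀).source →
    ContinuousAt (fun x => w x (chartFrame (chartAt R2 x₀) x)) x

/-- The unsigned component of a 2-form with respect to an orientation, in a chart. -/
def density (o : SurfaceOrientation S) (w : TwoForm S) (x₀ x : S) : ℝ :=
  frameSign (o x) (chartFrame (chartAt R2 x₀) x) * w x (chartFrame (chartAt R2 x₀) x)

theorem TwoForm.IsCont.add {w w' : TwoForm S} (h : w.IsCont) (h' : w'.IsCont) :
    (w + w').IsCont := fun x₀ x hx => (h x₀ x hx).add (h' x₀ x hx)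

theorem TwoForm.isCont_zero : (0 : TwoForm S).IsCont := fun _ _ _ => continuousAt_const

theorem TwoForm.IsCont.sum {ι : Type*} {I : Finset ι} {w : ι → TwoForm S}
    (h : ∀ i ∈ I, (w i).IsCont) : (∑ i ∈ I, w i).IsCont :=
  Finset.sum_induction _ TwoForm.IsCont (fun _ _ => .add) isCont_zero h

theorem TwoForm.IsCont.smul {w : TwoForm S} (h : w.IsCont) {f : S → ℝ} (hf : Continuous f) :
    TwoForm.IsCont (fun x => f x • w x : TwoForm S) :=
  fun x₀ x hx => hf.continuousAt.mul (h x₀ x hx)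

theorem frameSign_continuousAt (o : SurfaceOrientation S) {x₀ x : S}
    (hx : x ∈ (chartAt R2 x₀).source) :
    ContinuousAt (fun x => frameSign (o x) (chartFrame (chartAt R2 x₀) x)) x :=
  (o.continuousOn' x₀).continuousAt ((chartAt R2 x₀).open_source.mem_nhds hx)

theorem frameSign_mem {V : Type*} [AddCommGroup V] [Module ℝ V] (o : Orientation ℝ V (Fin 2))
    (v : Fin 2 → V) : frameSign o v = -1 ∨ frameSign o v = 0 ∨ frameSign o v = 1 :=
  Real.sign_apply_eq _

/-- A continuous function with values in `{-1, 0, 1}` is locally constant. -/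
theorem frameSign_eventuallyEq (o : SurfaceOrientation S) {x₀ x : S}
    (hx : x ∈ (chartAt R2 x₀).source) :
    ∀ᶠ x' in 𝓝 x, frameSign (o x') (chartFrame (chartAt R2 x₀) x') =
      frameSign (o x) (chartFrame (chartAt R2 x₀) x) := by
  have h := frameSign_continuousAt o hx
  have h1 := h.eventually (Metric.ball_mem_nhds _ (show (0 : ℝ) < 1 by norm_num))
  filter_upwards [h1] with x' hx'
  rw [Real.dist_eq, abs_lt] at hx'
  rcases frameSign_mem (o x') (chartFrame (chartAt R2 x₀) x') with h1 | h1 | h1 <;>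
  rcases frameSign_mem (o x) (chartFrame (chartAt R2 x₀) x) with h2 | h2 | h2 <;>
  rw [h1, h2] at hx' ⊢ <;> norm_num at hx'

theorem TwoForm.IsCont.density_continuousOn {w : TwoForm S} (h : w.IsCont)
    (o : SurfaceOrientation S) (x₀ : S) :
    ContinuousOn (density o w x₀) (chartAt R2 x₀).source := fun x hx =>
  ((frameSign_continuousAt o hx).mul (h x₀ x hx)).continuousWithinAt

theorem density_add (o : SurfaceOrientation S) (w w' : TwoForm S) (x₀ x : S) :
    density o (w + w') x₀ x = density o w x₀ x + density o w' x₀ x := by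
  simp [density, mul_add]

theorem density_smul (o : SurfaceOrientation S) (f : S → ℝ) (w : TwoForm S) (x₀ x : S) :
    density o (fun x => f x • w x) x₀ x = f x * density o w x₀ x := by
  simp [density]; ring

theorem density_eq_zero (o : SurfaceOrientation S) {w : TwoForm S} {x : S} (h : w x = 0) (x₀ : S) :
    density o w x₀ x = 0 := by
  simp [density, h]

/-- A linear map acts on alternating 2-forms by its determinant. -/
theorem alternating_comp_det {V : Type*} [AddCommGroup V] [Module ℝ V]
    (w : V [⋀^Fin 2]→ₗ[ℝ] ℝ) (T : R2 →ₗ[ℝ] V) (L : R2 →L[ℝ] R2) :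
    w (fun i => T (L (EuclideanSpace.single i 1))) =
      L.det * w (fun i => T (EuclideanSpace.single i 1)) := by
  let b := (EuclideanSpace.basisFun (Fin 2) ℝ).toBasis
  have hb : ∀ i, b i = EuclideanSpace.single i 1 := fun i => by simp [b]
  have h := (w.compLinearMap T).eq_smul_basis_det b
  have h1 := congrArg (fun f => f (fun i => L (b i))) h
  simp only [AlternatingMap.smul_apply, AlternatingMap.compLinearMap_apply, smul_eq_mul] at h1
  have h2 : b.det (fun i => L (b i)) = L.det := by
    have := b.det_comp (L : R2 →ₗ[ℝ] R2) b
    rw [b.det_self, mul_one] at this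
    exact this
  rw [h2] at h1
  simp only [hb] at h1
  rw [mul_comm]
  exact h1

theorem real_sign_mul (a b : ℝ) : Real.sign (a * b) = Real.sign a * Real.sign b := by
  rcases lt_trichotomy a 0 with h | h | h <;> rcases lt_trichotomy b 0 with h' | h' | h' <;>
  simp [h, h', Real.sign_of_neg, Real.sign_of_pos, mul_pos_of_neg_of_neg,
    mul_neg_of_neg_of_pos, mul_neg_of_pos_of_neg]

theorem frameSign_comp_det {V : Type*} [AddCommGroup V] [Module ℝ V]
    (o : Orientation ℝ V (Fin 2)) (T : R2 →ₗ[ℝ] V) (L : R2 →L[ℝ] R2) :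
    frameSign o (fun i => T (L (EuclideanSpace.single i 1))) =
      Real.sign L.det * frameSign o (fun i => T (EuclideanSpace.single i 1)) := by
  unfold frameSign
  rw [alternating_comp_det, real_sign_mul]

/-- This turns the determinant in the transformation law of a 2-form, together with the sign picked
up by the frame, into the absolute value required by the change of variables formula. -/
theorem sign_mul_self_eq_abs (a : ℝ) : Real.sign a * a = |a| := by
  rcases lt_trichotomy a 0 with h | h | h
  · rw [Real.sign_of_neg h, abs_of_neg h]; ring
  · simp [h]
  · rw [Real.sign_of_pos h, abs_of_pos h]; ring

variable [IsManifold (𝓡 2) ∞ S]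

theorem mdifferentiableAt_chart {x₀ x : S} (hx : x ∈ (chartAt R2 x₀).source) :
    MDifferentiableAt (𝓡 2) (𝓡 2) (chartAt R2 x₀) x :=
  mdifferentiableAt_atlas (chart_mem_atlas R2 x₀) hx

theorem mdifferentiableAt_chart_symm {x₀ : S} {y : R2} (hy : y ∈ (chartAt R2 x₀).target) :
    MDifferentiableAt (𝓡 2) (𝓡 2) (chartAt R2 x₀).symm y :=
  mdifferentiableAt_atlas_symm (chart_mem_atlas R2 x₀) hy

/-- The coordinate frame is the image of a constant vector field under the tangent map of the
inverse chart, which is continuous on total spaces, where `α` is continuous as well. -/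
theorem OneForm.frame_continuousOn {F : Type*} [NormedAddCommGroup F] [NormedSpace ℝ F]
    (α : OneForm (𝓡 2) S F) (x₀ : S) (i : Fin 2) :
    ContinuousOn (fun x => α x (chartFrame (chartAt R2 x₀) x i)) (chartAt R2 x₀).source := by
  set e := chartAt R2 x₀
  have h1 : ContinuousOn (tangentMapWithin (𝓡 2) (𝓡 2) e.symm e.target)
      (Bundle.TotalSpace.proj ⁻¹' e.target) :=
    (contMDiffOn_chart_symm (I := 𝓡 2) (n := ∞) (x := x₀)).continuousOn_tangentMapWithin
      (by simp) e.open_target.uniqueMDiffOn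
  have h2 : ContinuousOn (fun x => (⟨e x, EuclideanSpace.single i 1⟩ : TangentBundle (𝓡 2) R2))
      e.source := by
    have : Continuous (fun y : R2 => (⟨y, EuclideanSpace.single i 1⟩ : TangentBundle (𝓡 2) R2)) := by
      have := (tangentBundleModelSpaceHomeomorph (𝓡 2)).symm.continuous.comp
        (Continuous.prodMk (continuous_id (X := R2))
          (continuous_const (y := (EuclideanSpace.single i 1 : R2))))
      exact this
    exact this.comp_continuousOn e.continuousOn
  have h3 := α.smooth'.continuous.comp_continuousOn (h1.comp h2 fun x hx => e.map_source hx)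
  refine h3.congr fun x hx => ?_
  have h4 : tangentMapWithin (𝓡 2) (𝓡 2) e.symm e.target
      (⟨e x, EuclideanSpace.single i 1⟩ : TangentBundle (𝓡 2) R2) =
      ⟨x, chartFrame e x i⟩ := by
    rw [tangentMapWithin_eq_tangentMap (e.open_target.uniqueMDiffOn _ (e.map_source hx))
      (mdifferentiableAt_chart_symm (e.map_source hx))]
    unfold tangentMap
    -- The base points `e.symm (e x)` and `x` are equal only propositionally, so the base point is
    -- generalized; all tangent spaces are literally `R2`.
    have : ∀ (x' : S) (h : x' = x) (v : R2), (⟨x', v⟩ : TangentBundle (𝓡 2) S) = ⟨x, v⟩ := by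
      rintro _ rfl v; rfl
    exact this _ (e.left_inv hx) _
  simp only [Function.comp]
  rw [h4]
  rfl

theorem liePairing_eq (a b : LieT) :
    liePairing a b = -((a : ℂ).im * (b : ℂ).im) / (4 * Real.pi ^ 2) := by
  have h : (a : ℂ).re = 0 := a.2
  simp [liePairing, h]

theorem continuousAt_liePairing {X : Type*} [TopologicalSpace X] {f g : X → LieT} {x : X}
    (hf : ContinuousAt f x) (hg : ContinuousAt g x) :
    ContinuousAt (fun x => liePairing (f x) (g x)) x := by
  simp only [liePairing_eq]
  have hf' : ContinuousAt (fun x => ((f x : LieT) : ℂ).im) x :=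
    Complex.continuous_im.continuousAt.comp (continuous_subtype_val.continuousAt.comp hf)
  have hg' : ContinuousAt (fun x => ((g x : LieT) : ℂ).im) x :=
    Complex.continuous_im.continuousAt.comp (continuous_subtype_val.continuousAt.comp hg)
  exact ((hf'.mul hg').neg).div_const _

theorem wedgePairing_isCont (α β : OneForm (𝓡 2) S LieT) :
    TwoForm.IsCont (wedgePairing α β) := by
  intro x₀ x hx
  have hα := fun i => (α.frame_continuousOn x₀ i).continuousAt
    ((chartAt R2 x₀).open_source.mem_nhds hx)
  have hβ := fun i => (β.frame_continuousOn x₀ i).continuousAt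
    ((chartAt R2 x₀).open_source.mem_nhds hx)
  exact (continuousAt_liePairing (hα 0) (hβ 1)).sub (continuousAt_liePairing (hα 1) (hβ 0))

end TwoForms

/-! ### The integral of 2-forms: change of variables, linearity, diffeomorphisms, disjoint unions -/

section Integration

open MeasureTheory

variable {S : Type*} [TopologicalSpace S] [ChartedSpace R2 S] [IsManifold (𝓡 2) ∞ S]
  {S' : Type*} [TopologicalSpace S'] [ChartedSpace R2 S'] [IsManifold (𝓡 2) ∞ S']

/-- The pullback of a 2-form. -/
def TwoForm.pullback (f : S' → S) (w : TwoForm S) : TwoForm S' :=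
  fun x => (w (f x)).compLinearMap (mfderiv (𝓡 2) (𝓡 2) f x : R2 →L[ℝ] R2).toLinearMap

/-- The 2-form contributes `det L` and the frame sign contributes its sign, so a density transforms
by `|det L|` whether or not the charts are positively oriented. -/
theorem signed_comp_det {V : Type*} [AddCommGroup V] [Module ℝ V]
    (o : Orientation ℝ V (Fin 2)) (w : V [⋀^Fin 2]→ₗ[ℝ] ℝ) (T : R2 →ₗ[ℝ] V) (L : R2 →L[ℝ] R2)
    {v v' : Fin 2 → V} (hv : ∀ i, v i = T (L (EuclideanSpace.single i 1)))
    (hv' : ∀ i, v' i = T (EuclideanSpace.single i 1)) :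
    frameSign o v * w v = |L.det| * (frameSign o v' * w v') := by
  rw [funext hv, funext hv', frameSign_comp_det, alternating_comp_det, ← sign_mul_self_eq_abs]
  ring

/-- The change of variables formula for the local integrals of a 2-form. -/
theorem setIntegral_density_pullback {o' : SurfaceOrientation S'} {o : SurfaceOrientation S}
    (ψ : Diffeomorph (𝓡 2) (𝓡 2) S' S ∞) (hψ : o'.IsPreservedBy o ψ) (w : TwoForm S)
    (f : S → ℝ) (x₀' : S') (x₀ : S)
    (hf' : ∀ x, ψ.symm x ∉ (chartAt R2 x₀').source → f x = 0)
    (hf : ∀ x, x ∉ (chartAt R2 x₀).source → f x = 0) :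
    ∫ y in (chartAt R2 x₀').target, f (ψ ((chartAt R2 x₀').symm y)) *
        density o' (w.pullback ψ) x₀' ((chartAt R2 x₀').symm y) =
      ∫ y in (chartAt R2 x₀).target, f ((chartAt R2 x₀).symm y) *
        density o w x₀ ((chartAt R2 x₀).symm y) := by
  set e' := chartAt R2 x₀' with he'
  set e := chartAt R2 x₀ with he
  -- `A` is the domain of the coordinate expression `Φ` of `ψ`.
  set A : Set R2 := e'.target ∩ e'.symm ⁻¹' (ψ ⁻¹' e.source) with hA
  have hAo : IsOpen A := e'.symm.continuousOn.isOpen_inter_preimage e'.open_target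
    (e.open_source.preimage ψ.continuous)
  let Φ : R2 → R2 := fun y => e (ψ (e'.symm y))
  have hd1 : ∀ y ∈ A, MDifferentiableAt (𝓡 2) (𝓡 2) (fun y => ψ (e'.symm y)) y := fun y hy =>
    (ψ.contMDiff.mdifferentiableAt (by simp)).comp y (mdifferentiableAt_chart_symm hy.1)
  have hd : ∀ y ∈ A, MDifferentiableAt (𝓡 2) (𝓡 2) Φ y := fun y hy =>
    (mdifferentiableAt_chart hy.2).comp y (hd1 y hy)
  have hinj : InjOn Φ A := by
    intro y hy z hz hyz
    have h1 := e.injOn hy.2 hz.2 hyz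
    exact e'.symm.injOn hy.1 hz.1 (ψ.injective h1)
  have himage : Φ '' A = e.target ∩ e.symm ⁻¹' (ψ.symm ⁻¹' e'.source) := by
    ext z
    constructor
    · rintro ⟨y, hy, rfl⟩
      refine ⟨e.map_source hy.2, ?_⟩
      simp only [mem_preimage, Φ, e.left_inv hy.2, ψ.symm_apply_apply]
      exact e'.map_target hy.1
    · rintro ⟨hz, hz'⟩
      refine ⟨e' (ψ.symm (e.symm z)), ⟨e'.map_source hz', ?_⟩, ?_⟩
      · simp only [mem_preimage, e'.left_inv hz', ψ.apply_symm_apply]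
        exact e.map_target hz
      · simp only [Φ, e'.left_inv hz', ψ.apply_symm_apply, e.right_inv hz]
  have hframe : ∀ y ∈ A, ∀ i, mfderiv (𝓡 2) (𝓡 2) ψ (e'.symm y) (chartFrame e' (e'.symm y) i) =
      (mfderiv (𝓡 2) (𝓡 2) e.symm (Φ y) : R2 →L[ℝ] R2)
        (fderiv ℝ Φ y (EuclideanSpace.single i 1)) := by
    intro y hy i
    -- The relation between the frames is the derivative of `ψ ∘ e'⁻¹ = e⁻¹ ∘ Φ`.
    have h1 : (fun y => ψ (e'.symm y)) =ᶠ[𝓝 y] fun y => e.symm (Φ y) := by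
      filter_upwards [hAo.mem_nhds hy] with z hz
      exact (e.left_inv hz.2).symm
    have h2 := h1.mfderiv_eq (I := 𝓡 2) (I' := 𝓡 2)
    have h3 : mfderiv (𝓡 2) (𝓡 2) (fun y => ψ (e'.symm y)) y =
      (mfderiv (𝓡 2) (𝓡 2) ψ (e'.symm y)).comp (mfderiv (𝓡 2) (𝓡 2) e'.symm y) :=
      mfderiv_comp y (ψ.contMDiff.mdifferentiableAt (by simp)) (mdifferentiableAt_chart_symm hy.1)
    have h4 : mfderiv (𝓡 2) (𝓡 2) (fun y => e.symm (Φ y)) y =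
      (mfderiv (𝓡 2) (𝓡 2) e.symm (Φ y)).comp (mfderiv (𝓡 2) (𝓡 2) Φ y) :=
      mfderiv_comp y (mdifferentiableAt_chart_symm (e.map_source hy.2)) (hd y hy)
    rw [mfderiv_eq_fderiv] at h4
    have h5 := congrArg (fun L : R2 →L[ℝ] R2 => L (EuclideanSpace.single i 1))
      (h3.symm.trans (h2.trans h4))
    unfold chartFrame
    rw [e'.right_inv hy.1]
    exact h5
  have hdens : ∀ y ∈ A, density o' (w.pullback ψ) x₀' (e'.symm y) =
      |(fderiv ℝ Φ y).det| * density o w x₀ (ψ (e'.symm y)) := by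
    intro y hy
    unfold density
    rw [← he, ← he', ← hψ]
    exact signed_comp_det (o (ψ (e'.symm y))) (w (ψ (e'.symm y)))
      (mfderiv (𝓡 2) (𝓡 2) e.symm (Φ y) : R2 →L[ℝ] R2).toLinearMap (fderiv ℝ Φ y)
      (hframe y hy) fun i => rfl
  -- By the vanishing of `f` outside either chart domain, the integrals reduce to `A` and `Φ(A)`,
  -- between which `Φ` is a bijection.
  rw [setIntegral_eq_of_subset_of_forall_sdiff_eq_zero (s := A) e'.open_target.measurableSet
      (fun y hy => hy.1),
    setIntegral_eq_of_subset_of_forall_sdiff_eq_zero (s := Φ '' A) e.open_target.measurableSet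
      (by rw [himage]; exact fun y hy => hy.1),
    integral_image_eq_integral_abs_det_fderiv_smul volume hAo.measurableSet
      (f' := fun y => fderiv ℝ Φ y) (fun y hy => ((hd y hy).differentiableAt).hasFDerivAt.hasFDerivWithinAt)
      hinj]
  · refine setIntegral_congr_fun hAo.measurableSet fun y hy => ?_
    simp only [hdens y hy, Φ, smul_eq_mul]
    rw [e.left_inv hy.2]
    ring
  · rintro z ⟨hz, hz'⟩
    rw [himage] at hz'
    rw [hf' _ fun h => hz' ⟨hz, h⟩, zero_mul]
  · rintro z ⟨hz, hz'⟩
    rw [hf _ fun h => hz' ⟨hz, h⟩, zero_mul]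

-- A chart may have infinite area and `D` may be unbounded near its edge. But `C`, closed in a
-- compact surface, has compact image in the chart: `D` is integrable there and zero elsewhere.
omit [IsManifold (𝓡 2) ∞ S] in
theorem integrableOn_chart [CompactSpace S] {D : S → ℝ} {x₀ : S} {C : Set S}
    (hD : ContinuousOn D (chartAt R2 x₀).source)
    (hC : IsClosed C) (hCs : C ⊆ (chartAt R2 x₀).source) (h0 : ∀ x ∉ C, D x = 0) :
    IntegrableOn (fun y => D ((chartAt R2 x₀).symm y)) (chartAt R2 x₀).target := by
  set e := chartAt R2 x₀
  have hK : IsCompact (e '' C) := hC.isCompact.image_of_continuousOn (e.continuousOn.mono hCs)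
  have hKt : e '' C ⊆ e.target := by
    rintro _ ⟨x, hx, rfl⟩
    exact e.map_source (hCs hx)
  have hc : ContinuousOn (fun y => D (e.symm y)) e.target :=
    hD.comp e.symm.continuousOn fun y hy => e.map_target hy
  refine ((hc.mono hKt).integrableOn_compact hK).of_forall_sdiff_eq_zero
    e.open_target.measurableSet fun y hy => h0 _ fun h => hy.2 ⟨_, h, e.right_inv hy.1⟩

section Compact

variable [CompactSpace S] [T2Space S] [CompactSpace S'] [T2Space S']

variable (S) in
theorem chartPartition_tsupport (x₀ : S) :
    tsupport (chartPartition S x₀) ⊆ (chartAt R2 x₀).source :=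
  (SmoothPartitionOfUnity.exists_isSubordinate_chartAt_source (𝓡 2) S).choose_spec x₀

variable (S) in
/-- The finite set of indices of the nonzero functions of the partition of unity. -/
def chartIndex : Finset S :=
  ((chartPartition S).locallyFinite.finite_nonempty_of_compact).toFinset

theorem chartPartition_eq_zero {x₀ : S} (h : x₀ ∉ chartIndex S) (x : S) :
    chartPartition S x₀ x = 0 := by
  by_contra hx
  exact h ((Set.Finite.mem_toFinset _).2 ⟨x, hx⟩)

theorem sum_chartPartition (x : S) : ∑ x₀ ∈ chartIndex S, chartPartition S x₀ x = 1 := by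
  refine (chartPartition S).sum_finsupport' x (mem_univ x) fun i hi => ?_
  by_contra h
  exact ((chartPartition S).mem_finsupport x).1 hi (chartPartition_eq_zero h x)

/-- The index set on the right depends on neither `w` nor `o`, so that integrals of different forms
can be added term by term. -/
theorem surfaceIntegral_eq_sum (o : SurfaceOrientation S) (w : TwoForm S) :
    surfaceIntegral o w = ∑ x₀ ∈ chartIndex S, ∫ y in (chartAt R2 x₀).target,
      chartPartition S x₀ ((chartAt R2 x₀).symm y) *
        density o w x₀ ((chartAt R2 x₀).symm y) := by
  refine finsum_eq_sum_of_support_subset _ fun x₀ hx => ?_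
  by_contra h
  refine hx ?_
  simp [chartPartition_eq_zero h]

theorem integrableOn_chartPartition_mul (o : SurfaceOrientation S) {w : TwoForm S} (hw : w.IsCont)
    (x₀ : S) : IntegrableOn (fun y => chartPartition S x₀ ((chartAt R2 x₀).symm y) *
        density o w x₀ ((chartAt R2 x₀).symm y)) (chartAt R2 x₀).target :=
  integrableOn_chart (D := fun x => chartPartition S x₀ x * density o w x₀ x)
    ((chartPartition S x₀).contMDiff.continuous.continuousOn.mul (hw.density_continuousOn o x₀))
    (isClosed_tsupport _) (chartPartition_tsupport S x₀)
    fun x hx => by simp [image_eq_zero_of_notMem_tsupport hx]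

theorem surfaceIntegral_add (o : SurfaceOrientation S) {w w' : TwoForm S} (hw : w.IsCont)
    (hw' : w'.IsCont) : surfaceIntegral o (w + w') = surfaceIntegral o w + surfaceIntegral o w' := by
  simp only [surfaceIntegral_eq_sum, density_add, mul_add]
  rw [← Finset.sum_add_distrib]
  exact Finset.sum_congr rfl fun x₀ _ => integral_add (integrableOn_chartPartition_mul o hw x₀)
    (integrableOn_chartPartition_mul o hw' x₀)

theorem surfaceIntegral_zero (o : SurfaceOrientation S) : surfaceIntegral o (0 : TwoForm S) = 0 := by
  simp [surfaceIntegral_eq_sum, density]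

theorem surfaceIntegral_sum (o : SurfaceOrientation S) {ι : Type*} (I : Finset ι)
    {w : ι → TwoForm S} (hw : ∀ i ∈ I, (w i).IsCont) :
    surfaceIntegral o (∑ i ∈ I, w i) = ∑ i ∈ I, surfaceIntegral o (w i) := by
  classical
  induction I using Finset.induction_on with
  | empty => simpa using surfaceIntegral_zero o
  | insert a I ha ih =>
    rw [Finset.sum_insert ha, Finset.sum_insert ha, surfaceIntegral_add o (hw a (by simp))
      (.sum fun i hi => hw i (Finset.mem_insert_of_mem hi)),
      ih fun i hi => hw i (Finset.mem_insert_of_mem hi)]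

theorem surfaceIntegral_neg (o : SurfaceOrientation S) (w : TwoForm S) :
    surfaceIntegral (-o) w = -surfaceIntegral o w := by
  have h : ∀ x₀ x, density (-o) w x₀ x = -density o w x₀ x := fun x₀ x => by
    unfold density
    rw [← neg_mul, ← frameSign_neg]
    rfl
  simp only [surfaceIntegral_eq_sum, h, mul_neg, integral_neg, Finset.sum_neg_distrib]

omit [T2Space S] in
/-- The integral of the pullback of a 2-form supported in a chart. -/
theorem surfaceIntegral_pullback_of_support {o' : SurfaceOrientation S'} {o : SurfaceOrientation S}
    (ψ : Diffeomorph (𝓡 2) (𝓡 2) S' S ∞) (hψ : o'.IsPreservedBy o ψ) {w : TwoForm S}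
    (hw : w.IsCont) {x₀ : S} {C : Set S} (hC : IsClosed C) (hCs : C ⊆ (chartAt R2 x₀).source)
    (h0 : ∀ x ∉ C, w x = 0) :
    surfaceIntegral o' (w.pullback ψ) =
      ∫ y in (chartAt R2 x₀).target, density o w x₀ ((chartAt R2 x₀).symm y) := by
  classical
  let r : S' → S → ℝ := fun x' x => chartPartition S' x' (ψ.symm x)
  have hrc : ∀ x', Continuous (r x') := fun x' =>
    (chartPartition S' x').contMDiff.continuous.comp ψ.symm.continuous
  have h1 : ∀ x', ∫ y in (chartAt R2 x').target, chartPartition S' x' ((chartAt R2 x').symm y) *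
        density o' (w.pullback ψ) x' ((chartAt R2 x').symm y) =
      ∫ y in (chartAt R2 x₀).target, r x' ((chartAt R2 x₀).symm y) *
        density o w x₀ ((chartAt R2 x₀).symm y) := by
    intro x'
    -- The change of variables needs a weight vanishing outside both chart domains. Cutting `r x'`
    -- off outside `C` achieves this and changes no integrand, as `w` vanishes there.
    let f : S → ℝ := fun x => if x ∈ C then r x' x else 0
    have := setIntegral_density_pullback ψ hψ w f x' x₀ (fun x hx => ?_) (fun x hx => ?_)
    · refine Eq.trans ?_ (this.trans ?_)
      · refine setIntegral_congr_fun (chartAt R2 x').open_target.measurableSet fun y _ => ?_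
        by_cases h : ψ ((chartAt R2 x').symm y) ∈ C
        · simp [f, h, r]
        · have h' : (w.pullback ψ) ((chartAt R2 x').symm y) = 0 := by
            unfold TwoForm.pullback
            rw [h0 _ h]
            rfl
          simp only [density_eq_zero o' h', mul_zero]
      · refine setIntegral_congr_fun (chartAt R2 x₀).open_target.measurableSet fun y _ => ?_
        by_cases h : (chartAt R2 x₀).symm y ∈ C
        · simp [f, h]
        · simp [density_eq_zero o (h0 _ h)]
    · simp only [f, r]
      split_ifs
      · exact image_eq_zero_of_notMem_tsupport fun h => hx (chartPartition_tsupport S' x' h)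
      · rfl
    · exact if_neg fun h => hx (hCs h)
  -- Every term is now an integral over the one chart at `x₀`, and the weights transported from `S'`
  -- add up to `1`.
  rw [surfaceIntegral_eq_sum, Finset.sum_congr rfl fun x' _ => h1 x', ← integral_finsetSum]
  · refine setIntegral_congr_fun (chartAt R2 x₀).open_target.measurableSet fun y _ => ?_
    simp only [← Finset.sum_mul, r, sum_chartPartition, one_mul]
  · intro x' _
    exact integrableOn_chart (D := fun x => r x' x * density o w x₀ x)
      ((hrc x').continuousOn.mul (hw.density_continuousOn o x₀)) hC hCs
      fun x hx => by simp [density_eq_zero o (h0 x hx)]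

omit [IsManifold (𝓡 2) ∞ S] [CompactSpace S] [T2Space S] in
theorem isPreservedBy_refl (o : SurfaceOrientation S) :
    o.IsPreservedBy o (Diffeomorph.refl (𝓡 2) S ∞) := by
  intro x v
  simp only [Diffeomorph.coe_refl, mfderiv_id]
  rfl

omit [IsManifold (𝓡 2) ∞ S] [CompactSpace S] [T2Space S] in
theorem pullback_refl (w : TwoForm S) : w.pullback (Diffeomorph.refl (𝓡 2) S ∞) = w := by
  funext x
  ext v
  simp [TwoForm.pullback, mfderiv_id]
  rfl

/-- The integral of a 2-form supported in a chart. -/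
theorem surfaceIntegral_of_support (o : SurfaceOrientation S) {w : TwoForm S}
    (hw : w.IsCont) {x₀ : S} {C : Set S} (hC : IsClosed C) (hCs : C ⊆ (chartAt R2 x₀).source)
    (h0 : ∀ x ∉ C, w x = 0) :
    surfaceIntegral o w =
      ∫ y in (chartAt R2 x₀).target, density o w x₀ ((chartAt R2 x₀).symm y) := by
  -- For the identity diffeomorphism the statement expresses independence of the chosen partition of
  -- unity.
  have := surfaceIntegral_pullback_of_support _ (isPreservedBy_refl o) hw hC hCs h0
  rwa [pullback_refl] at this

/-- Orientation preserving diffeomorphisms preserve integrals. -/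
theorem surfaceIntegral_pullback {o' : SurfaceOrientation S'} {o : SurfaceOrientation S}
    (ψ : Diffeomorph (𝓡 2) (𝓡 2) S' S ∞) (hψ : o'.IsPreservedBy o ψ) {w : TwoForm S}
    (hw : w.IsCont) (hw' : (w.pullback ψ).IsCont) :
    surfaceIntegral o' (w.pullback ψ) = surfaceIntegral o w := by
  have hρ : ∀ j, Continuous (chartPartition S j) := fun j =>
    (chartPartition S j).contMDiff.continuous
  -- The partition of unity of the target cuts `w` into pieces supported in single charts, to which
  -- the previous case applies.
  have h1 : w.pullback ψ = ∑ j ∈ chartIndex S,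
      TwoForm.pullback ψ (fun x => chartPartition S j x • w x) := by
    have h : ∀ j, TwoForm.pullback ψ (fun x => chartPartition S j x • w x) =
      fun x => chartPartition S j (ψ x) • w.pullback ψ x := fun j => rfl
    funext x
    simp only [Finset.sum_apply, h]
    rw [← Finset.sum_smul, sum_chartPartition, one_smul]
  rw [h1, surfaceIntegral_sum, surfaceIntegral_eq_sum]
  · refine Finset.sum_congr rfl fun j _ => ?_
    rw [surfaceIntegral_pullback_of_support ψ hψ (hw.smul (hρ j)) (isClosed_tsupport _)
      (chartPartition_tsupport S j) fun x hx => by simp [image_eq_zero_of_notMem_tsupport hx]]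
    simp only [density_smul]
  · intro j _
    exact hw'.smul ((hρ j).comp ψ.continuous)

/-- The integral over a disjoint union. -/
theorem surfaceIntegral_disjointSum (o : SurfaceOrientation S) (o' : SurfaceOrientation S')
    {w : TwoForm (S ⊕ S')} (hw : w.IsCont) {w₁ : TwoForm S} {w₂ : TwoForm S'}
    (h₁ : ∀ x, w (Sum.inl x) = w₁ x) (h₂ : ∀ x, w (Sum.inr x) = w₂ x) :
    surfaceIntegral (o.sum o') w = surfaceIntegral o w₁ + surfaceIntegral o' w₂ := by
  -- The partition of unity chosen on `S ⊕ S'` is unrelated to those on the summands. The latter,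
  -- extended by zero, cut `w` into pieces supported in single charts, where the integral no longer
  -- depends on any partition.
  let r₁ : S → S ⊕ S' → ℝ := fun j => Sum.elim (chartPartition S j) 0
  let r₂ : S' → S ⊕ S' → ℝ := fun j => Sum.elim 0 (chartPartition S' j)
  have hr₁ : ∀ j, Continuous (r₁ j) := fun j =>
    (chartPartition S j).contMDiff.continuous.sumElim continuous_const
  have hr₂ : ∀ j, Continuous (r₂ j) := fun j =>
    Continuous.sumElim continuous_const (chartPartition S' j).contMDiff.continuous
  have hd : w = (∑ j ∈ chartIndex S, fun x => r₁ j x • w x) +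
      ∑ j ∈ chartIndex S', fun x => r₂ j x • w x := by
    funext x
    rcases x with x | x <;>
    simp [r₁, r₂, ← Finset.sum_smul, sum_chartPartition]
  conv_lhs => rw [hd]
  rw [surfaceIntegral_add _ (.sum fun j _ => hw.smul (hr₁ j)) (.sum fun j _ => hw.smul (hr₂ j)),
    surfaceIntegral_sum _ _ (fun j _ => hw.smul (hr₁ j)),
    surfaceIntegral_sum _ _ (fun j _ => hw.smul (hr₂ j)), surfaceIntegral_eq_sum o,
    surfaceIntegral_eq_sum o']
  congr 1
  · refine Finset.sum_congr rfl fun j _ => ?_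
    rw [surfaceIntegral_of_support _ (hw.smul (hr₁ j)) (x₀ := Sum.inl j)
      (C := Sum.inl '' tsupport (chartPartition S j))
      (Topology.IsClosedEmbedding.inl.isClosedMap _ (isClosed_tsupport _))]
    · rw [ChartedSpace.sum_chartAt_inl, OpenPartialHomeomorph.lift_openEmbedding_target]
      refine setIntegral_congr_fun (chartAt R2 j).open_target.measurableSet fun y hy => ?_
      have h := congrArg (fun v => frameSign (o ((chartAt R2 j).symm y)) v *
        w₁ ((chartAt R2 j).symm y) v) (funext fun i =>
        chartFrame_inl (S' := S') j ((chartAt R2 j).symm y) ((chartAt R2 j).map_target hy) i)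
      simp only [density_smul]
      congr 1
      refine Eq.trans ?_ h.symm
      unfold density
      rw [ChartedSpace.sum_chartAt_inl]
      simp only [OpenPartialHomeomorph.lift_openEmbedding_symm, Function.comp, h₁]
      rfl
    · rw [ChartedSpace.sum_chartAt_inl, OpenPartialHomeomorph.lift_openEmbedding_source]
      exact image_mono (chartPartition_tsupport S j)
    · rintro (x | x) hx
      · simp [r₁, image_eq_zero_of_notMem_tsupport fun h => hx ⟨x, h, rfl⟩]
      · simp [r₁]
  · refine Finset.sum_congr rfl fun j _ => ?_
    rw [surfaceIntegral_of_support _ (hw.smul (hr₂ j)) (x₀ := Sum.inr j)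
      (C := Sum.inr '' tsupport (chartPartition S' j))
      (Topology.IsClosedEmbedding.inr.isClosedMap _ (isClosed_tsupport _))]
    · rw [ChartedSpace.sum_chartAt_inr, OpenPartialHomeomorph.lift_openEmbedding_target]
      refine setIntegral_congr_fun (chartAt R2 j).open_target.measurableSet fun y hy => ?_
      have h := congrArg (fun v => frameSign (o' ((chartAt R2 j).symm y)) v *
        w₂ ((chartAt R2 j).symm y) v) (funext fun i =>
        chartFrame_inr (S := S) j ((chartAt R2 j).symm y) ((chartAt R2 j).map_target hy) i)
      simp only [density_smul]
      congr 1
      refine Eq.trans ?_ h.symm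
      unfold density
      rw [ChartedSpace.sum_chartAt_inr]
      simp only [OpenPartialHomeomorph.lift_openEmbedding_symm, Function.comp, h₂]
      rfl
    · rw [ChartedSpace.sum_chartAt_inr, OpenPartialHomeomorph.lift_openEmbedding_source]
      exact image_mono (chartPartition_tsupport S' j)
    · rintro (x | x) hx
      · simp [r₂]
      · simp [r₂, image_eq_zero_of_notMem_tsupport fun h => hx ⟨x, h, rfl⟩]

end Compact

end Integration

/-! ### Maurer-Cartan forms of gauge transformations and their angular lifts -/

section GaugeForms

variable {S : Type*} [TopologicalSpace S] [ChartedSpace R2 S] [IsManifold (𝓡 2) ∞ S]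

theorem wedgePairing_apply (α β : OneForm (𝓡 2) S LieT) (x : S)
    (v : Fin 2 → TangentSpace (𝓡 2) x) :
    wedgePairing α β x v = -(((α x (v 0) : LieT) : ℂ).im * ((β x (v 1) : LieT) : ℂ).im -
      ((α x (v 1) : LieT) : ℂ).im * ((β x (v 0) : LieT) : ℂ).im) / (4 * Real.pi ^ 2) := by
  change liePairing _ _ - liePairing _ _ = _
  rw [liePairing_eq, liePairing_eq]
  ring

theorem lieT_ext {a b : LieT} (h : (a : ℂ).im = (b : ℂ).im) : a = b := by
  have ha : (a : ℂ).re = 0 := a.2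
  have hb : (b : ℂ).re = 0 := b.2
  exact Subtype.ext (Complex.ext (ha.trans hb.symm) h)

theorem Gauge.mc_apply {l : Gauge S} {x : S} {D : R2 →L[ℝ] ℂ}
    (hD : HasMFDerivAt (𝓡 2) 𝓘(ℝ, ℂ) (fun x => (l x : ℂ)) x D) (v : R2) :
    ((l.mc x v : LieT) : ℂ) = (l x : ℂ)⁻¹ * D v := by
  have h : mfderiv (𝓡 2) 𝓘(ℝ, ℂ) (fun x => (l x : ℂ)) x = _ :=
    mfderiv_comp x (contMDiff_coe_circle.mdifferentiableAt (x := l x) (by simp))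
      (l.contMDiff.mdifferentiableAt (x := x) (by simp))
  rw [← hD.mfderiv, h]
  rfl

/-- The Maurer-Cartan form of a gauge transformation `exp (iθ)` is `i dθ`. -/
theorem Gauge.mc_of_lift {l : Gauge S} {x : S} {θ : S → ℝ}
    (hθ : MDifferentiableAt (𝓡 2) 𝓘(ℝ, ℝ) θ x) (h : ∀ᶠ y in 𝓝 x, l y = Circle.exp (θ y))
    (v : TangentSpace (𝓡 2) x) :
    ((l.mc x v : LieT) : ℂ).im = mfderiv (𝓡 2) 𝓘(ℝ, ℝ) θ x v := by
  have h1 : (fun y => (l y : ℂ)) =ᶠ[𝓝 x] (fun t : ℝ => Complex.exp (t * Complex.I)) ∘ θ := by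
    filter_upwards [h] with y hy
    simp [hy]
  have h2 : HasFDerivAt (fun t : ℝ => Complex.exp (t * Complex.I)) _ (θ x) :=
    ((Complex.ofRealCLM.hasFDerivAt (x := θ x)).mul_const Complex.I).cexp
  have h3 := (h2.hasMFDerivAt.comp x hθ.hasMFDerivAt).congr_of_eventuallyEq h1
  have h5 := Gauge.mc_apply h3 v
  rw [h.self_of_nhds] at h5
  have h4 : ∀ t : ℝ, (((Circle.exp (θ x) : Circle) : ℂ)⁻¹ *
      (Complex.exp (θ x * Complex.I) • (Complex.I • (t : ℂ)))).im = t := by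
    intro t
    rw [Circle.coe_exp, smul_eq_mul, inv_mul_cancel_left₀ (Complex.exp_ne_zero _)]
    simp
  exact (congrArg Complex.im h5).trans (h4 _)

theorem contDiffAt_arg {z : ℂ} (hz : z ∈ Complex.slitPlane) : ContDiffAt ℝ ∞ Complex.arg z := by
  have h : ContDiffAt ℝ ∞ (fun z => (Complex.log z).im) z :=
    Complex.imCLM.contDiff.contDiffAt.comp z ((Complex.contDiffAt_log hz).restrict_scalars ℝ)
  simpa only [Complex.log_im] using h

omit [IsManifold (𝓡 2) ∞ S] in
/-- A gauge transformation is locally of the form `exp (iθ)`. -/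
theorem Gauge.exists_lift (l : Gauge S) (x : S) :
    ∃ (θ : S → ℝ) (U : Set S), IsOpen U ∧ x ∈ U ∧ (∀ y ∈ U, ContMDiffAt (𝓡 2) 𝓘(ℝ, ℝ) ∞ θ y) ∧
      ∀ y, l y = Circle.exp (θ y) := by
  have h1 : ∀ y, ContMDiffAt (𝓡 2) 𝓘(ℝ, ℂ) ∞ (fun y => ((l y / l x : Circle) : ℂ)) y := fun y =>
    contMDiff_coe_circle.contMDiffAt.comp y ((l.contMDiff.contMDiffAt).div contMDiffAt_const)
  -- Dividing by `l x` places the value at `x` at `1`, inside the slit plane. Only smoothness of the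
  -- lift is local: its exponential is `l` everywhere, whatever the branch of the argument.
  refine ⟨fun y => Complex.arg (l x) + Complex.arg ((l y / l x : Circle) : ℂ),
    (fun y => ((l y / l x : Circle) : ℂ)) ⁻¹' Complex.slitPlane,
    Complex.isOpen_slitPlane.preimage (continuous_iff_continuousAt.2 fun y => (h1 y).continuousAt),
    by simp, fun y hy => contMDiffAt_const.add ((contDiffAt_arg hy).contMDiffAt.comp y (h1 y)),
    fun y => ?_⟩
  rw [Circle.exp_add, Circle.exp_arg, Circle.exp_arg, mul_div_cancel]

/-- The sum of local angles of the factors is a local angle of the product, and the Maurer-Cartan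
form is `i` times the differential of the angle. -/
theorem Gauge.mc_mul (l₁ l₂ : Gauge S) : (l₁ * l₂).mc = l₁.mc + l₂.mc := by
  ext x v
  obtain ⟨θ₁, _, -, hx₁, h₁, e₁⟩ := l₁.exists_lift x
  obtain ⟨θ₂, _, -, hx₂, h₂, e₂⟩ := l₂.exists_lift x
  have d₁ := (h₁ x hx₁).mdifferentiableAt (by simp)
  have d₂ := (h₂ x hx₂).mdifferentiableAt (by simp)
  congr 1
  refine lieT_ext ?_
  rw [Gauge.mc_of_lift (θ := fun y => θ₁ y + θ₂ y) (d₁.add d₂)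
    (.of_forall fun y => by rw [Circle.exp_add, ← e₁, ← e₂]; rfl)]
  rw [OneForm.add_apply, Submodule.coe_add, Complex.add_im,
    Gauge.mc_of_lift d₁ (.of_forall e₁), Gauge.mc_of_lift d₂ (.of_forall e₂)]
  have := (d₁.hasMFDerivAt.add d₂.hasMFDerivAt).mfderiv
  exact congrArg (fun L => L v) this

theorem Gauge.mc_one : (1 : Gauge S).mc = 0 := by
  have := Gauge.mc_mul (1 : Gauge S) 1
  rw [mul_one] at this
  exact left_eq_add.1 this

/-- The gauge transformation `exp (iH)`. -/
def gaugeExp (H : ContMDiffMap (𝓡 2) 𝓘(ℝ, ℝ) S ℝ ∞) : Gauge S :=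
  ⟨fun x => Circle.exp (H x), contMDiff_circleExp.comp H.contMDiff⟩

theorem gaugeExp_mc (H : ContMDiffMap (𝓡 2) 𝓘(ℝ, ℝ) S ℝ ∞) (x : S)
    (v : TangentSpace (𝓡 2) x) :
    (((gaugeExp H).mc x v : LieT) : ℂ).im = mfderiv (𝓡 2) 𝓘(ℝ, ℝ) H x v :=
  Gauge.mc_of_lift (H.contMDiff.mdifferentiableAt (by simp)) (.of_forall fun _ => rfl) v

/-- Multiplication by a constant does not change the Maurer-Cartan form. -/
theorem Gauge.mc_const_mul (l l' : Gauge S) (c : Circle) (h : ∀ x, l' x = c * l x) :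
    l'.mc = l.mc := by
  let g : Gauge S := ⟨fun _ => c, contMDiff_const⟩
  have h1 : l' = g * l := ContMDiffMap.ext h
  have h2 : g.mc = 0 := OneForm.pullback_const _ _
  rw [h1, Gauge.mc_mul, h2, zero_add]

theorem contMDiffAt_chart_symm {x₀ : S} {y : R2} (hy : y ∈ (chartAt R2 x₀).target) :
    ContMDiffAt (𝓡 2) (𝓡 2) ∞ (chartAt R2 x₀).symm y :=
  (contMDiffOn_chart_symm (I := 𝓡 2) (n := ∞) (x := x₀)).contMDiffAt
    ((chartAt R2 x₀).open_target.mem_nhds hy)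

theorem contDiffAt_comp_chart_symm {F : Type*} [NormedAddCommGroup F] [NormedSpace ℝ F]
    {x₀ : S} {y : R2} {f : S → F} (hy : y ∈ (chartAt R2 x₀).target)
    (hf : ContMDiffAt (𝓡 2) 𝓘(ℝ, F) ∞ f ((chartAt R2 x₀).symm y)) :
    ContDiffAt ℝ ∞ (fun y => f ((chartAt R2 x₀).symm y)) y :=
  (hf.comp y (contMDiffAt_chart_symm hy)).contDiffAt

theorem mfderiv_chartFrame {x₀ : S} {y : R2} {f : S → ℝ} (hy : y ∈ (chartAt R2 x₀).target)
    (hf : ContMDiffAt (𝓡 2) 𝓘(ℝ, ℝ) ∞ f ((chartAt R2 x₀).symm y)) (i : Fin 2) :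
    mfderiv (𝓡 2) 𝓘(ℝ, ℝ) f ((chartAt R2 x₀).symm y)
        (chartFrame (chartAt R2 x₀) ((chartAt R2 x₀).symm y) i) =
      fderiv ℝ (fun y => f ((chartAt R2 x₀).symm y)) y (EuclideanSpace.single i 1) := by
  have h := mfderiv_comp y (hf.mdifferentiableAt (by simp)) (mdifferentiableAt_chart_symm hy)
  unfold chartFrame
  rw [(chartAt R2 x₀).right_inv hy]
  rw [← mfderiv_eq_fderiv]
  exact (congrArg (fun L : R2 →L[ℝ] ℝ => L (EuclideanSpace.single i 1)) h).symm

/-- The component of `⟨dθ₁ ∧ dθ₂⟩` in coordinates. -/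
theorem wedge_chartFrame_of_lift {l₁ l₂ : Gauge S} {x₀ : S} {y : R2}
    (hy : y ∈ (chartAt R2 x₀).target) {θ₁ θ₂ : S → ℝ}
    (h₁ : ContMDiffAt (𝓡 2) 𝓘(ℝ, ℝ) ∞ θ₁ ((chartAt R2 x₀).symm y))
    (h₂ : ContMDiffAt (𝓡 2) 𝓘(ℝ, ℝ) ∞ θ₂ ((chartAt R2 x₀).symm y))
    (e₁ : ∀ᶠ x in 𝓝 ((chartAt R2 x₀).symm y), l₁ x = Circle.exp (θ₁ x))
    (e₂ : ∀ᶠ x in 𝓝 ((chartAt R2 x₀).symm y), l₂ x = Circle.exp (θ₂ x)) :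
    wedgePairing l₁.mc l₂.mc ((chartAt R2 x₀).symm y)
        (chartFrame (chartAt R2 x₀) ((chartAt R2 x₀).symm y)) =
      -(fderiv ℝ (fun y => θ₁ ((chartAt R2 x₀).symm y)) y (EuclideanSpace.single 0 1) *
          fderiv ℝ (fun y => θ₂ ((chartAt R2 x₀).symm y)) y (EuclideanSpace.single 1 1) -
        fderiv ℝ (fun y => θ₁ ((chartAt R2 x₀).symm y)) y (EuclideanSpace.single 1 1) *
          fderiv ℝ (fun y => θ₂ ((chartAt R2 x₀).symm y)) y (EuclideanSpace.single 0 1)) /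
        (4 * Real.pi ^ 2) := by
  have d₁ := fun i => (Gauge.mc_of_lift (h₁.mdifferentiableAt (by simp)) e₁
    (chartFrame (chartAt R2 x₀) ((chartAt R2 x₀).symm y) i)).trans (mfderiv_chartFrame hy h₁ i)
  have d₂ := fun i => (Gauge.mc_of_lift (h₂.mdifferentiableAt (by simp)) e₂
    (chartFrame (chartAt R2 x₀) ((chartAt R2 x₀).symm y) i)).trans (mfderiv_chartFrame hy h₂ i)
  rw [wedgePairing_apply, d₁, d₂, d₁, d₂]

/-- The density of `⟨dθ₁ ∧ dθ₂⟩` in coordinates. -/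
theorem density_of_lift (o : SurfaceOrientation S) {l₁ l₂ : Gauge S} {x₀ : S} {y : R2}
    (hy : y ∈ (chartAt R2 x₀).target) {θ₁ θ₂ : S → ℝ}
    (h₁ : ContMDiffAt (𝓡 2) 𝓘(ℝ, ℝ) ∞ θ₁ ((chartAt R2 x₀).symm y))
    (h₂ : ContMDiffAt (𝓡 2) 𝓘(ℝ, ℝ) ∞ θ₂ ((chartAt R2 x₀).symm y))
    (e₁ : ∀ᶠ x in 𝓝 ((chartAt R2 x₀).symm y), l₁ x = Circle.exp (θ₁ x))
    (e₂ : ∀ᶠ x in 𝓝 ((chartAt R2 x₀).symm y), l₂ x = Circle.exp (θ₂ x)) :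
    density o (wedgePairing l₁.mc l₂.mc) x₀ ((chartAt R2 x₀).symm y) =
      frameSign (o ((chartAt R2 x₀).symm y)) (chartFrame (chartAt R2 x₀) ((chartAt R2 x₀).symm y)) *
      (-(fderiv ℝ (fun y => θ₁ ((chartAt R2 x₀).symm y)) y (EuclideanSpace.single 0 1) *
          fderiv ℝ (fun y => θ₂ ((chartAt R2 x₀).symm y)) y (EuclideanSpace.single 1 1) -
        fderiv ℝ (fun y => θ₁ ((chartAt R2 x₀).symm y)) y (EuclideanSpace.single 1 1) *
          fderiv ℝ (fun y => θ₂ ((chartAt R2 x₀).symm y)) y (EuclideanSpace.single 0 1)) /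
        (4 * Real.pi ^ 2)) := by
  unfold density
  rw [wedge_chartFrame_of_lift hy h₁ h₂ e₁ e₂]

end GaugeForms

/-! ### Stokes' theorem, and invariance of the pairing under factors `exp (iH)` -/

section Stokes

open MeasureTheory

/-- Integration by parts against the constant function `1`. -/
theorem integral_fderiv_eq_zero {A : R2 → ℝ} (hA : ContDiff ℝ 1 A) (hc : HasCompactSupport A)
    (v : R2) : ∫ y, fderiv ℝ A y v = 0 := by
  have h1 : Integrable (fun y => fderiv ℝ A y v) :=
    ((hA.continuous_fderiv (by simp)).clm_apply continuous_const).integrable_of_hasCompactSupport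
      (hc.fderiv_apply ℝ v)
  have h2 : Integrable A := hA.continuous.integrable_of_hasCompactSupport hc
  have := integral_mul_fderiv_eq_neg_fderiv_mul_of_integrable (μ := (volume : Measure R2))
    (f := fun _ : R2 => (1 : ℝ)) (g := A) (v := v)
    (by simp) (by simpa using h1) (by simpa using h2)
    (fun x _ => differentiableAt_const _) (fun x _ => (hA.differentiable (by simp)) x)
  simpa using this

variable {S : Type*} [TopologicalSpace S] [ChartedSpace R2 S] [IsManifold (𝓡 2) ∞ S]
  [CompactSpace S] [T2Space S]

omit [CompactSpace S] [T2Space S] in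
theorem wedgePairing_add_left (α β γ : OneForm (𝓡 2) S LieT) :
    wedgePairing (α + β) γ = (wedgePairing α γ : TwoForm S) + wedgePairing β γ := by
  funext x
  ext v
  simp only [Pi.add_apply, AlternatingMap.add_apply, wedgePairing_apply, OneForm.add_apply,
    Submodule.coe_add, Complex.add_im]
  ring

omit [CompactSpace S] [T2Space S] in
theorem wedgePairing_add_right (α β γ : OneForm (𝓡 2) S LieT) :
    wedgePairing α (β + γ) = (wedgePairing α β : TwoForm S) + wedgePairing α γ := by
  funext x
  ext v
  simp only [Pi.add_apply, AlternatingMap.add_apply, wedgePairing_apply, OneForm.add_apply,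
    Submodule.coe_add, Complex.add_im]
  ring

omit [CompactSpace S] [T2Space S] in
theorem wedgePairing_swap (α β : OneForm (𝓡 2) S LieT) :
    wedgePairing α β + wedgePairing β α = (0 : TwoForm S) := by
  funext x
  ext v
  simp only [Pi.add_apply, AlternatingMap.add_apply, wedgePairing_apply, Pi.zero_apply,
    AlternatingMap.zero_apply]
  ring

theorem integral_wedge_add_left (o : SurfaceOrientation S) (α β γ : OneForm (𝓡 2) S LieT) :
    surfaceIntegral o (wedgePairing (α + β) γ) =
      surfaceIntegral o (wedgePairing α γ) + surfaceIntegral o (wedgePairing β γ) := by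
  rw [wedgePairing_add_left]
  exact surfaceIntegral_add o (wedgePairing_isCont _ _) (wedgePairing_isCont _ _)

theorem integral_wedge_add_right (o : SurfaceOrientation S) (α β γ : OneForm (𝓡 2) S LieT) :
    surfaceIntegral o (wedgePairing α (β + γ)) =
      surfaceIntegral o (wedgePairing α β) + surfaceIntegral o (wedgePairing α γ) := by
  rw [wedgePairing_add_right]
  exact surfaceIntegral_add o (wedgePairing_isCont _ _) (wedgePairing_isCont _ _)

theorem integral_wedge_swap (o : SurfaceOrientation S) (α β : OneForm (𝓡 2) S LieT) :
    surfaceIntegral o (wedgePairing α β) = -surfaceIntegral o (wedgePairing β α) := by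
  rw [eq_neg_iff_add_eq_zero,
    ← surfaceIntegral_add o (wedgePairing_isCont _ _) (wedgePairing_isCont _ _),
    wedgePairing_swap, surfaceIntegral_zero]

/-- Stokes' theorem for `dH ∧ dθ`, where `H` is supported in a small open set. -/
theorem integral_wedge_gaugeExp_of_support (o : SurfaceOrientation S)
    (H : ContMDiffMap (𝓡 2) 𝓘(ℝ, ℝ) S ℝ ∞) (l : Gauge S) {x₀ : S} {U : Set S} (hU : IsOpen U)
    (hUs : U ⊆ (chartAt R2 x₀).source) {σ : ℝ}
    (hσ : ∀ x ∈ U, frameSign (o x) (chartFrame (chartAt R2 x₀) x) = σ) {θ : S → ℝ}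
    (hθ : ∀ x ∈ U, ContMDiffAt (𝓡 2) 𝓘(ℝ, ℝ) ∞ θ x) (hl : ∀ x, l x = Circle.exp (θ x))
    (hH : tsupport H ⊆ U) :
    surfaceIntegral o (wedgePairing (gaugeExp H).mc l.mc) = 0 := by
  classical
  set e := chartAt R2 x₀ with he
  have hw0 : ∀ x ∉ tsupport H, wedgePairing (gaugeExp H).mc l.mc x = 0 := by
    intro x hx
    ext v
    have h1 : H =ᶠ[𝓝 x] fun _ => (0 : ℝ) := notMem_tsupport_iff_eventuallyEq.1 hx
    have h2 : ∀ v, (((gaugeExp H).mc x v : LieT) : ℂ).im = 0 := by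
      intro v
      rw [gaugeExp_mc, h1.mfderiv_eq, mfderiv_const]
      rfl
    rw [wedgePairing_apply, h2, h2]
    simp
  rw [surfaceIntegral_of_support o (wedgePairing_isCont _ _) (isClosed_tsupport H)
    (hH.trans hUs) hw0]
  set V : Set R2 := e.target ∩ e.symm ⁻¹' U with hV
  have hVo : IsOpen V := e.symm.continuousOn.isOpen_inter_preimage e.open_target hU
  set K : Set R2 := e '' tsupport H with hK
  have hKc : IsCompact K :=
    (isClosed_tsupport H).isCompact.image_of_continuousOn (e.continuousOn.mono (hH.trans hUs))
  have hKV : K ⊆ V := by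
    rintro _ ⟨x, hx, rfl⟩
    refine ⟨e.map_source (hUs (hH hx)), ?_⟩
    rw [mem_preimage, e.left_inv (hUs (hH hx))]
    exact hH hx
  let h : R2 → ℝ := fun y => H (e.symm y)
  let t : R2 → ℝ := fun y => θ (e.symm y)
  have hh0 : ∀ y ∈ V, y ∉ K → h y = 0 := fun y hy hyK =>
    image_eq_zero_of_notMem_tsupport (f := H) (x := e.symm y) fun h' =>
      hyK ⟨_, h', e.right_inv hy.1⟩
  have hhd : ∀ y ∈ V, ContDiffAt ℝ ∞ h y := fun y hy =>
    contDiffAt_comp_chart_symm hy.1 H.contMDiff.contMDiffAt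
  have htd : ∀ y ∈ V, ContDiffAt ℝ ∞ t y := fun y hy =>
    contDiffAt_comp_chart_symm hy.1 (hθ _ hy.2)
  have htd' : ∀ y ∈ V, ContDiffAt ℝ 1 (fderiv ℝ t) y := fun y hy =>
    (htd y hy).fderiv_right (by rw [one_add_one_eq_two]; exact ENat.LEInfty.out)
  -- These are the components of `h dt`. The angle `t` is smooth only on `V`, but `h` vanishes off
  -- the compact set `K ⊆ V`, so the extension by zero is `C¹` on the plane.
  let A : R2 → R2 → ℝ := fun v y => if y ∈ V then h y * fderiv ℝ t y v else 0
  have hA0 : ∀ v, ∀ y ∉ K, A v y = 0 := by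
    intro v y hy
    by_cases hyV : y ∈ V
    · simp only [A, if_pos hyV, hh0 y hyV hy, zero_mul]
    · exact if_neg hyV
  have hA : ∀ v, ContDiff ℝ 1 (A v) := by
    intro v
    rw [contDiff_iff_contDiffAt]
    intro y
    by_cases hy : y ∈ V
    · refine ContDiffAt.congr_of_eventuallyEq (f := fun y => h y * fderiv ℝ t y v)
        (((hhd y hy).of_le (by exact_mod_cast le_top)).mul ((htd' y hy).clm_apply contDiffAt_const)) ?_
      filter_upwards [hVo.mem_nhds hy] with z hz
      exact if_pos hz
    · refine ContDiffAt.congr_of_eventuallyEq (f := fun _ => (0 : ℝ)) contDiffAt_const ?_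
      filter_upwards [hKc.isClosed.isOpen_compl.mem_nhds fun h' => hy (hKV h')] with z hz
      exact hA0 v z hz
  have hAc : ∀ v, HasCompactSupport (A v) := fun v => HasCompactSupport.intro hKc (hA0 v)
  have hAd : ∀ v u, ∀ y ∈ V, fderiv ℝ (A v) y u =
      fderiv ℝ h y u * fderiv ℝ t y v + h y * fderiv ℝ (fderiv ℝ t) y u v := by
    intro v u y hy
    have h1 : A v =ᶠ[𝓝 y] fun y => h y * fderiv ℝ t y v := by
      filter_upwards [hVo.mem_nhds hy] with z hz
      exact if_pos hz
    have h2 : HasFDerivAt h (fderiv ℝ h y) y :=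
      ((hhd y hy).differentiableAt (by simp)).hasFDerivAt
    have h3 : HasFDerivAt (fderiv ℝ t) (fderiv ℝ (fderiv ℝ t) y) y :=
      ((htd' y hy).differentiableAt (by simp)).hasFDerivAt
    have h4 : fderiv ℝ (fun y => h y * fderiv ℝ t y v) y = _ :=
      (h2.mul (h3.clm_apply (hasFDerivAt_const v y))).fderiv
    rw [h1.fderiv_eq, h4]
    simp
    ring
  let u₀ : R2 := EuclideanSpace.single 0 1
  let u₁ : R2 := EuclideanSpace.single 1 1
  have hint : ∀ v u, Integrable (fun y => fderiv ℝ (A v) y u) := fun v u =>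
    (((hA v).continuous_fderiv (by simp)).clm_apply continuous_const).integrable_of_hasCompactSupport
      ((hAc v).fderiv_apply ℝ u)
  have hAd0 : ∀ v u, ∀ y ∉ K, fderiv ℝ (A v) y u = 0 := by
    intro v u y hy
    have h1 : A v =ᶠ[𝓝 y] fun _ => (0 : ℝ) := by
      filter_upwards [hKc.isClosed.isOpen_compl.mem_nhds hy] with z hz
      exact hA0 v z hz
    rw [h1.fderiv_eq]
    simp
  -- In coordinates `dh ∧ dt = d(h dt)`: the terms with second derivatives of `t` cancel by
  -- symmetry. The sign `σ`, constant on `U`, leaves the integral.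
  have key : ∀ y ∈ e.target, density o (wedgePairing (gaugeExp H).mc l.mc) x₀ (e.symm y) =
      -σ / (4 * Real.pi ^ 2) * (fderiv ℝ (A u₁) y u₀ - fderiv ℝ (A u₀) y u₁) := by
    intro y hy
    by_cases hyV : y ∈ V
    · rw [density_of_lift o hy (θ₁ := H) (θ₂ := θ) H.contMDiff.contMDiffAt (hθ _ hyV.2)
        (.of_forall fun _ => rfl) (.of_forall hl), hσ _ hyV.2, hAd _ _ y hyV, hAd _ _ y hyV]
      have hs : fderiv ℝ (fderiv ℝ t) y u₀ u₁ = fderiv ℝ (fderiv ℝ t) y u₁ u₀ :=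
        ((htd y hyV).isSymmSndFDerivAt (by simpa using ENat.LEInfty.out)).eq u₀ u₁
      rw [hs]
      simp only [h, t, u₀, u₁]
      ring
    · have h1 : y ∉ K := fun h' => hyV (hKV h')
      rw [hAd0 _ _ y h1, hAd0 _ _ y h1, density_eq_zero]
      · ring
      · exact hw0 _ fun h' => h1 ⟨_, h', e.right_inv hy⟩
  rw [setIntegral_congr_fun e.open_target.measurableSet key,
    setIntegral_eq_integral_of_forall_compl_eq_zero, integral_const_mul, integral_sub (hint _ _)
    (hint _ _), integral_fderiv_eq_zero (hA _) (hAc _), integral_fderiv_eq_zero (hA _) (hAc _)]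
  · simp
  · intro y hy
    have h1 : y ∉ K := fun h' => hy (hKV h').1
    rw [hAd0 _ _ y h1, hAd0 _ _ y h1]
    simp

/-- Stokes' theorem: `∫ ⟨dH ∧ l^* ϑ⟩ = 0`. -/
theorem integral_wedge_gaugeExp (o : SurfaceOrientation S)
    (H : ContMDiffMap (𝓡 2) 𝓘(ℝ, ℝ) S ℝ ∞) (l : Gauge S) :
    surfaceIntegral o (wedgePairing (gaugeExp H).mc l.mc) = 0 := by
  classical
  have hloc : ∀ x : S, ∃ U : Set S, IsOpen U ∧ x ∈ U ∧ U ⊆ (chartAt R2 x).source ∧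
      (∀ y ∈ U, frameSign (o y) (chartFrame (chartAt R2 x) y) =
        frameSign (o x) (chartFrame (chartAt R2 x) x)) ∧
      ∃ θ : S → ℝ, (∀ y ∈ U, ContMDiffAt (𝓡 2) 𝓘(ℝ, ℝ) ∞ θ y) ∧ ∀ y, l y = Circle.exp (θ y) := by
    intro x
    obtain ⟨θ, U, hU, hx, hθ, hl⟩ := l.exists_lift x
    obtain ⟨W, hW, hWo, hxW⟩ :=
      eventually_nhds_iff.1 (frameSign_eventuallyEq o (mem_chart_source R2 x))
    exact ⟨U ∩ W ∩ (chartAt R2 x).source, (hU.inter hWo).inter (chartAt R2 x).open_source,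
      ⟨⟨hx, hxW⟩, mem_chart_source R2 x⟩, inter_subset_right, fun y hy => hW y hy.1.2,
      θ, fun y hy => hθ y hy.1.1, hl⟩
  choose U hU hxU hUs hσ θ hθ hl using hloc
  obtain ⟨ρ, hρ⟩ := SmoothPartitionOfUnity.exists_isSubordinate (𝓡 2) isClosed_univ U hU
    (fun x _ => mem_iUnion_of_mem x (hxU x))
  let I : Finset S := (ρ.locallyFinite.finite_nonempty_of_compact).toFinset
  have hI : ∀ j ∉ I, ∀ x, ρ j x = 0 := by
    intro j hj x
    by_contra hx
    exact hj ((Set.Finite.mem_toFinset _).2 ⟨x, hx⟩)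
  have hsum : ∀ x, ∑ j ∈ I, ρ j x = 1 := by
    intro x
    refine ρ.sum_finsupport' x (mem_univ x) fun i hi => ?_
    by_contra h
    exact (ρ.mem_finsupport x).1 hi (hI i h x)
  have hadd : ∀ H H' : ContMDiffMap (𝓡 2) 𝓘(ℝ, ℝ) S ℝ ∞,
      gaugeExp (H + H') = gaugeExp H * gaugeExp H' := fun H H' =>
    ContMDiffMap.ext fun x => Circle.exp_add _ _
  have hzero : gaugeExp (0 : ContMDiffMap (𝓡 2) 𝓘(ℝ, ℝ) S ℝ ∞) = 1 :=
    ContMDiffMap.ext fun x => Circle.exp_zero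
  -- `gaugeExp` turns the sum of the localized functions `ρ j * H` into a product, and `mc` turns
  -- the product back into a sum of forms with small support.
  have hind : ∀ J : Finset S,
      surfaceIntegral o (wedgePairing (gaugeExp (∑ j ∈ J, ρ j * H)).mc l.mc) = 0 := by
    intro J
    induction J using Finset.induction_on with
    | empty =>
      rw [Finset.sum_empty, hzero, Gauge.mc_one]
      have := integral_wedge_add_left o 0 0 l.mc
      rw [add_zero] at this
      exact left_eq_add.1 this
    | insert a J ha ih =>
      rw [Finset.sum_insert ha, hadd, Gauge.mc_mul, integral_wedge_add_left, ih, add_zero]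
      refine integral_wedge_gaugeExp_of_support o _ l (hU a) (hUs a) (hσ a) (hθ a) (hl a) ?_
      exact (closure_mono (Function.support_mul_subset_left _ _)).trans (hρ a)
  have hH : H = ∑ j ∈ I, ρ j * H := by
    rw [← Finset.sum_mul]
    refine ContMDiffMap.ext fun x => ?_
    have : (∑ j ∈ I, ρ j) x = 1 := by
      rw [← hsum x]
      exact map_sum (ContMDiffMap.evalRingHom x) _ _
    change _ = (∑ j ∈ I, ρ j) x * H x
    rw [this, one_mul]
  rw [hH]
  exact hind I

end Stokes

/-! ### Plane determinants and smooth step functions -/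

section Plane

open MeasureTheory

/-- The map to the plane with the given components. -/
def planeMap (a b : R2 → ℝ) (y : R2) : R2 := !₂[a y, b y]

theorem planeMap_contDiffAt {a b : R2 → ℝ} {y : R2} (ha : ContDiffAt ℝ ∞ a y)
    (hb : ContDiffAt ℝ ∞ b y) : ContDiffAt ℝ ∞ (planeMap a b) y := by
  rw [contDiffAt_euclidean]
  intro i
  fin_cases i
  · exact ha
  · exact hb

theorem plane_det (L : R2 →L[ℝ] R2) : L.det =
    L (EuclideanSpace.single 0 1) 0 * L (EuclideanSpace.single 1 1) 1 -
      L (EuclideanSpace.single 1 1) 0 * L (EuclideanSpace.single 0 1) 1 := by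
  change LinearMap.det (L : R2 →ₗ[ℝ] R2) = _
  rw [← LinearMap.det_toMatrix (EuclideanSpace.basisFun (Fin 2) ℝ).toBasis, Matrix.det_fin_two]
  simp [LinearMap.toMatrix_apply]

theorem planeMap_det {a b : R2 → ℝ} {y : R2} (ha : DifferentiableAt ℝ a y)
    (hb : DifferentiableAt ℝ b y) : (fderiv ℝ (planeMap a b) y).det =
      fderiv ℝ a y (EuclideanSpace.single 0 1) * fderiv ℝ b y (EuclideanSpace.single 1 1) -
      fderiv ℝ a y (EuclideanSpace.single 1 1) * fderiv ℝ b y (EuclideanSpace.single 0 1) := by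
  have h : DifferentiableAt ℝ (planeMap a b) y := by
    rw [differentiableAt_euclidean]
    intro i
    fin_cases i
    · exact ha
    · exact hb
  have h0 : ∀ i v, fderiv ℝ (planeMap a b) y v i = fderiv ℝ (fun z => planeMap a b z i) y v := by
    intro i v
    have : fderiv ℝ (fun z => planeMap a b z i) y = _ :=
      ((EuclideanSpace.proj (𝕜 := ℝ) i).hasFDerivAt.comp y h.hasFDerivAt).fderiv
    rw [this]
    rfl
  rw [plane_det, h0, h0, h0, h0]
  rfl

/-- A smooth step function from `0` to `2π`. -/
structure IsStep (δ : ℝ) (τ : ℝ → ℝ) : Prop where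
  contDiff : ContDiff ℝ ∞ τ
  left : ∀ s ≤ -δ, τ s = 0
  right : ∀ s, δ ≤ s → τ s = 2 * Real.pi

theorem exists_isStep {δ : ℝ} (hδ : 0 < δ) : ∃ τ, IsStep δ τ := by
  refine ⟨fun s => 2 * Real.pi * Real.smoothTransition ((s + δ) / (2 * δ)), ?_, ?_, ?_⟩
  · exact contDiff_const.mul (Real.smoothTransition.contDiff.comp
      ((contDiff_id.add contDiff_const).div_const _))
  · intro s hs
    rw [Real.smoothTransition.zero_of_nonpos, mul_zero]
    exact div_nonpos_of_nonpos_of_nonneg (by linarith) (by linarith)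
  · intro s hs
    rw [Real.smoothTransition.eq_one_iff_one_le.2, mul_one]
    rw [le_div_iff₀ (by linarith)]
    linarith

namespace IsStep

variable {δ : ℝ} {τ : ℝ → ℝ}

theorem deriv_eq_zero (h : IsStep δ τ) {s : ℝ} (hs : δ < |s|) : deriv τ s = 0 := by
  rcases lt_abs.1 hs with h1 | h1
  · have : τ =ᶠ[𝓝 s] fun _ => 2 * Real.pi := by
      filter_upwards [lt_mem_nhds h1] with t ht
      exact h.right t ht.le
    rw [this.deriv_eq, deriv_const]
  · have : τ =ᶠ[𝓝 s] fun _ => 0 := by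
      filter_upwards [gt_mem_nhds (show s < -δ by linarith)] with t ht
      exact h.left t ht.le
    rw [this.deriv_eq, deriv_const]

theorem integral_deriv (h : IsStep δ τ) : ∫ s, deriv τ s = 2 * Real.pi := by
  have hd : Continuous (deriv τ) := h.contDiff.continuous_deriv (by simp)
  have hc : HasCompactSupport (deriv τ) := by
    refine HasCompactSupport.intro (isCompact_Icc (a := -δ) (b := δ)) fun s hs => ?_
    refine h.deriv_eq_zero ?_
    by_contra h'
    exact hs (abs_le.1 (not_lt.1 h'))
  have h0 : Filter.Tendsto τ Filter.atBot (𝓝 0) :=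
    tendsto_const_nhds.congr' ((Filter.eventually_le_atBot (-δ)).mono fun s hs => (h.left s hs).symm)
  have h1 : Filter.Tendsto τ Filter.atTop (𝓝 (2 * Real.pi)) :=
    tendsto_const_nhds.congr' ((Filter.eventually_ge_atTop δ).mono fun s hs => (h.right s hs).symm)
  rw [integral_of_hasDerivAt_of_tendsto
    (fun s => ((h.contDiff.differentiable (by simp)) s).hasDerivAt)
    (hd.integrable_of_hasCompactSupport hc) h0 h1, sub_zero]

/-- By Fubini, `dτ(z₀) ∧ dτ(z₁)` has mass `(2π)²`; the factor `1/(4π²)` of the pairing normalizes it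
to `1`. -/
theorem integral_plane (h : IsStep δ τ) :
    ∫ z : R2, deriv τ (z 0) * deriv τ (z 1) = (2 * Real.pi) ^ 2 := by
  have h1 := (PiLp.volume_preserving_toLp (Fin 2)).integral_comp
    (MeasurableEquiv.toLp 2 (Fin 2 → ℝ)).measurableEmbedding
    (fun z : R2 => deriv τ (z 0) * deriv τ (z 1))
  rw [← h1]
  have h2 := integral_fintype_prod_volume_eq_prod (ι := Fin 2) (E := fun _ => ℝ) (𝕜 := ℝ)
    (fun _ s => deriv τ s)
  simp only [Fin.prod_univ_two, h.integral_deriv] at h2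
  rw [sq, ← h2]

/-- The function `h` on the circle for which `z ↦ z exp (i h(z))` collapses the complement of a
small arc around `1`. -/
theorem contMDiff_circle (h : IsStep δ τ) (hδ : δ ≤ Real.pi / 2) :
    ContMDiff (𝓡 1) 𝓘(ℝ, ℝ) ∞ (fun z : Circle => τ (Complex.arg z) - Complex.arg z) := by
  intro z
  by_cases hz : (z : ℂ) ∈ Complex.slitPlane
  · have h1 : ContMDiffAt (𝓡 1) 𝓘(ℝ, ℝ) ∞ (fun z : Circle => Complex.arg z) z :=
      (contDiffAt_arg hz).contMDiffAt.comp z contMDiff_coe_circle.contMDiffAt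
    exact (h.contDiff.contMDiff.contMDiffAt.comp z h1).sub h1
  · have hz1 : (z : ℂ).re < 0 := by
      rw [Complex.mem_slitPlane_iff, not_or, not_lt, not_not] at hz
      refine lt_of_le_of_ne hz.1 fun h0 => ?_
      exact Circle.coe_ne_zero z (Complex.ext h0 hz.2)
    have h1 : ContMDiffAt (𝓡 1) 𝓘(ℝ, ℝ) ∞ (fun z : Circle => Complex.arg (-z)) z := by
      have h2 : ContMDiffAt (𝓡 1) 𝓘(ℝ, ℂ) ∞ (fun z : Circle => -(z : ℂ)) z :=
        (contMDiff_neg 𝓘(ℝ, ℂ) ∞).contMDiffAt.comp z contMDiff_coe_circle.contMDiffAt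
      refine ContMDiffAt.comp (g := Complex.arg) z (contDiffAt_arg ?_).contMDiffAt h2
      exact Complex.mem_slitPlane_iff.2 (Or.inl (by simpa using hz1))
    -- Across the cut of `arg`, the jump by `2π` of `arg` is matched by that of `τ ∘ arg` between
    -- `0` and `2π`. On the half circle `Re z < 0` one has `|arg z| > π/2 ≥ δ`, and on both sides
    -- the difference equals `π - arg(-z)`.
    refine ContMDiffAt.congr_of_eventuallyEq
      (f := fun z : Circle => Real.pi - Complex.arg (-z)) (contMDiffAt_const.sub h1) ?_
    have hre : Continuous fun z : Circle => (z : ℂ).re :=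
      Complex.continuous_re.comp continuous_subtype_val
    filter_upwards [(isOpen_lt hre continuous_const).mem_nhds hz1] with w hw
    change (w : ℂ).re < 0 at hw
    rcases le_or_gt 0 (w : ℂ).im with hi | hi
    · have h3 : Complex.arg (-w) = Complex.arg w - Real.pi :=
        Complex.arg_neg_eq_arg_sub_pi_iff.2 (hi.lt_or_eq.imp id fun h => ⟨h.symm, hw⟩)
      have h4 : ¬ Complex.arg w ≤ Real.pi / 2 := fun h' => by
        rcases Complex.arg_le_pi_div_two_iff.1 h' with h'' | h'' <;> linarith
      rw [h.right _ (by linarith), h3]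
      ring
    · have h3 : Complex.arg (-w) = Complex.arg w + Real.pi :=
        Complex.arg_neg_eq_arg_add_pi_iff.2 (Or.inl hi)
      have h4 : ¬ -(Real.pi / 2) ≤ Complex.arg w := fun h' => by
        rcases Complex.neg_pi_div_two_le_arg_iff.1 h' with h'' | h'' <;> linarith
      rw [h.left _ (by linarith), h3]
      ring

end IsStep

/-- A chord is no longer than its arc. Hence distance more than `δ` from `1` forces `|arg z| > δ`,
where a step function is constant. -/
theorem norm_sub_one_le_abs_arg (z : Circle) : ‖(z : ℂ) - 1‖ ≤ |Complex.arg z| := by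
  have h := Real.norm_exp_I_mul_ofReal_sub_one_le (x := Complex.arg z)
  rw [mul_comm, ← Circle.coe_exp, Circle.exp_arg] at h
  exact h

end Plane

/-! ### Concentrating a gauge transformation near the value 1 -/

section Collapse

variable {S : Type*} [TopologicalSpace S] [ChartedSpace R2 S] [IsManifold (𝓡 2) ∞ S]
  [CompactSpace S] [T2Space S]

/-- The gauge transformation `exp (iτ(θ))`, if `l = exp (iθ)` and `|θ| ≤ π`. -/
theorem exists_collapse {δ : ℝ} {τ : ℝ → ℝ} (h : IsStep δ τ) (hδ : δ ≤ Real.pi / 2)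
    (o : SurfaceOrientation S) (l : Gauge S) :
    ∃ l' : Gauge S, (∀ x, l' x = Circle.exp (τ (Complex.arg (l x)))) ∧
      ∀ m : Gauge S, surfaceIntegral o (wedgePairing l'.mc m.mc) =
        surfaceIntegral o (wedgePairing l.mc m.mc) := by
  let H : ContMDiffMap (𝓡 2) 𝓘(ℝ, ℝ) S ℝ ∞ :=
    ⟨fun x => τ (Complex.arg (l x)) - Complex.arg (l x),
      (h.contMDiff_circle hδ).comp l.contMDiff⟩
  -- The factor `exp(iH)` replaces the angle `arg l` by `τ(arg l)`; by Stokes' theorem it does not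
  -- affect the integral.
  refine ⟨l * gaugeExp H, fun x => ?_, fun m => ?_⟩
  · have h1 : (l * gaugeExp H) x =
      Circle.exp (Complex.arg (l x)) * Circle.exp (τ (Complex.arg (l x)) - Complex.arg (l x)) := by
      rw [Circle.exp_arg]
      rfl
    rw [h1, ← Circle.exp_add]
    congr 1
    ring
  · rw [Gauge.mc_mul, integral_wedge_add_left, integral_wedge_gaugeExp, add_zero]

omit [CompactSpace S] [T2Space S] in
/-- The collapsed gauge transformation is constant away from `1`. -/
theorem collapse_mc_eq_zero {δ : ℝ} {τ : ℝ → ℝ} (h : IsStep δ τ) {l l' : Gauge S}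
    (hl : ∀ x, l' x = Circle.exp (τ (Complex.arg (l x)))) {x : S} (hx : δ < ‖(l x : ℂ) - 1‖) :
    l'.mc x = 0 := by
  ext v
  congr 1
  refine lieT_ext ?_
  have hc : Continuous fun y => ‖(l y : ℂ) - 1‖ := by
    have := l.contMDiff.continuous
    fun_prop
  have h1 : ∀ᶠ y in 𝓝 x, l' y = Circle.exp 0 := by
    filter_upwards [(isOpen_lt continuous_const hc).mem_nhds hx] with y hy
    rw [hl]
    rcases lt_abs.1 (lt_of_lt_of_le hy (norm_sub_one_le_abs_arg (l y))) with h2 | h2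
    · rw [h.right _ h2.le, Circle.exp_two_pi, Circle.exp_zero]
    · rw [h.left _ (by linarith)]
  rw [Gauge.mc_of_lift (θ := fun _ => 0) mdifferentiableAt_const h1, mfderiv_const]
  rfl

end Collapse

/-! ### The contribution of a nondegenerate preimage -/

section LocalDegree

open MeasureTheory

variable {S : Type*} [TopologicalSpace S] [ChartedSpace R2 S] [IsManifold (𝓡 2) ∞ S]

omit [IsManifold (𝓡 2) ∞ S] in
theorem contMDiffAt_arg_gauge {l : Gauge S} {x : S} (hx : (l x : ℂ) ∈ Complex.slitPlane) :
    ContMDiffAt (𝓡 2) 𝓘(ℝ, ℝ) ∞ (fun x => Complex.arg (l x)) x :=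
  (contDiffAt_arg hx).contMDiffAt.comp x
    (contMDiff_coe_circle.contMDiffAt.comp x l.contMDiff.contMDiffAt)

theorem eventually_sign_eq {X : Type*} [TopologicalSpace X] {g : X → ℝ} {x : X}
    (hg : ContinuousAt g x) (h0 : g x ≠ 0) :
    ∀ᶠ y in 𝓝 x, Real.sign (g y) = Real.sign (g x) := by
  rcases h0.lt_or_gt with h | h
  · filter_upwards [hg.eventually (gt_mem_nhds h)] with y hy
    rw [Real.sign_of_neg hy, Real.sign_of_neg h]
  · filter_upwards [hg.eventually (lt_mem_nhds h)] with y hy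
    rw [Real.sign_of_pos hy, Real.sign_of_pos h]

/-- A nondegenerate preimage of `(1, 1)` under `(l₁, l₂)` contributes an integer to the integral of
the pullback of a form of total mass one supported near `(1, 1)`. -/
theorem exists_nhds_integral_int (o : SurfaceOrientation S) {l₁ l₂ : Gauge S} {x₀ p : S}
    (hp : p ∈ (chartAt R2 x₀).source) (h₁ : l₁ p = 1) (h₂ : l₂ p = 1)
    (hreg : wedgePairing l₁.mc l₂.mc p (chartFrame (chartAt R2 x₀) p) ≠ 0) :
    ∃ N : Set S, IsOpen N ∧ p ∈ N ∧ N ⊆ (chartAt R2 x₀).source ∧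
      (∀ x ∈ N, l₁ x = 1 → l₂ x = 1 → x = p) ∧
      ∀ N' ⊆ N, IsOpen N' → p ∈ N' → ∃ δ₀ > 0, ∀ δ τ, δ < δ₀ → IsStep δ τ →
        ∀ l₁' l₂' : Gauge S, (∀ x, l₁' x = Circle.exp (τ (Complex.arg (l₁ x)))) →
          (∀ x, l₂' x = Circle.exp (τ (Complex.arg (l₂ x)))) →
          ∃ n : ℤ, ∫ y in (chartAt R2 x₀).target,
            N'.indicator (density o (wedgePairing l₁'.mc l₂'.mc) x₀)
              ((chartAt R2 x₀).symm y) = n := by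
  classical
  set e := chartAt R2 x₀ with he
  have hcont : ∀ l : Gauge S, Continuous fun x => (l x : ℂ) := fun l =>
    continuous_subtype_val.comp l.contMDiff.continuous
  let G : Set S := {x | (l₁ x : ℂ) ∈ Complex.slitPlane ∧ (l₂ x : ℂ) ∈ Complex.slitPlane}
  have hG : IsOpen G := (Complex.isOpen_slitPlane.preimage (hcont l₁)).inter
    (Complex.isOpen_slitPlane.preimage (hcont l₂))
  have hpG : p ∈ G := by simp [G, h₁, h₂]
  let a₁ : R2 → ℝ := fun y => Complex.arg (l₁ (e.symm y))
  let a₂ : R2 → ℝ := fun y => Complex.arg (l₂ (e.symm y))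
  let f : R2 → R2 := planeMap a₁ a₂
  set V₀ : Set R2 := e.target ∩ e.symm ⁻¹' G
  have hV₀ : IsOpen V₀ := e.symm.continuousOn.isOpen_inter_preimage e.open_target hG
  have ha₁ : ∀ y ∈ V₀, ContDiffAt ℝ ∞ a₁ y := fun y hy =>
    contDiffAt_comp_chart_symm hy.1 (contMDiffAt_arg_gauge hy.2.1)
  have ha₂ : ∀ y ∈ V₀, ContDiffAt ℝ ∞ a₂ y := fun y hy =>
    contDiffAt_comp_chart_symm hy.1 (contMDiffAt_arg_gauge hy.2.2)
  have hf : ∀ y ∈ V₀, ContDiffAt ℝ ∞ f y := fun y hy => planeMap_contDiffAt (ha₁ y hy) (ha₂ y hy)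
  set y₀ := e p with hy₀
  have hpy : e.symm y₀ = p := e.left_inv hp
  have hy₀V : y₀ ∈ V₀ := ⟨e.map_source hp, by rw [mem_preimage, hpy]; exact hpG⟩
  have hdet : ∀ y ∈ V₀, (fderiv ℝ f y).det =
      fderiv ℝ a₁ y (EuclideanSpace.single 0 1) * fderiv ℝ a₂ y (EuclideanSpace.single 1 1) -
      fderiv ℝ a₁ y (EuclideanSpace.single 1 1) * fderiv ℝ a₂ y (EuclideanSpace.single 0 1) :=
    fun y hy => planeMap_det ((ha₁ y hy).differentiableAt (by simp))
      ((ha₂ y hy).differentiableAt (by simp))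
  have hdet0 : (fderiv ℝ f y₀).det ≠ 0 := by
    have := wedge_chartFrame_of_lift (l₁ := l₁) (l₂ := l₂) hy₀V.1
      (contMDiffAt_arg_gauge hy₀V.2.1) (contMDiffAt_arg_gauge hy₀V.2.2)
      (.of_forall fun x => (Circle.exp_arg _).symm) (.of_forall fun x => (Circle.exp_arg _).symm)
    rw [← he, hpy] at this
    rw [this] at hreg
    intro h0
    rw [hdet y₀ hy₀V] at h0
    apply hreg
    change -(fderiv ℝ a₁ y₀ _ * fderiv ℝ a₂ y₀ _ - fderiv ℝ a₁ y₀ _ * fderiv ℝ a₂ y₀ _) / _ = 0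
    rw [h0]
    simp
  have hdetc : ContinuousAt (fun y => (fderiv ℝ f y).det) y₀ :=
    ContinuousLinearMap.continuous_det.continuousAt.comp
      ((hf y₀ hy₀V).fderiv_right (m := 0) (by simp)).continuousAt
  let f' : R2 ≃L[ℝ] R2 := (fderiv ℝ f y₀).toContinuousLinearEquivOfDetNeZero hdet0
  have hf' : HasFDerivAt f (f' : R2 →L[ℝ] R2) y₀ := by
    have := ((hf y₀ hy₀V).differentiableAt (by simp)).hasFDerivAt
    simpa [f'] using this
  -- Regularity makes the Jacobian invertible, so the inverse function theorem applies at `y₀`.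
  let Φ := (hf y₀ hy₀V).toOpenPartialHomeomorph f hf' (by simp)
  have hΦ : ∀ y, Φ y = f y := fun y => rfl
  have hΦs : y₀ ∈ Φ.source := (hf y₀ hy₀V).mem_toOpenPartialHomeomorph_source hf' (by simp)
  have hsgn : ∀ᶠ y in 𝓝 y₀, frameSign (o (e.symm y)) (chartFrame e (e.symm y)) =
      frameSign (o p) (chartFrame e p) := by
    have h1 : Filter.Tendsto e.symm (𝓝 y₀) (𝓝 p) := by
      have := (e.symm.continuousAt (x := y₀) (e.map_source hp)).tendsto
      rwa [hpy] at this
    exact h1.eventually (frameSign_eventuallyEq o hp)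
  -- On `W` the Jacobian determinant and the coordinate frame have constant signs and `f` is an
  -- injective smooth map.
  obtain ⟨W, hW, hWo, hyW⟩ := eventually_nhds_iff.1
    ((eventually_sign_eq hdetc hdet0).and (hsgn.and
      ((Φ.open_source.mem_nhds hΦs |> Filter.Eventually.and) (hV₀.mem_nhds hy₀V))))
  have hf0 : ∀ x, x ∈ e.source → l₁ x = 1 → l₂ x = 1 → f (e x) = 0 := by
    intro x hx hx1 hx2
    ext i
    fin_cases i <;> simp [f, planeMap, a₁, a₂, e.left_inv hx, hx1, hx2]
  refine ⟨e.source ∩ e ⁻¹' W, e.continuousOn.isOpen_inter_preimage e.open_source hWo,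
    ⟨hp, hyW⟩, inter_subset_left, ?_, ?_⟩
  · rintro x ⟨hx, hxW⟩ hx1 hx2
    refine e.injOn hx hp (Φ.injOn (hW _ hxW).2.2.1 hΦs ?_)
    rw [hΦ, hΦ, hf0 x hx hx1 hx2, hf0 p hp h₁ h₂]
  intro N' hN' hN'o hpN'
  set V : Set R2 := e.target ∩ e.symm ⁻¹' N'
  have hVo : IsOpen V := e.symm.continuousOn.isOpen_inter_preimage e.open_target hN'o
  have hVW : V ⊆ W := by
    rintro y ⟨hy, hy'⟩
    have := (hN' hy').2
    rwa [mem_preimage, e.right_inv hy] at this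
  have hVV₀ : V ⊆ V₀ := fun y hy => (hW y (hVW hy)).2.2.2
  have hVs : V ⊆ Φ.source := fun y hy => (hW y (hVW hy)).2.2.1
  have hfV : IsOpen (f '' V) := Φ.isOpen_image_of_subset_source hVo hVs
  have h0V : (0 : R2) ∈ f '' V :=
    ⟨y₀, ⟨e.map_source hp, by rw [mem_preimage, hpy]; exact hpN'⟩, hf0 p hp h₁ h₂⟩
  obtain ⟨r, hr, hrV⟩ := Metric.isOpen_iff.1 hfV 0 h0V
  -- The mass lies in the square `|z₀|, |z₁| ≤ δ`. With `δ < r / 2` this square is inside the ball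
  -- of radius `r`, hence inside the image of `V`.
  refine ⟨r / 2, by linarith, fun δ τ hδ hτ l₁' l₂' hl₁ hl₂ => ?_⟩
  set σ := frameSign (o p) (chartFrame e p) with hσ
  set ε := Real.sign (fderiv ℝ f y₀).det with hε
  have hτd : ∀ {a : R2 → ℝ} {y : R2} (v : R2), ContDiffAt ℝ ∞ a y →
      fderiv ℝ (fun y => τ (a y)) y v = deriv τ (a y) * fderiv ℝ a y v := by
    intro a y v ha
    have h1 : HasFDerivAt (fun y => τ (a y)) _ y :=
      ((hτ.contDiff.differentiable (by simp)) (a y)).hasDerivAt.comp_hasFDerivAt y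
        (ha.differentiableAt (by simp)).hasFDerivAt
    rw [h1.fderiv]
    simp
  -- The density is the pullback under `f` of a multiple of `dτ(z₀) ∧ dτ(z₁)`. Writing `det = ε
  -- |det|`, the Jacobian sign `ε` joins the orientation sign `σ` in the coefficient.
  have hdens : ∀ y ∈ V, N'.indicator (density o (wedgePairing l₁'.mc l₂'.mc) x₀) (e.symm y) =
      |(fderiv ℝ f y).det| • (-(σ * ε) / (4 * Real.pi ^ 2) *
        (deriv τ (f y 0) * deriv τ (f y 1))) := by
    intro y hy
    have hyV₀ := hVV₀ hy
    have hmd : ∀ {l : Gauge S}, ((l (e.symm y) : Circle) : ℂ) ∈ Complex.slitPlane →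
        ContMDiffAt (𝓡 2) 𝓘(ℝ, ℝ) ∞ (fun x => τ (Complex.arg (l x))) (e.symm y) := fun h =>
      hτ.contDiff.contMDiff.contMDiffAt.comp _ (contMDiffAt_arg_gauge h)
    have hyN : e.symm y ∈ N' := hy.2
    rw [indicator_of_mem hyN, density_of_lift o hy.1 (hmd hyV₀.2.1) (hmd hyV₀.2.2)
      (.of_forall hl₁) (.of_forall hl₂), (hW y (hVW hy)).2.1, ← sign_mul_self_eq_abs,
      (hW y (hVW hy)).1, hdet y hyV₀, hτd _ (ha₁ y hyV₀), hτd _ (ha₂ y hyV₀), hτd _ (ha₁ y hyV₀),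
      hτd _ (ha₂ y hyV₀)]
    change _ = _ • (_ * (deriv τ (a₁ y) * deriv τ (a₂ y)))
    rw [smul_eq_mul]
    have hε2 : ε * ε = 1 := by
      rcases Real.sign_apply_eq_of_ne_zero _ hdet0 with h | h <;> rw [hε, h] <;> norm_num
    linear_combination (σ * (deriv τ (a₁ y) * deriv τ (a₂ y)) / (4 * Real.pi ^ 2) *
      (fderiv ℝ a₁ y (EuclideanSpace.single 0 1) * fderiv ℝ a₂ y (EuclideanSpace.single 1 1) -
      fderiv ℝ a₁ y (EuclideanSpace.single 1 1) * fderiv ℝ a₂ y (EuclideanSpace.single 0 1))) *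
        hε2
  have hint : ∫ y in e.target,
      N'.indicator (density o (wedgePairing l₁'.mc l₂'.mc) x₀) (e.symm y) = -(σ * ε) := by
    have hout : ∀ y ∈ e.target \ V,
        N'.indicator (density o (wedgePairing l₁'.mc l₂'.mc) x₀) (e.symm y) = 0 := fun y hy => by
      have hyN : e.symm y ∉ N' := fun h => hy.2 ⟨hy.1, h⟩
      exact indicator_of_notMem hyN _
    rw [setIntegral_eq_of_subset_of_forall_sdiff_eq_zero (s := V) e.open_target.measurableSet
      (fun y hy => hy.1) hout,
      setIntegral_congr_fun hVo.measurableSet hdens,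
      ← integral_image_eq_integral_abs_det_fderiv_smul volume hVo.measurableSet
        (fun y hy => ((hf y (hVV₀ hy)).differentiableAt (by simp)).hasFDerivAt.hasFDerivWithinAt)
        (Φ.injOn.mono hVs) (fun z => -(σ * ε) / (4 * Real.pi ^ 2) *
          (deriv τ (z 0) * deriv τ (z 1))),
      setIntegral_eq_integral_of_forall_compl_eq_zero, integral_const_mul, hτ.integral_plane]
    · have := Real.pi_pos.ne'
      field_simp
      norm_num
    · intro z hz
      by_contra h0
      apply hz
      apply hrV
      have hz0 : |z 0| ≤ δ := by
        by_contra h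
        exact h0 (by rw [hτ.deriv_eq_zero (not_le.1 h)]; ring)
      have hz1 : |z 1| ≤ δ := by
        by_contra h
        exact h0 (by rw [hτ.deriv_eq_zero (not_le.1 h)]; ring)
      have hδ0 : 0 ≤ δ := (abs_nonneg _).trans hz0
      rw [mem_ball_zero_iff, EuclideanSpace.norm_eq, Fin.sum_univ_two, Real.sqrt_lt' hr]
      simp only [Real.norm_eq_abs]
      nlinarith [abs_nonneg (z 0), abs_nonneg (z 1)]
  rw [hint]
  have hσi : ∃ n : ℤ, σ = n := by
    rcases frameSign_mem (o p) (chartFrame e p) with h | h | h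
    · exact ⟨-1, by rw [hσ, h]; norm_num⟩
    · exact ⟨0, by rw [hσ, h]; norm_num⟩
    · exact ⟨1, by rw [hσ, h]; norm_num⟩
  have hεi : ∃ n : ℤ, ε = n := by
    rcases Real.sign_apply_eq_of_ne_zero _ hdet0 with h | h
    · exact ⟨-1, by rw [hε, h]; norm_num⟩
    · exact ⟨1, by rw [hε, h]; norm_num⟩
  obtain ⟨m, hm⟩ := hσi
  obtain ⟨n, hn⟩ := hεi
  exact ⟨-(m * n), by rw [hm, hn]; push_cast; ring⟩

end LocalDegree

/-! ### Integrality of the degree -/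

section Degree

open MeasureTheory

variable {S : Type*} [TopologicalSpace S] [ChartedSpace R2 S] [IsManifold (𝓡 2) ∞ S]
  [CompactSpace S] [T2Space S]

/-- Finitely many charts suffice to cover the surface, so regularity need only be tested in those.
-/
theorem exists_chartIndex_mem_source (x : S) : ∃ j ∈ chartIndex S, x ∈ (chartAt R2 j).source := by
  by_contra! h
  have h1 : ∑ j ∈ chartIndex S, chartPartition S j x = 0 :=
    Finset.sum_eq_zero fun j hj =>
      image_eq_zero_of_notMem_tsupport fun h' => h j hj (chartPartition_tsupport S j h')
  rw [sum_chartPartition] at h1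
  exact one_ne_zero h1

/-- The degree of `(l₁, l₂)` is an integer if `(1, 1)` is a regular value. -/
theorem integral_wedge_mc_int_of_regular (o : SurfaceOrientation S) (l₁ l₂ : Gauge S)
    (hreg : ∀ j ∈ chartIndex S, ∀ x ∈ (chartAt R2 j).source, l₁ x = 1 → l₂ x = 1 →
      wedgePairing l₁.mc l₂.mc x (chartFrame (chartAt R2 j) x) ≠ 0) :
    ∃ n : ℤ, surfaceIntegral o (wedgePairing l₁.mc l₂.mc) = n := by
  classical
  have hcont : ∀ l : Gauge S, Continuous fun x => ‖(l x : ℂ) - 1‖ := fun l => by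
    have := l.contMDiff.continuous
    fun_prop
  let P : Set S := {x | l₁ x = 1 ∧ l₂ x = 1}
  have hPc : IsCompact P := ((isClosed_eq l₁.contMDiff.continuous continuous_const).inter
    (isClosed_eq l₂.contMDiff.continuous continuous_const)).isCompact
  have hloc : ∀ p : P, ∃ (x₀ : S) (N : Set S), IsOpen N ∧ (p : S) ∈ N ∧
      N ⊆ (chartAt R2 x₀).source ∧ (∀ x ∈ N, l₁ x = 1 → l₂ x = 1 → x = p) ∧
      ∀ N' ⊆ N, IsOpen N' → (p : S) ∈ N' → ∃ δ₀ > 0, ∀ δ τ, δ < δ₀ → IsStep δ τ →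
        ∀ l₁' l₂' : Gauge S, (∀ x, l₁' x = Circle.exp (τ (Complex.arg (l₁ x)))) →
          (∀ x, l₂' x = Circle.exp (τ (Complex.arg (l₂ x)))) →
          ∃ n : ℤ, ∫ y in (chartAt R2 x₀).target,
            N'.indicator (density o (wedgePairing l₁'.mc l₂'.mc) x₀)
              ((chartAt R2 x₀).symm y) = n := by
    intro p
    obtain ⟨j, hj, hp⟩ := exists_chartIndex_mem_source (p : S)
    exact ⟨j, exists_nhds_integral_int o hp p.2.1 p.2.2 (hreg j hj p hp p.2.1 p.2.2)⟩
  choose x₀ N hNo hpN hNs hNu hN using hloc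
  -- The preimages of `(1, 1)` are isolated and form a compact set.
  have hPf : P.Finite := by
    obtain ⟨T, hT⟩ := hPc.elim_finite_subcover N hNo fun x hx => mem_iUnion.2 ⟨⟨x, hx⟩, hpN ⟨x, hx⟩⟩
    refine (T.finite_toSet.image Subtype.val).subset fun x hx => ?_
    obtain ⟨p, hpT, hxp⟩ := mem_iUnion₂.1 (hT hx)
    exact ⟨p, hpT, (hNu p x hxp hx.1 hx.2).symm⟩
  have : Fintype P := hPf.fintype
  obtain ⟨U, hU, hUd⟩ := hPf.t2_separation
  -- The neighbourhoods are shrunk to be disjoint; the local result was stated for all smaller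
  -- neighbourhoods for this purpose.
  let M : P → Set S := fun p => N p ∩ U p
  have hMo : ∀ p, IsOpen (M p) := fun p => (hNo p).inter (hU p).2
  have hpM : ∀ p : P, (p : S) ∈ M p := fun p => ⟨hpN p, (hU p).1⟩
  have hMd : ∀ p q : P, ∀ x, x ∈ M p → x ∈ M q → p = q := by
    intro p q x hp hq
    by_contra hpq
    exact (disjoint_left.1 (hUd p.2 q.2 fun h => hpq (Subtype.ext h))) hp.2 hq.2
  choose δ₀ hδ₀ hint using fun p => hN p (M p) inter_subset_left (hMo p) (hpM p)
  let K : Set S := (⋃ p, M p)ᶜ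
  have hK : IsCompact K := (isOpen_iUnion hMo).isClosed_compl.isCompact
  have hKpos : ∀ x ∈ K, 0 < max ‖(l₁ x : ℂ) - 1‖ ‖(l₂ x : ℂ) - 1‖ := by
    intro x hx
    by_contra! h
    have h1 : (l₁ x : ℂ) = 1 := sub_eq_zero.1 (norm_le_zero_iff.1 ((le_max_left _ _).trans h))
    have h2 : (l₂ x : ℂ) = 1 := sub_eq_zero.1 (norm_le_zero_iff.1 ((le_max_right _ _).trans h))
    have hxP : x ∈ P := ⟨Circle.ext h1, Circle.ext h2⟩
    exact hx (mem_iUnion.2 ⟨⟨x, hxP⟩, hpM ⟨x, hxP⟩⟩)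
  obtain ⟨m, hm, hKm⟩ := hK.exists_forall_le' ((hcont l₁).max (hcont l₂)).continuousOn hKpos
  -- The first bound makes the collapsed form vanish on `K`, where one of `l₁, l₂` has distance at
  -- least `m` from `1`; the second keeps the collapse smooth; the third serves the local degrees.
  obtain ⟨δ, hδ, hδm, hδpi, hδp⟩ : ∃ δ > 0, δ < m ∧ δ ≤ Real.pi / 2 ∧ ∀ p, δ < δ₀ p := by
    have h1 : ∀ᶠ δ in 𝓝[>] (0 : ℝ), δ < m ∧ δ < Real.pi / 2 ∧ ∀ p, δ < δ₀ p :=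
      ((gt_mem_nhds hm).and ((gt_mem_nhds (by positivity)).and
        (Filter.eventually_all.2 fun p => gt_mem_nhds (hδ₀ p)))).filter_mono nhdsWithin_le_nhds
    obtain ⟨δ, h, hδ⟩ := (h1.and self_mem_nhdsWithin).exists
    exact ⟨δ, hδ, h.1, h.2.1.le, h.2.2⟩
  obtain ⟨τ, hτ⟩ := exists_isStep hδ
  obtain ⟨l₁', hl₁, he₁⟩ := exists_collapse hτ hδpi o l₁
  obtain ⟨l₂', hl₂, he₂⟩ := exists_collapse hτ hδpi o l₂
  -- The collapse is available in the first argument only, so the arguments are swapped to collapse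
  -- `l₂` and then swapped back.
  rw [← he₁ l₂, integral_wedge_swap, ← he₂ l₁', ← integral_wedge_swap]
  set w : TwoForm S := wedgePairing l₁'.mc l₂'.mc with hw
  have hwc : w.IsCont := wedgePairing_isCont _ _
  have hwK : ∀ x ∈ K, ∀ᶠ y in 𝓝 x, w y = 0 := by
    intro x hx
    have h1 : δ < max ‖(l₁ x : ℂ) - 1‖ ‖(l₂ x : ℂ) - 1‖ := hδm.trans_le (hKm x hx)
    rcases lt_max_iff.1 h1 with h1 | h1
    · filter_upwards [(isOpen_lt continuous_const (hcont l₁)).mem_nhds h1] with y hy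
      ext v
      rw [hw, wedgePairing_apply, collapse_mc_eq_zero hτ hl₁ hy]
      simp
    · filter_upwards [(isOpen_lt continuous_const (hcont l₂)).mem_nhds h1] with y hy
      ext v
      rw [hw, wedgePairing_apply, collapse_mc_eq_zero hτ hl₂ hy]
      simp
  have hcases : ∀ x, x ∈ K ∨ ∃ p, x ∈ M p := by
    intro x
    by_cases h : x ∈ ⋃ p, M p
    · exact Or.inr (mem_iUnion.1 h)
    · exact Or.inl h
  let W : P → TwoForm S := fun p x => if x ∈ M p then w x else 0
  have hW1 : ∀ p x, x ∈ M p → W p x = w x := fun p x h => if_pos h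
  have hW0 : ∀ p x, x ∉ M p → W p x = 0 := fun p x h => if_neg h
  -- The cut-off is sharp, but `w` vanishes near every point outside the disjoint open sets `M q`,
  -- so each piece is still continuous.
  have hWe : ∀ p x, (∀ᶠ y in 𝓝 x, W p y = w y) ∨ ∀ᶠ y in 𝓝 x, W p y = 0 := by
    intro p x
    rcases hcases x with h | ⟨q, h⟩
    · right
      filter_upwards [hwK x h] with y hy
      by_cases h' : y ∈ M p
      · rw [hW1 p y h', hy]
      · exact hW0 p y h'
    · by_cases hpq : p = q
      · left
        filter_upwards [(hMo q).mem_nhds h] with y hy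
        exact hW1 p y (hpq ▸ hy)
      · right
        filter_upwards [(hMo q).mem_nhds h] with y hy
        exact hW0 p y fun h' => hpq (hMd p q y h' hy)
  have hWc : ∀ p, (W p).IsCont := by
    intro p j x hx
    rcases hWe p x with h | h
    · refine (hwc j x hx).congr ?_
      filter_upwards [h] with y hy
      rw [hy]
    · refine (continuousAt_const (y := (0 : ℝ))).congr ?_
      filter_upwards [h] with y hy
      rw [hy]
      rfl
  have hsum : w = ∑ p, W p := by
    funext x
    rw [Finset.sum_apply]
    rcases hcases x with h | ⟨q, h⟩
    · rw [(hwK x h).self_of_nhds]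
      refine (Finset.sum_eq_zero fun p _ => hW0 p x fun h' => ?_).symm
      exact h (mem_iUnion.2 ⟨p, h'⟩)
    · rw [Finset.sum_eq_single q (fun p _ hpq => hW0 p x fun h' => hpq (hMd p q x h' h))
        (fun h' => absurd (Finset.mem_univ q) h')]
      exact (hW1 q x h).symm
  have hWi : ∀ p, ∃ n : ℤ, surfaceIntegral o (W p) = n := by
    intro p
    obtain ⟨n, hn⟩ := hint p δ τ (hδp p) hτ l₁' l₂' hl₁ hl₂
    refine ⟨n, ?_⟩
    rw [← hn, surfaceIntegral_of_support o (hWc p) (x₀ := x₀ p)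
      -- This is the support of `W p`; it is contained in `M p`, because `W p` vanishes near every
      -- point of `K` and of the other `M q`.
      (C := {x | ∀ᶠ y in 𝓝 x, W p y = 0}ᶜ)]
    · refine integral_congr_ae (.of_forall fun y => ?_)
      set x := (chartAt R2 (x₀ p)).symm y
      change density o (W p) (x₀ p) x = (M p).indicator (density o w (x₀ p)) x
      by_cases h : x ∈ M p
      · rw [indicator_of_mem h]
        unfold density
        rw [hW1 p x h]
      · rw [indicator_of_notMem h, density_eq_zero o (hW0 p x h)]
    · exact isOpen_setOfPred_eventually_nhds.isClosed_compl
    · intro x hx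
      by_contra h'
      apply hx
      rcases hcases x with h | ⟨q, h⟩
      · filter_upwards [hwK x h] with y hy
        by_cases h' : y ∈ M p
        · rw [hW1 p y h', hy]
        · exact hW0 p y h'
      · have hpq : p ≠ q := by
          rintro rfl
          exact h' (hNs p h.1)
        filter_upwards [(hMo q).mem_nhds h] with y hy
        exact hW0 p y fun h' => hpq (hMd p q y h' hy)
    · intro x hx
      exact (not_not.1 hx : ∀ᶠ y in 𝓝 x, W p y = 0).self_of_nhds
  choose n hn using hWi
  refine ⟨∑ p, n p, ?_⟩
  conv_lhs => rw [hsum]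
  rw [surfaceIntegral_sum o _ fun p _ => hWc p, Finset.sum_congr rfl fun p _ => hn p]
  push_cast
  rfl

/-- Sard's theorem: the map `(l₁, l₂)` to the torus has a regular value. -/
theorem exists_regular_value (l₁ l₂ : Gauge S) :
    ∃ c₁ c₂ : Circle, ∀ j ∈ chartIndex S, ∀ x ∈ (chartAt R2 j).source, l₁ x = c₁ → l₂ x = c₂ →
      wedgePairing l₁.mc l₂.mc x (chartFrame (chartAt R2 j) x) ≠ 0 := by
  classical
  choose θ₁ U₁ hU₁ hx₁ hθ₁ hl₁ using l₁.exists_lift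
  choose θ₂ U₂ hU₂ hx₂ hθ₂ hl₂ using l₂.exists_lift
  obtain ⟨T, hT⟩ := isCompact_univ.elim_finite_subcover (fun x => U₁ x ∩ U₂ x)
    (fun x => (hU₁ x).inter (hU₂ x)) fun x _ => mem_iUnion.2 ⟨x, hx₁ x, hx₂ x⟩
  -- All `2π`-translates of the lifts are used, so that `l₁ = exp(it₀)` holds exactly when some
  -- translate equals `t₀`.
  let a₁ : S → S → ℤ → R2 → ℝ := fun j x m y => θ₁ x ((chartAt R2 j).symm y) + m * (2 * Real.pi)
  let a₂ : S → S → ℤ → R2 → ℝ := fun j x m y => θ₂ x ((chartAt R2 j).symm y) + m * (2 * Real.pi)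
  let B : S → S → Set R2 := fun j x => {y | y ∈ (chartAt R2 j).target ∧
    (chartAt R2 j).symm y ∈ U₁ x ∩ U₂ x ∧ wedgePairing l₁.mc l₂.mc ((chartAt R2 j).symm y)
      (chartFrame (chartAt R2 j) ((chartAt R2 j).symm y)) = 0}
  have hnull : ∀ j x m n, volume (planeMap (a₁ j x m) (a₂ j x n) '' B j x) = 0 := by
    intro j x m n
    have hd₁ : ∀ y ∈ B j x, ContDiffAt ℝ ∞ (fun y => θ₁ x ((chartAt R2 j).symm y)) y :=
      fun y hy => contDiffAt_comp_chart_symm hy.1 (hθ₁ x _ hy.2.1.1)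
    have hd₂ : ∀ y ∈ B j x, ContDiffAt ℝ ∞ (fun y => θ₂ x ((chartAt R2 j).symm y)) y :=
      fun y hy => contDiffAt_comp_chart_symm hy.1 (hθ₂ x _ hy.2.1.2)
    have hda₁ : ∀ y ∈ B j x, ContDiffAt ℝ ∞ (a₁ j x m) y := fun y hy =>
      (hd₁ y hy).add contDiffAt_const
    have hda₂ : ∀ y ∈ B j x, ContDiffAt ℝ ∞ (a₂ j x n) y := fun y hy =>
      (hd₂ y hy).add contDiffAt_const
    -- Sard's theorem in equal dimensions: a set on which the Jacobian determinant vanishes has a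
    -- null image. Here the determinant is a nonzero multiple of the component of the wedge.
    refine addHaar_image_eq_zero_of_det_fderivWithin_eq_zero volume
      (f' := fun y => fderiv ℝ (planeMap (a₁ j x m) (a₂ j x n)) y)
      (fun y hy => ((planeMap_contDiffAt (hda₁ y hy) (hda₂ y hy)).differentiableAt
        (by simp)).hasFDerivAt.hasFDerivWithinAt) fun y hy => ?_
    rw [planeMap_det ((hda₁ y hy).differentiableAt (by simp))
      ((hda₂ y hy).differentiableAt (by simp))]
    have h1 : fderiv ℝ (a₁ j x m) y = fderiv ℝ (fun y => θ₁ x ((chartAt R2 j).symm y)) y :=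
      fderiv_add_const _
    have h2 : fderiv ℝ (a₂ j x n) y = fderiv ℝ (fun y => θ₂ x ((chartAt R2 j).symm y)) y :=
      fderiv_add_const _
    have h3 := wedge_chartFrame_of_lift (l₁ := l₁) (l₂ := l₂) hy.1 (hθ₁ x _ hy.2.1.1)
      (hθ₂ x _ hy.2.1.2) (.of_forall (hl₁ x)) (.of_forall (hl₂ x))
    rw [hy.2.2, eq_comm, div_eq_zero_iff, neg_eq_zero] at h3
    rw [h1, h2]
    exact h3.resolve_right (by positivity)
  have hbad : volume (⋃ j ∈ chartIndex S, ⋃ x ∈ T, ⋃ (m : ℤ) (n : ℤ),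
      planeMap (a₁ j x m) (a₂ j x n) '' B j x) = 0 := by
    refine (measure_biUnion_null_iff (chartIndex S).countable_toSet).2 fun j _ =>
      (measure_biUnion_null_iff T.countable_toSet).2 fun x _ => measure_iUnion_null fun m =>
      measure_iUnion_null fun n => hnull j x m n
  -- A countable union of null sets does not fill the plane.
  obtain ⟨t, ht⟩ : ∃ t : R2, t ∉ ⋃ j ∈ chartIndex S, ⋃ x ∈ T, ⋃ (m : ℤ) (n : ℤ),
      planeMap (a₁ j x m) (a₂ j x n) '' B j x := by
    by_contra! h
    rw [eq_univ_of_forall h] at hbad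
    exact (isOpen_univ.measure_pos (volume : Measure R2) univ_nonempty).ne' hbad
  refine ⟨Circle.exp (t 0), Circle.exp (t 1), fun j hj x hx h1 h2 h0 => ht ?_⟩
  obtain ⟨z, hzT, hxz⟩ := mem_iUnion₂.1 (hT (mem_univ x))
  rw [hl₁ z, eq_comm, Circle.exp_eq_exp] at h1
  rw [hl₂ z, eq_comm, Circle.exp_eq_exp] at h2
  obtain ⟨m, hm⟩ := h1
  obtain ⟨n, hn⟩ := h2
  simp only [mem_iUnion]
  have hex := (chartAt R2 j).left_inv hx
  refine ⟨j, hj, z, hzT, m, n, chartAt R2 j x, ⟨(chartAt R2 j).map_source hx, ?_, ?_⟩, ?_⟩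
  · rw [hex]; exact hxz
  · rw [hex]; exact h0
  · ext i
    fin_cases i
    · simp [planeMap, a₁, hex, hm]
    · simp [planeMap, a₂, hex, hn]

/-- The degree of the map `(l₁, l₂)` to the torus is an integer. -/
theorem integral_wedge_mc_int (o : SurfaceOrientation S) (l₁ l₂ : Gauge S) :
    ∃ n : ℤ, surfaceIntegral o (wedgePairing l₁.mc l₂.mc) = n := by
  obtain ⟨c₁, c₂, hreg⟩ := exists_regular_value l₁ l₂
  -- Translation on the torus moves the regular value to `(1, 1)` without changing the Maurer-Cartan
  -- forms.
  let m₁ : Gauge S := ⟨fun x => c₁⁻¹ * l₁ x, contMDiff_const.mul l₁.contMDiff⟩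
  let m₂ : Gauge S := ⟨fun x => c₂⁻¹ * l₂ x, contMDiff_const.mul l₂.contMDiff⟩
  have h₁ : m₁.mc = l₁.mc := l₁.mc_const_mul m₁ c₁⁻¹ fun _ => rfl
  have h₂ : m₂.mc = l₂.mc := l₂.mc_const_mul m₂ c₂⁻¹ fun _ => rfl
  rw [← h₁, ← h₂]
  refine integral_wedge_mc_int_of_regular o m₁ m₂ fun j hj x hx e₁ e₂ => ?_
  rw [h₁, h₂]
  exact hreg j hj x hx (inv_mul_eq_one.1 e₁).symm (inv_mul_eq_one.1 e₂).symm

end Degree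

/-! ### The cocycle identity, and connections under gauge transformations -/

section Cocycle

variable {S : Type*} [TopologicalSpace S] [ChartedSpace R2 S] [IsManifold (𝓡 2) ∞ S]

theorem csCocycle_one [CompactSpace S] [T2Space S] (k : ℤ) (o : SurfaceOrientation S)
    (α : OneForm (𝓡 2) S LieT) : csCocycle k o α 1 = 1 := by
  have h : surfaceIntegral o (wedgePairing α (0 : OneForm (𝓡 2) S LieT)) = 0 := by
    have := integral_wedge_add_right o α 0 0
    rw [add_zero] at this
    exact left_eq_add.1 this
  rw [csCocycle, Gauge.mc_one, h, mul_zero, Circle.exp_zero]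

/-- The cocycle identity. -/
theorem csCocycle_mul [CompactSpace S] [T2Space S] {k : ℤ} (hk : Even k)
    (o : SurfaceOrientation S) (α : OneForm (𝓡 2) S LieT) (l₁ l₂ : Gauge S) :
    csCocycle k o α (l₁ * l₂) = csCocycle k o α l₁ * csCocycle k o (α + l₁.mc) l₂ := by
  obtain ⟨n, hn⟩ := integral_wedge_mc_int o l₁ l₂
  obtain ⟨m, rfl⟩ := hk
  rw [csCocycle, csCocycle, csCocycle, Gauge.mc_mul, integral_wedge_add_right,
    integral_wedge_add_left, hn, ← Circle.exp_add, Circle.exp_eq_exp]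
  -- With `k = m + m` the exponents differ by `πkn = 2πmn`; this is where the evenness of `k`
  -- enters.
  refine ⟨-(m * n), ?_⟩
  push_cast
  ring

namespace Connection

variable {Q : CircleBundle S}

/-- The effect of a gauge transformation on the local expression of a connection. -/
theorem pullSection_smul (η : Connection Q) {s s₁ : GlobalSection Q} {l : Gauge S}
    (h : ∀ x, s₁ x = l x • s x) : η.pullSection s₁ = η.pullSection s + l.mc := by
  have hm : ContMDiff (𝓡 2) I3 ∞ (fun x => l x • s x) :=
    Q.contMDiff_smul.comp (l.contMDiff.prodMk s.contMDiff')
  have h1 : η.pullSection s₁ = η.form.pullback (fun x => l x • s x) hm :=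
    OneForm.pullback_congr _ _ (funext h) _
  rw [h1]
  ext x v
  congr 1
  rw [OneForm.pullback_apply, OneForm.add_apply]
  have hF := Q.contMDiff_smul.mdifferentiableAt (x := (l x, s x)) (by simp)
  have hl := l.contMDiff.mdifferentiableAt (x := x) (by simp)
  have hs := s.contMDiff'.mdifferentiableAt (x := x) (by simp)
  -- By the Leibniz rule the derivative has a part along the orbit, which the connection sends to
  -- `λ^*ϑ`, and a translate of `ds`, on which invariance gives `s^*η`.
  have h2 : mfderiv (𝓡 2) I3 (fun x => l x • s x) x v =
      mfderiv (𝓡 1) I3 (fun z : Circle => z • s x) (l x) (mfderiv (𝓡 2) (𝓡 1) l x v) +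
      mfderiv I3 I3 (fun p : Q.Total => l x • p) (s x) (mfderiv (𝓡 2) I3 s x v) := by
    have h3 : mfderiv (𝓡 2) I3 (fun x => l x • s x) x = _ :=
      mfderiv_comp x hF (hl.prodMk hs)
    have h4 := mfderiv_prod_eq_add_apply (v := mfderiv (𝓡 2) ((𝓡 1).prod I3)
      (fun x => (l x, s x)) x v) hF
    have h5 := hl.mfderiv_prod hs
    rw [h3]
    refine h4.trans ?_
    rw [h5]
    rfl
  have hv := congrArg (fun α : OneForm (𝓡 1) Circle LieT => α (l x) (mfderiv (𝓡 2) (𝓡 1) l x v))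
    (η.vertical (s x))
  have hi := congrArg (fun α : OneForm I3 Q.Total LieT => α (s x) (mfderiv (𝓡 2) I3 s x v))
    (η.invariant (l x))
  rw [h2, map_add, add_comm]
  exact congrArg₂ _ hi hv

theorem pullSection_vadd (η : Connection Q) (α : OneForm (𝓡 2) S LieT) (s : GlobalSection Q) :
    (α +ᵥ η).pullSection s = η.pullSection s + α := by
  have h1 : (α +ᵥ η).pullSection s = η.pullSection s +
      (α.pullback Q.proj Q.contMDiff_proj).pullback s s.contMDiff' := rfl
  have h2 : (α.pullback Q.proj Q.contMDiff_proj).pullback s s.contMDiff' =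
      α.pullback (I := 𝓡 2) id contMDiff_id := by
    rw [OneForm.pullback_pullback]
    exact OneForm.pullback_congr _ _ (funext s.proj_apply') _
  rw [h1, h2]
  congr 1
  ext x v
  rw [OneForm.pullback_apply, mfderiv_id]
  rfl

end Connection

omit [IsManifold (𝓡 2) ∞ S] in
/-- The circle group acts freely on a circle bundle. -/
theorem CircleBundle.smul_left_injective (Q : CircleBundle S) (p : Q.Total) :
    Function.Injective fun z : Circle => z • p := by
  intro z w h
  obtain ⟨U, -, hx, φ, τ, -, -, h1, h2, h3⟩ := Q.locally_trivial (Q.proj p)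
  have e := h2 p hx
  simp only at h
  rw [← e, ← h3 _ hx, ← h3 _ hx] at h
  have := congrArg τ h
  rw [(h1 _ hx _).2, (h1 _ hx _).2] at this
  exact mul_left_cancel this

omit [IsManifold (𝓡 2) ∞ S] in
theorem CircleBundle.Trivializable.exists_section {Q : CircleBundle S} (h : Q.Trivializable) :
    Nonempty (GlobalSection Q) := by
  obtain ⟨φ, τ, hφ, -, h1, -, -⟩ := h
  rw [univ_prod_univ, contMDiffOn_univ] at hφ
  exact ⟨⟨fun x => φ (x, 1), hφ.comp (contMDiff_id.prodMk contMDiff_const),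
    fun x => (h1 x (mem_univ x) 1).1⟩⟩

end Cocycle

/-! ### Evaluation at a section as a unitary isomorphism -/

namespace CSLine

variable {S : Type*} [TopologicalSpace S] [ChartedSpace R2 S] [IsManifold (𝓡 2) ∞ S]
  [CompactSpace S] [T2Space S] {k : ℤ} {o : SurfaceOrientation S} {Q : CircleBundle S}
  {η : Connection Q}

theorem apply_smul (f : CSLine k o η) {s s₁ : GlobalSection Q} {l : Gauge S}
    (h : ∀ x, s₁ x = l x • s x) : f s₁ = f s * csCocycle k o (η.pullSection s) l := f.2 s s₁ l h

/-- A change of section multiplies the values of `f` and `g` by the same unimodular number, which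
cancels against its conjugate; the section chosen in the definition is therefore immaterial. -/
theorem inner_eq (s : GlobalSection Q) (f g : CSLine k o η) :
    inner ℂ f g = conj (f s) * g s := by
  have hn : Nonempty (GlobalSection Q) := ⟨s⟩
  have h1 : inner ℂ f g = conj (f hn.some) * g hn.some := dif_pos hn
  obtain ⟨l, hl⟩ := s.exists_gauge hn.some
  rw [h1, f.apply_smul hl, g.apply_smul hl]
  set c : Circle := csCocycle k o (η.pullSection s) l
  have hc : conj (c : ℂ) * c = 1 := by
    rw [← Circle.coe_inv_eq_conj, Circle.coe_inv, inv_mul_cancel₀ (Circle.coe_ne_zero c)]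
  rw [map_mul]
  linear_combination conj (f s) * g s * hc

theorem norm_eq (s : GlobalSection Q) (f : CSLine k o η) : ‖f‖ = ‖f s‖ := by
  rw [norm_eq_sqrt_re_inner (𝕜 := ℂ), inner_eq s, ← Complex.normSq_eq_conj_mul_self]
  change √(Complex.re (Complex.normSq (f s) : ℂ)) = _
  rw [Complex.ofReal_re, Complex.normSq_eq_norm_sq, Real.sqrt_sq (norm_nonneg _)]

/-- Each section is `s · λ` for one `λ`, as the action is free, and the value there must be `c ·
c(s^*η, λ)`. The cocycle identity says that this prescription satisfies the transformation law
between any two sections. -/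
theorem exists_apply_eq (hk : Even k) (s : GlobalSection Q) (c : ℂ) :
    ∃ f : CSLine k o η, f s = c := by
  choose g hg using s.exists_gauge
  refine ⟨⟨fun s₁ => c * csCocycle k o (η.pullSection s) (g s₁), fun s₁ s₂ l h => ?_⟩, ?_⟩
  · have h1 : g s₂ = g s₁ * l := ContMDiffMap.ext fun x => by
      refine Q.smul_left_injective (s x) ?_
      change g s₂ x • s x = (g s₁ x * l x) • s x
      rw [← hg, h, hg s₁, smul_smul, mul_comm]
    beta_reduce
    rw [h1, csCocycle_mul hk, η.pullSection_smul (hg s₁), Circle.coe_mul, mul_assoc]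
  · have h1 : g s = 1 := ContMDiffMap.ext fun x => by
      refine Q.smul_left_injective (s x) ?_
      change g s x • s x = (1 : Circle) • s x
      rw [← hg, one_smul]
    change c * _ = c
    rw [h1, csCocycle_one, Circle.coe_one, mul_one]

variable (k o η) in
/-- Evaluation at a section. -/
def eval (s : GlobalSection Q) : CSLine k o η →ₗ[ℂ] ℂ where
  toFun f := f s
  map_add' _ _ := rfl
  map_smul' _ _ := rfl

variable (k o η) in
/-- A section trivializes the line by evaluation. -/
def evalEquiv (hk : Even k) (s : GlobalSection Q) : CSLine k o η ≃ₗᵢ[ℂ] ℂ where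
  toLinearEquiv := LinearEquiv.ofBijective (eval k o η s)
    ⟨(injective_iff_map_eq_zero _).2 fun _ hf => eq_zero_of_apply (s := s) hf,
      exists_apply_eq hk s⟩
  norm_map' f := (norm_eq s f).symm

theorem evalEquiv_symm_apply (hk : Even k) (s : GlobalSection Q) (c : ℂ) :
    ((evalEquiv k o η hk s).symm c) s = c := (evalEquiv k o η hk s).apply_symm_apply c

theorem ext_apply {f g : CSLine k o η} (s : GlobalSection Q) (h : f s = g s) : f = g := by
  rw [← sub_eq_zero]
  refine eq_zero_of_apply (s := s) ?_
  change f s - g s = 0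
  rw [h, sub_self]

end CSLine

/-! ### Smoothness of the transition functions -/

section Smooth

open MeasureTheory

variable {S : Type*} [TopologicalSpace S] [ChartedSpace R2 S] [IsManifold (𝓡 2) ∞ S]

theorem eventually_norm_sub_lt_of_iteratedFDeriv_zero {E F ι : Type*} [NormedAddCommGroup E]
    [NormedSpace ℝ E] [NormedAddCommGroup F] [NormedSpace ℝ F] {l : Filter ι} {K : Set E}
    {f : E → F} {g : ι → E → F}
    (h : TendstoUniformlyOn (fun i => iteratedFDeriv ℝ 0 (g i)) (iteratedFDeriv ℝ 0 f) l K)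
    {ε : ℝ} (hε : 0 < ε) : ∀ᶠ i in l, ∀ x ∈ K, ‖g i x - f x‖ < ε := by
  rw [Metric.tendstoUniformlyOn_iff] at h
  filter_upwards [h ε hε] with i hi x hx
  have h2 := hi x hx
  rwa [iteratedFDeriv_zero_eq_comp, iteratedFDeriv_zero_eq_comp, Function.comp, Function.comp,
    LinearIsometryEquiv.dist_map, dist_comm, dist_eq_norm] at h2

/-- The Fréchet topology controls the coordinate expressions uniformly on compact sets. -/
theorem OneForm.eventually_localRep (x₀ : S) {K : Set R2} (hK : IsCompact K)
    (hKt : K ⊆ (chartAt R2 x₀).target) (α : OneForm (𝓡 2) S LieT) {ε : ℝ} (hε : 0 < ε) :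
    ∀ᶠ β in 𝓝 α, ∀ y ∈ K,
      ‖OneForm.localRep (chartAt R2 x₀) (β - α) y‖ < ε := by
  let e : IsManifold.maximalAtlas (𝓡 2) ∞ S :=
    ⟨chartAt R2 x₀, IsManifold.chart_mem_maximalAtlas x₀⟩
  let F : OneForm (𝓡 2) S LieT → UniformOnFun R2 (R2 [×0]→L[ℝ] (R2 →L[ℝ] LieT))
      {K : Set R2 | IsCompact K ∧ K ⊆ e.1.target} := fun α =>
    UniformOnFun.ofFun {K : Set R2 | IsCompact K ∧ K ⊆ e.1.target}
      (iteratedFDeriv ℝ 0 (α.localRep e.1))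
  -- Of the seminorms defining the Fréchet topology, only those of order zero are needed.
  have hF : Continuous F :=
    continuous_iInf_dom (i := e) (continuous_iInf_dom (i := 0) continuous_induced_dom)
  have h1 := UniformOnFun.tendsto_iff_tendstoUniformlyOn.1 (hF.tendsto α) K ⟨hK, hKt⟩
  have h2 : ∀ᶠ β in 𝓝 α, ∀ y ∈ K,
      ‖OneForm.localRep (chartAt R2 x₀) β y - OneForm.localRep (chartAt R2 x₀) α y‖ < ε :=
    eventually_norm_sub_lt_of_iteratedFDeriv_zero h1 hε
  filter_upwards [h2] with β hβ y hy
  refine lt_of_eq_of_lt ?_ (hβ y hy)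
  congr 1

theorem localRep_single (x₀ : S) {y : R2} (hy : y ∈ (chartAt R2 x₀).target)
    (α : OneForm (𝓡 2) S LieT) (i : Fin 2) :
    α ((chartAt R2 x₀).symm y) (chartFrame (chartAt R2 x₀) ((chartAt R2 x₀).symm y) i) =
      OneForm.localRep (chartAt R2 x₀) α y (EuclideanSpace.single i 1) := by
  unfold chartFrame
  rw [(chartAt R2 x₀).right_inv hy]
  rfl

variable [CompactSpace S] [T2Space S]

/-- The integral `∫ ⟨α ∧ β⟩` is a continuous function of `α`. -/
theorem continuous_integral_wedge (o : SurfaceOrientation S) (β : OneForm (𝓡 2) S LieT) :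
    Continuous fun α : OneForm (𝓡 2) S LieT => surfaceIntegral o (wedgePairing α β) := by
  let t : S → OneForm (𝓡 2) S LieT → ℝ := fun j α => ∫ y in (chartAt R2 j).target,
      chartPartition S j ((chartAt R2 j).symm y) *
        density o (wedgePairing α β) j ((chartAt R2 j).symm y)
  have ht : ∀ j, Continuous (t j) := by
    intro j
    set e := chartAt R2 j with he
    -- By additivity, continuity at `α` reduces to a bound on `t j (γ - α)`.
    have hadd : ∀ α γ, t j (α + γ) = t j α + t j γ := by
      intro α γ
      simp only [t, wedgePairing_add_left, density_add, mul_add]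
      exact integral_add (integrableOn_chartPartition_mul o (wedgePairing_isCont α β) j)
        (integrableOn_chartPartition_mul o (wedgePairing_isCont γ β) j)
    set K := e '' tsupport (chartPartition S j) with hK
    have hKc : IsCompact K := (isClosed_tsupport _).isCompact.image_of_continuousOn
      (e.continuousOn.mono (chartPartition_tsupport S j))
    have hKt : K ⊆ e.target := by
      rintro _ ⟨x, hx, rfl⟩
      exact e.map_source (chartPartition_tsupport S j hx)
    have hβc : ∀ i, ∃ C, ∀ y ∈ K, |((β (e.symm y) (chartFrame e (e.symm y) i) : LieT) : ℂ).im| ≤ C := by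
      intro i
      have h1 : ContinuousOn (fun y => ((β (e.symm y) (chartFrame e (e.symm y) i) : LieT) : ℂ).im) K :=
        (Complex.continuous_im.comp continuous_subtype_val).comp_continuousOn
          ((β.frame_continuousOn j i).comp (e.symm.continuousOn.mono hKt)
            fun y hy => e.map_target (hKt hy))
      exact hKc.exists_bound_of_continuousOn h1
    obtain ⟨C₀, hC₀⟩ := hβc 0
    obtain ⟨C₁, hC₁⟩ := hβc 1
    let C := |C₀| + |C₁|
    have hbound : ∀ γ : OneForm (𝓡 2) S LieT, ∀ ε, 0 ≤ ε →
        (∀ y ∈ K, ‖OneForm.localRep e γ y‖ ≤ ε) →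
        |t j γ| ≤ ε * C / (4 * Real.pi ^ 2) * volume.real K := by
      intro γ ε hε hγ
      have h1 : t j γ = ∫ y in K, chartPartition S j (e.symm y) *
          density o (wedgePairing γ β) j (e.symm y) := by
        refine setIntegral_eq_of_subset_of_forall_sdiff_eq_zero e.open_target.measurableSet hKt ?_
        rintro y ⟨hy, hyK⟩
        rw [image_eq_zero_of_notMem_tsupport (f := chartPartition S j) (x := e.symm y)
          fun h => hyK ⟨_, h, e.right_inv hy⟩, zero_mul]
      rw [h1]
      rw [← Real.norm_eq_abs]
      refine norm_setIntegral_le_of_norm_le_const (μ := volume) hKc.measure_lt_top fun y hy => ?_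
      have hyt := hKt hy
      have h2 : ∀ i, |((γ (e.symm y) (chartFrame e (e.symm y) i) : LieT) : ℂ).im| ≤ ε := by
        intro i
        rw [localRep_single j hyt]
        refine (Complex.abs_im_le_norm _).trans ?_
        refine ((OneForm.localRep e γ y).le_opNorm (EuclideanSpace.single i 1)).trans ?_
        simpa using hγ y hy
      have h3 : |frameSign (o (e.symm y)) (chartFrame e (e.symm y))| ≤ 1 := by
        rcases frameSign_mem (o (e.symm y)) (chartFrame e (e.symm y)) with h | h | h <;>
        rw [h] <;> norm_num
      have h4 : |chartPartition S j (e.symm y)| ≤ 1 := by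
        rw [abs_of_nonneg ((chartPartition S).nonneg _ _)]
        exact (chartPartition S).le_one _ _
      unfold density
      rw [wedgePairing_apply, Real.norm_eq_abs, abs_mul, abs_mul, abs_div, abs_neg,
        abs_of_pos (show 0 < 4 * Real.pi ^ 2 by positivity)]
      have h5 : |((γ (e.symm y) (chartFrame e (e.symm y) 0) : LieT) : ℂ).im *
          ((β (e.symm y) (chartFrame e (e.symm y) 1) : LieT) : ℂ).im -
          ((γ (e.symm y) (chartFrame e (e.symm y) 1) : LieT) : ℂ).im *
          ((β (e.symm y) (chartFrame e (e.symm y) 0) : LieT) : ℂ).im| ≤ ε * C := by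
        refine (abs_sub _ _).trans ?_
        rw [abs_mul, abs_mul]
        have h6 := mul_le_mul (h2 0) ((hC₁ y hy).trans (le_abs_self _)) (abs_nonneg _) hε
        have h7 := mul_le_mul (h2 1) ((hC₀ y hy).trans (le_abs_self _)) (abs_nonneg _) hε
        simp only [C]
        linarith
      refine (mul_le_of_le_one_left (by positivity) h4).trans
        ((mul_le_of_le_one_left (by positivity) h3).trans ?_)
      gcongr
    rw [continuous_iff_continuousAt]
    intro α
    rw [Metric.continuousAt_iff']
    intro ε hε
    set B := C / (4 * Real.pi ^ 2) * volume.real K with hB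
    have hB0 : 0 ≤ B := by positivity
    -- `B` may be zero; adding `1` avoids a case distinction and gives the strict inequality.
    have hr : 0 < ε / (B + 1) := by positivity
    filter_upwards [OneForm.eventually_localRep j hKc hKt α hr] with γ hγ
    have h1 : t j γ = t j α + t j (γ - α) := by rw [← hadd, add_sub_cancel]
    rw [Real.dist_eq, h1, add_sub_cancel_left]
    refine (hbound _ _ hr.le fun y hy => (hγ y hy).le).trans_lt ?_
    have h2 : ε / (B + 1) * C / (4 * Real.pi ^ 2) * volume.real K = ε * (B / (B + 1)) := by
      rw [hB]; ring
    rw [h2]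
    refine mul_lt_of_lt_one_right hε ?_
    rw [div_lt_one (by positivity)]
    linarith
  simp only [surfaceIntegral_eq_sum]
  exact continuous_finsetSum _ fun j _ => ht j

/-- The exponential of a continuous linear function is smooth. -/
theorem frechetSmoothOn_exp {V : Type*} [AddCommGroup V] [Module ℝ V] [TopologicalSpace V]
    {ℓ : V → ℝ} (hℓ : Continuous ℓ) (hadd : ∀ v w, ℓ (v + w) = ℓ v + ℓ w)
    (hsmul : ∀ (t : ℝ) v, ℓ (t • v) = t * ℓ v) (c a : ℂ) (U : Set V) :
    FrechetSmoothOn (fun v => c * Complex.exp (a * ℓ v)) U := by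
  -- Each directional derivative multiplies the exponential by one more constant factor `a * ℓ (w
  -- i)`.
  refine ⟨fun j v w => c * Complex.exp (a * ℓ v) * ∏ i, (a * ℓ (w i)), ?_, ?_, ?_⟩
  · intro x _ w
    simp
  · intro j
    refine Continuous.continuousOn ?_
    have h1 : ∀ i : Fin j, Continuous fun p : V × (Fin j → V) => ℓ (p.2 i) := fun i =>
      hℓ.comp ((continuous_apply i).comp continuous_snd)
    have h2 : Continuous fun p : V × (Fin j → V) => ℓ p.1 := hℓ.comp continuous_fst
    fun_prop
  · intro j x _ v w
    have h1 : HasDerivAt (fun t : ℝ => a * ((ℓ (x + t • v) : ℝ) : ℂ)) (a * ℓ v) 0 := by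
      have h2 : HasDerivAt (fun t : ℝ => ((ℓ x + t * ℓ v : ℝ) : ℂ)) ((1 * ℓ v : ℝ) : ℂ) 0 :=
        (((hasDerivAt_id (0 : ℝ)).mul_const (ℓ v)).const_add (ℓ x)).ofReal_comp
      simp only [one_mul] at h2
      simpa only [hadd, hsmul] using h2.const_mul a
    have h3 := (h1.cexp.const_mul c).mul_const (∏ i, (a * (ℓ (w i) : ℂ)))
    beta_reduce
    rw [Fin.prod_univ_succ]
    simp only [Fin.cons_zero, Fin.cons_succ]
    simp only [zero_smul, add_zero] at h3
    refine h3.congr_deriv ?_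
    ring

variable {Q : CircleBundle S}

/-- The transition functions between the trivializations given by sections are smooth. -/
theorem connectionSmoothOn_csCocycle (k : ℤ) (o : SurfaceOrientation S) (s : GlobalSection Q)
    (l : Gauge S) (U : Set (Connection Q)) :
    ConnectionSmoothOn (fun η => (csCocycle k o (η.pullSection s) l : ℂ)) U := by
  intro η
  have hadd : ∀ α β : OneForm (𝓡 2) S LieT, surfaceIntegral o (wedgePairing (α + β) l.mc) =
      surfaceIntegral o (wedgePairing α l.mc) + surfaceIntegral o (wedgePairing β l.mc) :=
    fun α β => integral_wedge_add_left o α β l.mc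
  have hsmul : ∀ (t : ℝ) (α : OneForm (𝓡 2) S LieT), surfaceIntegral o (wedgePairing (t • α) l.mc) =
      t * surfaceIntegral o (wedgePairing α l.mc) := by
    intro t α
    have h1 : ∀ x, wedgePairing (t • α) l.mc x = t • wedgePairing α l.mc x := by
      intro x
      ext v
      rw [AlternatingMap.smul_apply, wedgePairing_apply, wedgePairing_apply]
      simp only [OneForm.smul_apply, Submodule.coe_smul, Complex.real_smul, Complex.im_ofReal_mul,
        smul_eq_mul]
      ring
    have h2 : ∀ x₀ x, density o (wedgePairing (t • α) l.mc) x₀ x =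
        t * density o (wedgePairing α l.mc) x₀ x := by
      intro x₀ x
      unfold density
      rw [h1, AlternatingMap.smul_apply, smul_eq_mul]
      ring
    rw [surfaceIntegral_eq_sum, surfaceIntegral_eq_sum, Finset.mul_sum]
    refine Finset.sum_congr rfl fun j _ => ?_
    rw [← integral_const_mul]
    congr 1
    funext y
    rw [h2]
    ring
  -- Since `s^*(η + π^*α) = s^*η + α`, in the affine chart at `η` the cocycle is its value at `η`
  -- times `exp(πik ∫ ⟨α ∧ λ^*ϑ⟩)`, whose exponent is linear in `α`.
  have h := frechetSmoothOn_exp (continuous_integral_wedge o l.mc) hadd hsmul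
    (csCocycle k o (η.pullSection s) l : ℂ) (Real.pi * k * Complex.I) {α | α +ᵥ η ∈ U}
  convert h using 2 with α
  beta_reduce
  rw [csCocycle, csCocycle, Connection.pullSection_vadd, integral_wedge_add_left, mul_add,
    Circle.exp_add, Circle.coe_mul]
  congr 1
  rw [Circle.coe_exp]
  congr 1
  push_cast
  ring

end Smooth

/-! ### Sections and connections under morphisms and disjoint unions -/

section Pullback

variable {S S' S₂ : Type*} [TopologicalSpace S] [ChartedSpace R2 S] [IsManifold (𝓡 2) ∞ S]
  [TopologicalSpace S'] [ChartedSpace R2 S'] [IsManifold (𝓡 2) ∞ S']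
  [TopologicalSpace S₂] [ChartedSpace R2 S₂] [IsManifold (𝓡 2) ∞ S₂]
  {Q : CircleBundle S} {Q' : CircleBundle S'} {Q₂ : CircleBundle S₂}

/-- The gauge transformation `λ ∘ ψ`. -/
def Gauge.compDiffeomorph (l : Gauge S) (ψ : Diffeomorph (𝓡 2) (𝓡 2) S' S ∞) : Gauge S' :=
  ⟨l ∘ ψ, l.contMDiff.comp ψ.contMDiff⟩

/-- Both sides pull `η` back along the same map, since `(ψ ∘ s' ∘ ψ̄⁻¹) ∘ ψ̄ = ψ ∘ s'`. -/
theorem BundleMorphism.pullSection_mapSection (ψ : BundleMorphism Q' Q) (η : Connection Q)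
    (s' : GlobalSection Q') :
    (η.pullSection (ψ.mapSection s')).pullback ψ.base ψ.base.contMDiff =
      (ψ.pullback η).pullSection s' := by
  unfold Connection.pullSection
  refine (OneForm.pullback_pullback _ _ _ _ _).trans
    (Eq.trans ?_ (OneForm.pullback_pullback s' s'.contMDiff' ψ.toFun ψ.contMDiff' η.form).symm)
  refine OneForm.pullback_congr _ _ (funext fun x => ?_) _
  change ψ.toFun (s' (ψ.base.symm (ψ.base x))) = ψ.toFun (s' x)
  rw [ψ.base.symm_apply_apply]

/-- The gauge transformation `λ ⊔ λ₂`. -/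
def Gauge.sum (l : Gauge S) (l₂ : Gauge S₂) : Gauge (S ⊕ S₂) :=
  ⟨Sum.elim l l₂, l.contMDiff.sumElim l₂.contMDiff⟩

theorem wedgePairing_inl (α β : OneForm (𝓡 2) (S ⊕ S₂) LieT) (x : S) :
    wedgePairing α β (Sum.inl x) = wedgePairing (α.pullback Sum.inl ContMDiff.inl)
      (β.pullback Sum.inl ContMDiff.inl) x := by
  ext v
  simp only [wedgePairing, OneForm.pullback_apply, hasMFDerivAt_inl.mfderiv, AlternatingMap.coe_mk,
    MultilinearMap.coe_mk]
  rfl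

theorem wedgePairing_inr (α β : OneForm (𝓡 2) (S ⊕ S₂) LieT) (x : S₂) :
    wedgePairing α β (Sum.inr x) = wedgePairing (α.pullback Sum.inr ContMDiff.inr)
      (β.pullback Sum.inr ContMDiff.inr) x := by
  ext v
  simp only [wedgePairing, OneForm.pullback_apply, hasMFDerivAt_inr.mfderiv, AlternatingMap.coe_mk,
    MultilinearMap.coe_mk]
  rfl

theorem Connection.pullSection_sum_inl (η : Connection Q) (η₂ : Connection Q₂)
    (s : GlobalSection Q) (s₂ : GlobalSection Q₂) :
    ((η.sum η₂).pullSection (s.sum s₂)).pullback Sum.inl ContMDiff.inl = η.pullSection s := by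
  have h1 := OneForm.pullback_inl_sum (M := Q.Total) (N := Q₂.Total) η.form η₂.form
  have h2 := OneForm.pullback_pullback s s.contMDiff' (Sum.inl : Q.Total → Q.Total ⊕ Q₂.Total)
    ContMDiff.inl (OneForm.sum (M := Q.Total) (N := Q₂.Total) η.form η₂.form)
  rw [h1] at h2
  exact (OneForm.pullback_pullback _ _ _ _ _).trans h2.symm

theorem Connection.pullSection_sum_inr (η : Connection Q) (η₂ : Connection Q₂)
    (s : GlobalSection Q) (s₂ : GlobalSection Q₂) :
    ((η.sum η₂).pullSection (s.sum s₂)).pullback Sum.inr ContMDiff.inr = η₂.pullSection s₂ := by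
  have h1 := OneForm.pullback_inr_sum (M := Q.Total) (N := Q₂.Total) η.form η₂.form
  have h2 := OneForm.pullback_pullback s₂ s₂.contMDiff' (Sum.inr : Q₂.Total → Q.Total ⊕ Q₂.Total)
    ContMDiff.inr (OneForm.sum (M := Q.Total) (N := Q₂.Total) η.form η₂.form)
  rw [h1] at h2
  exact (OneForm.pullback_pullback _ _ _ _ _).trans h2.symm

end Pullback

/-! ### The hermitian line bundle and the three isometries -/

section Isometries

variable {S : Type*} [TopologicalSpace S] [ChartedSpace R2 S] [IsManifold (𝓡 2) ∞ S]
  [CompactSpace S] [T2Space S] {k : ℤ} {o : SurfaceOrientation S} {Q : CircleBundle S}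

theorem finrank_csLine (hk : Even k) (hQ : Q.Trivializable) (η : Connection Q) :
    Module.finrank ℂ (CSLine k o η) = 1 := by
  obtain ⟨s⟩ := hQ.exists_section
  rw [(CSLine.evalEquiv k o η hk s).toLinearEquiv.finrank_eq, Module.finrank_self]

variable (o) in
/-- The trivialization of the Chern-Simons lines given by evaluation at a section. -/
def evalTrivialization (hk : Even k) (s : GlobalSection Q) :
    UnitaryTrivialization (fun η : Connection Q => CSLine k o η) where
  base := univ
  isOpen_base := isOpen_univ
  iso η _ := CSLine.evalEquiv k o η hk s

variable (o) in
/-- The hermitian line bundle formed by the Chern-Simons lines. -/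
def csLineBundle (hk : Even k) (hQ : Q.Trivializable) :
    SmoothHermitianLineBundle (fun η : Connection Q => CSLine k o η) where
  atlas := range (evalTrivialization o hk)
  cover _ := ⟨_, ⟨hQ.exists_section.some, rfl⟩, mem_univ _⟩
  smooth_transition := by
    -- The transition function from evaluation at `s` to evaluation at `s' = s · λ` is `η ↦ c(s^*η,
    -- λ)`.
    rintro _ ⟨s, rfl⟩ _ ⟨s', rfl⟩
    obtain ⟨l, hl⟩ := s.exists_gauge s'
    refine ⟨_, connectionSmoothOn_csCocycle k o s l _, fun η _ _ f => ?_⟩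
    exact (f.apply_smul hl).trans (mul_comm _ _)

section Functoriality

variable {S' : Type*} [TopologicalSpace S'] [ChartedSpace R2 S'] [IsManifold (𝓡 2) ∞ S']
  [CompactSpace S'] [T2Space S'] {o' : SurfaceOrientation S'} {Q' : CircleBundle S'}

/-- The cocycle is invariant under orientation preserving diffeomorphisms. -/
theorem csCocycle_pullback (ψ : Diffeomorph (𝓡 2) (𝓡 2) S' S ∞) (hψ : o'.IsPreservedBy o ψ)
    (α : OneForm (𝓡 2) S LieT) (l : Gauge S) :
    csCocycle k o' (α.pullback ψ ψ.contMDiff) (l.compDiffeomorph ψ) = csCocycle k o α l := by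
  have h1 : (l.compDiffeomorph ψ).mc = l.mc.pullback ψ ψ.contMDiff :=
    (OneForm.pullback_pullback ψ ψ.contMDiff l l.contMDiff maurerCartan).symm
  have h2 : wedgePairing (α.pullback ψ ψ.contMDiff) (l.mc.pullback ψ ψ.contMDiff) =
      (TwoForm.pullback ψ (wedgePairing α l.mc) : TwoForm S') := rfl
  rw [csCocycle, csCocycle, h1, h2]
  congr 2
  exact surfaceIntegral_pullback ψ hψ (wedgePairing_isCont _ _)
    (h2 ▸ wedgePairing_isCont _ _)

/-- The function `s' ↦ f (ψ ∘ s' ∘ ψ̄⁻¹)`. -/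
def CSLine.pullback (ψ : BundleMorphism Q' Q) (hψ : o'.IsPreservedBy o ψ.base)
    {η : Connection Q} (f : CSLine k o η) : CSLine k o' (ψ.pullback η) :=
  ⟨fun s' => f (ψ.mapSection s'), fun s s₁ l h => by
    let l' : Gauge S := l.compDiffeomorph ψ.base.symm
    have h1 : ∀ x, ψ.mapSection s₁ x = l' x • ψ.mapSection s x := fun x => by
      change ψ.toFun (s₁ _) = l (ψ.base.symm x) • ψ.toFun (s (ψ.base.symm x))
      rw [h, ψ.map_smul']
    have h2 : l'.compDiffeomorph ψ.base = l := ContMDiffMap.ext fun x =>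
      congrArg l (ψ.base.symm_apply_apply x)
    beta_reduce
    rw [f.apply_smul h1, ← csCocycle_pullback ψ.base hψ, ψ.pullSection_mapSection, h2]⟩

/-- Evaluation at `ψ ∘ s₀ ∘ ψ̄⁻¹` followed by the inverse of evaluation at `s₀` is an isometry. It
agrees with `ψ^*` at `s₀`, hence at every section, because `ψ^* f` lies in the line. -/
theorem exists_pullback_isometry (hk : Even k) (hQ' : Q'.Trivializable) (ψ : BundleMorphism Q' Q)
    (hψ : o'.IsPreservedBy o ψ.base) (η : Connection Q) :
    ∃ Ψ : CSLine k o η ≃ₗᵢ[ℂ] CSLine k o' (ψ.pullback η),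
      ∀ (f : CSLine k o η) (s' : GlobalSection Q'), Ψ f s' = f (ψ.mapSection s') := by
  obtain ⟨s₀⟩ := hQ'.exists_section
  refine ⟨(CSLine.evalEquiv k o η hk (ψ.mapSection s₀)).trans
    (CSLine.evalEquiv k o' (ψ.pullback η) hk s₀).symm, fun f s' => ?_⟩
  have h : (CSLine.evalEquiv k o' (ψ.pullback η) hk s₀).symm (f (ψ.mapSection s₀)) =
      f.pullback ψ hψ :=
    CSLine.ext_apply s₀ (CSLine.evalEquiv_symm_apply hk s₀ _)
  exact congrArg (fun g : CSLine k o' (ψ.pullback η) => g s') h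

end Functoriality

section Orientation

theorem csCocycle_neg (α : OneForm (𝓡 2) S LieT) (l : Gauge S) :
    csCocycle k (-o) α l = (csCocycle k o α l)⁻¹ := by
  rw [csCocycle, csCocycle, surfaceIntegral_neg, mul_neg, Circle.exp_neg]

/-- The conjugate function, in the line of the opposite orientation. -/
def CSLine.conjugate {η : Connection Q} (f : CSLine k (-o) η) : CSLine k o η :=
  ⟨fun s => conj (f s), fun s s₁ l h => by
    beta_reduce
    rw [f.apply_smul h, map_mul, csCocycle_neg, ← Circle.coe_inv_eq_conj, inv_inv]⟩

theorem exists_conjugate_isometry (hk : Even k) (hQ : Q.Trivializable) (η : Connection Q) :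
    ∃ Φ : CSLine k (-o) η ≃ₗᵢ⋆[ℂ] CSLine k o η,
      ∀ (f : CSLine k (-o) η) (s : GlobalSection Q), Φ f s = conj (f s) := by
  obtain ⟨s₀⟩ := hQ.exists_section
  refine ⟨((CSLine.evalEquiv k (-o) η hk s₀).trans (starₗᵢ ℂ : ℂ ≃ₗᵢ⋆[ℂ] ℂ)).trans
    (CSLine.evalEquiv k o η hk s₀).symm, fun f s => ?_⟩
  have h : (CSLine.evalEquiv k o η hk s₀).symm (conj (f s₀)) = f.conjugate :=
    CSLine.ext_apply s₀ (CSLine.evalEquiv_symm_apply hk s₀ _)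
  exact congrArg (fun g : CSLine k o η => g s) h

end Orientation

section DisjointUnion

variable {S₂ : Type*} [TopologicalSpace S₂] [ChartedSpace R2 S₂] [IsManifold (𝓡 2) ∞ S₂]
  [CompactSpace S₂] [T2Space S₂] {o₂ : SurfaceOrientation S₂} {Q₂ : CircleBundle S₂}

theorem csCocycle_sum (α : OneForm (𝓡 2) (S ⊕ S₂) LieT) (l : Gauge S) (l₂ : Gauge S₂) :
    csCocycle k (o.sum o₂) α (l.sum l₂) =
      csCocycle k o (α.pullback Sum.inl ContMDiff.inl) l *
        csCocycle k o₂ (α.pullback Sum.inr ContMDiff.inr) l₂ := by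
  have h1 : (l.sum l₂).mc.pullback Sum.inl ContMDiff.inl = l.mc :=
    OneForm.pullback_pullback _ _ _ _ _
  have h2 : (l.sum l₂).mc.pullback Sum.inr ContMDiff.inr = l₂.mc :=
    OneForm.pullback_pullback _ _ _ _ _
  rw [csCocycle, csCocycle, csCocycle, ← Circle.exp_add, ← mul_add,
    surfaceIntegral_disjointSum o o₂ (wedgePairing_isCont α (l.sum l₂).mc)
      (wedgePairing_inl α _) (wedgePairing_inr α _), h1, h2]

/-- The isometry is built from evaluations at `t`, `t₂` and `t ⊔ t₂`, so the formula holds there by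
construction. It propagates to all `s ⊔ s₂` because the cocycle of the disjoint union is the product
of the two cocycles. -/
theorem exists_tensor_isometry (hk : Even k) (hQ : Q.Trivializable) (hQ₂ : Q₂.Trivializable)
    (η : Connection Q) (η₂ : Connection Q₂) :
    ∃ Φ : CSLine k o η ⊗[ℂ] CSLine k o₂ η₂ ≃ₗᵢ[ℂ] CSLine k (o.sum o₂) (η.sum η₂),
      ∀ (f : CSLine k o η) (f₂ : CSLine k o₂ η₂) (s : GlobalSection Q)
        (s₂ : GlobalSection Q₂), Φ (f ⊗ₜ f₂) (s.sum s₂) = f s * f₂ s₂ := by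
  obtain ⟨t⟩ := hQ.exists_section
  obtain ⟨t₂⟩ := hQ₂.exists_section
  let Φ : CSLine k o η ⊗[ℂ] CSLine k o₂ η₂ ≃ₗᵢ[ℂ] CSLine k (o.sum o₂) (η.sum η₂) :=
    ((TensorProduct.congrIsometry (CSLine.evalEquiv k o η hk t)
      (CSLine.evalEquiv k o₂ η₂ hk t₂)).trans (TensorProduct.lidIsometry ℂ ℂ)).trans
    (CSLine.evalEquiv k (o.sum o₂) (η.sum η₂) hk (t.sum t₂)).symm
  refine ⟨Φ, fun f f₂ s s₂ => ?_⟩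
  have h0 : Φ (f ⊗ₜ f₂) (t.sum t₂) = f t * f₂ t₂ :=
    CSLine.evalEquiv_symm_apply hk (t.sum t₂) _
  obtain ⟨l, hl⟩ := t.exists_gauge s
  obtain ⟨l₂, hl₂⟩ := t₂.exists_gauge s₂
  have h1 : ∀ x, s.sum s₂ x = l.sum l₂ x • t.sum t₂ x := by
    rintro (x | x)
    · exact congrArg Sum.inl (hl x)
    · exact congrArg Sum.inr (hl₂ x)
  rw [CSLine.apply_smul _ h1, h0, csCocycle_sum, Connection.pullSection_sum_inl,
    Connection.pullSection_sum_inr, f.apply_smul hl, f₂.apply_smul hl₂, Circle.coe_mul]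
  ring

end DisjointUnion

end Isometries

end CSLines

end

/-- The Chern-Simons lines of the connections on trivializable circle bundles over closed oriented
surfaces, for an even level `k`. -/
theorem theoremt (k : ℤ) (hk : Even k)
    {S : Type*} [TopologicalSpace S] [ChartedSpace R2 S] [IsManifold (𝓡 2) ∞ S]
    [CompactSpace S] [T2Space S] (o : SurfaceOrientation S) :
    -- the cocycle identity
    (∀ (α : OneForm (𝓡 2) S LieT) (l₁ l₂ : Gauge S),
      csCocycle k o α (l₁ * l₂) = csCocycle k o α l₁ * csCocycle k o (α + l₁.mc) l₂) ∧
    -- the lines fit together smoothly into a hermitian line bundle over the space of connections,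
    -- which every section of `Q` trivializes by evaluation
    (∀ Q : CircleBundle S, Q.Trivializable →
      (∀ η : Connection Q, Module.finrank ℂ (CSLine k o η) = 1) ∧
      (∀ (η : Connection Q) (s : GlobalSection Q) (f g : CSLine k o η),
        inner ℂ f g = conj (f s) * g s) ∧
      ∃ L : SmoothHermitianLineBundle (fun η : Connection Q => CSLine k o η),
        ∀ s : GlobalSection Q, ∃ t ∈ L.atlas, t.base = univ ∧
          ∀ (η : Connection Q) (h : η ∈ t.base) (f : CSLine k o η), t.iso η h f = f s) ∧
    -- functoriality
    (∀ {S' : Type*} [TopologicalSpace S'] [ChartedSpace R2 S'] [IsManifold (𝓡 2) ∞ S']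
      [CompactSpace S'] [T2Space S'] (o' : SurfaceOrientation S')
      (Q' : CircleBundle S') (Q : CircleBundle S), Q'.Trivializable → Q.Trivializable →
      ∀ ψ : BundleMorphism Q' Q, o'.IsPreservedBy o ψ.base → ∀ η : Connection Q,
        ∃ Ψ : CSLine k o η ≃ₗᵢ[ℂ] CSLine k o' (ψ.pullback η),
          ∀ (f : CSLine k o η) (s' : GlobalSection Q'), Ψ f s' = f (ψ.mapSection s')) ∧
    -- orientation: an isometry to the conjugate line, that is, a conjugate-linear isometry
    (∀ Q : CircleBundle S, Q.Trivializable → ∀ η : Connection Q,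
      ∃ Φ : CSLine k (-o) η ≃ₗᵢ⋆[ℂ] CSLine k o η,
        ∀ (f : CSLine k (-o) η) (s : GlobalSection Q), Φ f s = conj (f s)) ∧
    -- disjoint union
    (∀ {S₂ : Type*} [TopologicalSpace S₂] [ChartedSpace R2 S₂] [IsManifold (𝓡 2) ∞ S₂]
      [CompactSpace S₂] [T2Space S₂] (o₂ : SurfaceOrientation S₂)
      (Q : CircleBundle S) (Q₂ : CircleBundle S₂), Q.Trivializable → Q₂.Trivializable →
      ∀ (η : Connection Q) (η₂ : Connection Q₂),
        ∃ Φ : CSLine k o η ⊗[ℂ] CSLine k o₂ η₂ ≃ₗᵢ[ℂ] CSLine k (o.sum o₂) (η.sum η₂),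
          ∀ (f : CSLine k o η) (f₂ : CSLine k o₂ η₂) (s : GlobalSection Q)
            (s₂ : GlobalSection Q₂), Φ (f ⊗ₜ f₂) (s.sum s₂) = f s * f₂ s₂) := by
  refine ⟨csCocycle_mul hk o, fun Q hQ => ⟨finrank_csLine hk hQ, fun η s => CSLine.inner_eq s,
      csLineBundle o hk hQ, fun s => ⟨evalTrivialization o hk s, ⟨s, rfl⟩, rfl, fun _ _ _ => rfl⟩⟩,
    fun {S'} _ _ _ _ _ o' Q' Q hQ' hQ ψ hψ η => exists_pullback_isometry hk hQ' ψ hψ η,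
    fun Q hQ η => exists_conjugate_isometry hk hQ η,
    fun {S₂} _ _ _ _ _ o₂ Q Q₂ hQ hQ₂ η η₂ => exists_tensor_isometry hk hQ hQ₂ η η₂⟩
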